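/- For $\lambda=x+iy\in\mathbb{C}$ let $G_\lambda$ be the group of Möbius transformations of the sphere $\hat{\mathbb{C}}$ generated by (the transformations induced by) $S=\begin{pmatrix}1&0\\1&1\end{pmatrix}$ and $T=\begin{pmatrix}1&2\lambda\\0&1\end{pmatrix}$. A circle in $\hat{\mathbb{C}}$ is a Euclidean circle or a line together with $\infty$; where needed, one of its sides is chosen as its interior, the other being its exterior. A group of Möbius transformations is *classical T-Schottky* if it has generators $g_1,\dots,g_n$ for which there are circles $C_i,C_i'$ $(1\le i\le n)$ whose $2n$ interiors are pairwise disjoint, such that $g_i$ maps the exterior of $C_i$ onto the interior of $C_i'$ for each $i$. For $p\ne q$ in $\hat{\mathbb{C}}$ let $H_{[p,q]}$ be the half-turn about the hyperbolic line with ends $p,q$, that is, the Möbius transformation of order two fixing $p$ and $q$. The axis of a Möbius transformation is the hyperbolic line joining its two fixed points, or the improper line $[u,u]$ if it is parabolic with fixed point $u$; a line is perpendicular to $[u,u]$ if $u$ is one of its ends. A non-elementary group of Möbius transformations is *nsdc* (a non-separating disjoint circle group) if it has a pair of generators $A,B$ whose axes have a common perpendicular $[n,n']$, $n\neq n'$,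 and for which $A=H_{[a,a']}H_{[n,n']}$, $B=H_{[b,b']}H_{[n,n']}$ with $a\ne a'$, $b\ne b'$, such that there are three circles, through $a,a'$, through $n,n'$ and through $b,b'$ respectively, that are pairwise disjoint or tangent and none of which separates the other two. Put $\mathcal{NSDC}=\{\lambda\in\mathbb{C}\setminus\{0\}: G_\lambda\text{ is nsdc}\}$ and $c\mathcal{S}=\{\lambda\in\mathbb{C}\setminus\{0\}: G_\lambda\text{ is classical T-Schottky}\}$, and let $\partial$ denote the topological boundary in $\mathbb{C}$. Then: 1. For $\lambda=|\lambda|e^{i\omega}\neq 0$: $\lambda\in\mathcal{NSDC}$ if and only if $|\lambda|(1+|\cos\omega|)\ge 4$, and $\lambda\in\partial\,\mathcal{NSDC}$ if and only if $|\lambda|(1+|\cos\omega|)=4$. In Cartesian coordinates, $\partial\,\mathcal{NSDC}=\{x+iy: y^2=16-8|x|\}$. 2. $\partial\, c\mathcal{S}=\{x+iy: |y|=1-x^2/4\}=\left\{\dfrac{2e^{i\omega}}{1+|\sin\omega|}:\omega\in\mathbb{R}\right\}$. -/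

import Mathlib

open Complex

noncomputable section

namespace TwoParabolic

/-- The complex sphere. -/
abbrev Sphere : Type := OnePoint ℂ

/-- The group of Möbius transformations of the complex sphere: the permutations
`z ↦ (a z + b) / (c z + d)` with `a d - b c ≠ 0`. -/
def mobius : Subgroup (Equiv.Perm Sphere) :=
  (MulAction.toPermHom (GL (Fin 2) ℂ) Sphere).range

/-- The Möbius transformation induced by an invertible matrix. -/
def ofMatrix (M : GL (Fin 2) ℂ) : Equiv.Perm Sphere :=
  MulAction.toPermHom (GL (Fin 2) ℂ) Sphere M

/-- A circle in the complex sphere (a Euclidean circle, or a Euclidean line together with `∞`) with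
a choice of one of its two sides as its interior. It is the zero set of
`a |z|² + 2 Re (conj b * z) + c`, where `|b|² - a c > 0`; the interior is where this is negative. -/
structure Circle where
  /-- The coefficient of `|z|²`. -/
  a : ℝ
  /-- The coefficient of the linear term. -/
  b : ℂ
  /-- The constant term. -/
  c : ℝ
  nondegenerate : a * c < normSq b

namespace Circle

/-- The defining function of a circle. The sign of its value at `∞` is that of `a`, or zero if
`a = 0`, in which case the circle is a line and passes through `∞`. -/
def form (C : Circle) : Sphere → ℝ
  | none => C.a
  | some z => C.a * normSq z + 2 * ((starRingEnd ℂ) C.b * z).re + C.c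

/-- The points on the circle. -/
def carrier (C : Circle) : Set Sphere := {p | C.form p = 0}

/-- The chosen side of the circle. -/
def interior (C : Circle) : Set Sphere := {p | C.form p < 0}

/-- The other side of the circle. -/
def exterior (C : Circle) : Set Sphere := {p | 0 < C.form p}

/-- Two circles are disjoint or tangent: they have at most one common point. -/
def DisjointOrTangent (C D : Circle) : Prop := (C.carrier ∩ D.carrier).Subsingleton

/-- The circle `C` separates `D` from `E`: there are points of `D` and of `E` that
lie on different sides of `C`. -/
def Separates (C D E : Circle) : Prop :=
  ((D.carrier ∩ C.interior).Nonempty ∧ (E.carrier ∩ C.exterior).Nonempty) ∨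
    ((D.carrier ∩ C.exterior).Nonempty ∧ (E.carrier ∩ C.interior).Nonempty)

end Circle

/-- The group generated by `g 0, …, g (n - 1)` is a marked classical T-Schottky group on these
generators: there are circles `C i`, `C' i` whose `2 n` interiors are pairwise
disjoint, such that the Möbius transformation `g i` maps the exterior of `C i` onto the interior of
`C' i`. -/
def IsMarkedClassicalTSchottky {n : ℕ} (g : Fin n → Equiv.Perm Sphere) : Prop :=
  (∀ i, g i ∈ mobius) ∧
    ∃ C C' : Fin n → Circle,
      Pairwise (fun s t : Fin n ⊕ Fin n =>
        Disjoint (Sum.elim C C' s).interior (Sum.elim C C' t).interior) ∧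
      ∀ i, g i '' (C i).exterior = (C' i).interior

/-- A classical T-Schottky group: marked classical T-Schottky on some set of generators. -/
def IsClassicalTSchottky (G : Subgroup (Equiv.Perm Sphere)) : Prop :=
  ∃ (n : ℕ) (g : Fin n → Equiv.Perm Sphere),
    Subgroup.closure (Set.range g) = G ∧ IsMarkedClassicalTSchottky g

/-- `h` is the half-turn about the hyperbolic line with distinct ends `x` and `y`, acting on the
sphere at infinity: the Möbius transformation of order two that fixes `x` and `y`. -/
def IsHalfTurn (h : Equiv.Perm Sphere) (x y : Sphere) : Prop :=
  x ≠ y ∧ h ∈ mobius ∧ h x = x ∧ h y = y ∧ h ≠ 1 ∧ h * h = 1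

/-- The proper hyperbolic line `[n, n']` is perpendicular to the axis of the Möbius transformation
`A`. If `A` is parabolic with fixed point `u`, its axis is the improper line `[u, u]`, and this means
that `u` is an end of `[n, n']`. Otherwise the axis is the line that joins the two fixed points of
`A`, and this means that the half-turn about `[n, n']` interchanges them. -/
def IsPerpendicularToAxis (n n' : Sphere) (A : Equiv.Perm Sphere) : Prop :=
  (∃ u, Function.fixedPoints A = {u} ∧ (u = n ∨ u = n')) ∨
    (∃ p q, p ≠ q ∧ Function.fixedPoints A = {p, q} ∧
      ∃ h, IsHalfTurn h n n' ∧ h p = q ∧ h q = p)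

/-- `(a, a', n, n', b, b')` is the ortho-end of the pair `A`, `B`: the line `[n, n']` is the common
perpendicular of the axes of `A` and `B`, and `A = H_[a, a'] H_[n, n']`,
`B = H_[b, b'] H_[n, n']`, where `H` denotes half-turns. -/
def IsOrthoEnd (A B : Equiv.Perm Sphere) (a a' n n' b b' : Sphere) : Prop :=
  IsPerpendicularToAxis n n' A ∧ IsPerpendicularToAxis n n' B ∧
    ∃ hA hN hB, IsHalfTurn hA a a' ∧ IsHalfTurn hN n n' ∧ IsHalfTurn hB b b' ∧
      A = hA * hN ∧ B = hB * hN

/-- The non-separating disjoint circle property of six points. -/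
def HasNSDCProperty (a a' n n' b b' : Sphere) : Prop :=
  a ≠ a' ∧ n ≠ n' ∧ b ≠ b' ∧
    ∃ CA CN CB : Circle,
      a ∈ CA.carrier ∧ a' ∈ CA.carrier ∧
      n ∈ CN.carrier ∧ n' ∈ CN.carrier ∧
      b ∈ CB.carrier ∧ b' ∈ CB.carrier ∧
      CA.DisjointOrTangent CN ∧ CN.DisjointOrTangent CB ∧ CA.DisjointOrTangent CB ∧
      ¬ CA.Separates CN CB ∧ ¬ CN.Separates CA CB ∧ ¬ CB.Separates CA CN

/-- The (non-elementary) group generated by `A` and `B` is a marked nsdc group. -/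
def IsMarkedNSDC (A B : Equiv.Perm Sphere) : Prop :=
  A ∈ mobius ∧ B ∈ mobius ∧
    ∃ a a' n n' b b', IsOrthoEnd A B a a' n n' b b' ∧ HasNSDCProperty a a' n n' b b'

/-- The (non-elementary) group `G` is an nsdc group: some pair of generators is marked nsdc. -/
def IsNSDC (G : Subgroup (Equiv.Perm Sphere)) : Prop :=
  ∃ A B, Subgroup.closure {A, B} = G ∧ IsMarkedNSDC A B

/-- The parabolic transformation `S`. -/
def S : Equiv.Perm Sphere :=
  ofMatrix (Matrix.GeneralLinearGroup.mkOfDetNeZero !![1, 0; 1, 1] (by simp))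

/-- The parabolic transformation `T = T_lam`. -/
def T (lam : ℂ) : Equiv.Perm Sphere :=
  ofMatrix (Matrix.GeneralLinearGroup.mkOfDetNeZero !![1, 2 * lam; 0, 1] (by simp))

/-- The group `G_lam` generated by `S` and `T`. -/
def G (lam : ℂ) : Subgroup (Equiv.Perm Sphere) := Subgroup.closure {S, T lam}

/-- Nsdc-space. The standing assumption `lam ≠ 0` says that `G lam` is non-elementary. -/
def nsdcSpace : Set ℂ := {lam | lam ≠ 0 ∧ IsNSDC (G lam)}

/-- Two-parabolic classical T-Schottky space. The standing assumption `lam ≠ 0` says that `G lam` is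
non-elementary. -/
def classicalTSchottkySpace : Set ℂ := {lam | lam ≠ 0 ∧ IsClassicalTSchottky (G lam)}

end TwoParabolic

end

/-! By the focus-directrix description of parabolas the theorem says that `G l`, for `l ≠ 0`, is
classical T-Schottky if and only if `2 ≤ ‖l‖ + |Im l|`, and nsdc if and only if
`4 ≤ ‖l‖ + |Re l|`. Each inequality suffices by an explicit choice of circles.

For the converse the unknown generators have to be compared with `S` and `T l`. In both cases
the group is a free Schottky group of rank two, in which `S` and `T l` are parabolic. The fixed
point of a parabolic cyclically reduced word lies on the circle of its first letter and on that
of the inverse of its last letter, so the images of this point under the final segments of the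
word are points of tangency between circles. As two of the four disjoint discs touch in at most
one point, a turn of the word, that is, the pair of circles between which it passes, determines
the rest of the path. As the words of `S` and of `T l` generate the free group, none of their
turns occurs twice. There are only six turns, so the two words have total length at most six; a
finite search, in which their images in `ℤ²` have determinant `±1` and neither of them is killed
by a homomorphism to the symmetric group on three points with nonabelian image, leaves total
length at most three.

Hence up to conjugation, inversion and exchange, `S` and `T l` are the Schottky generators, or
one of these and their product. The tangencies at their fixed points `0` and `∞` then place the
circles in the plane so that the inequality expresses that they do not overlap.
-/

noncomputable section

namespace TwoParabolic

open OnePoint Filter ComplexConjugate Topology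

/-! ### Circles and Möbius transformations -/

theorem ofMatrix_mem_mobius (M : GL (Fin 2) ℂ) : ofMatrix M ∈ mobius := ⟨M, rfl⟩

theorem exists_eq_ofMatrix {k : Equiv.Perm Sphere} (hk : k ∈ mobius) :
    ∃ M : GL (Fin 2) ℂ, k = ofMatrix M := by
  obtain ⟨M, rfl⟩ := hk
  exact ⟨M, rfl⟩

theorem ofMatrix_mul (M N : GL (Fin 2) ℂ) : ofMatrix (M * N) = ofMatrix M * ofMatrix N :=
  map_mul (MulAction.toPermHom (GL (Fin 2) ℂ) Sphere) M N

/-- The point of the sphere with homogeneous coordinates `(z, w) ≠ (0, 0)`. -/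
def ofRatio (z w : ℂ) : Sphere := if w = 0 then ∞ else ((z / w : ℂ) : Sphere)

theorem ofMatrix_coe (M : GL (Fin 2) ℂ) (z : ℂ) :
    ofMatrix M (z : Sphere) = ofRatio (M 0 0 * z + M 0 1) (M 1 0 * z + M 1 1) :=
  smul_some_eq_ite

theorem ofMatrix_infty (M : GL (Fin 2) ℂ) : ofMatrix M ∞ = ofRatio (M 0 0) (M 1 0) :=
  smul_infty_eq_ite M

theorem eq_zero_of_mulVec_eq_zero (M : GL (Fin 2) ℂ) {z w : ℂ}
    (h₀ : M 0 0 * z + M 0 1 * w = 0) (h₁ : M 1 0 * z + M 1 1 * w = 0) : z = 0 ∧ w = 0 := by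
  have hdet : M 0 0 * M 1 1 - M 0 1 * M 1 0 ≠ 0 := by
    rw [← Matrix.det_fin_two]
    exact M.det_ne_zero
  constructor
  · refine (mul_eq_zero.1 ?_).resolve_left hdet
    linear_combination M 1 1 * h₀ - M 0 1 * h₁
  · refine (mul_eq_zero.1 ?_).resolve_left hdet
    linear_combination M 0 0 * h₁ - M 1 0 * h₀

theorem exists_mobius_apply_eq_infty (p : Sphere) : ∃ k ∈ mobius, k p = ∞ := by
  induction p using OnePoint.rec with
  | infty => exact ⟨1, mobius.one_mem, rfl⟩
  | coe z =>
    refine ⟨ofMatrix (Matrix.GeneralLinearGroup.mkOfDetNeZero !![0, 1; 1, -z] (by simp)),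
      ofMatrix_mem_mobius _, ?_⟩
    simp [ofMatrix_coe, ofRatio, Matrix.GeneralLinearGroup.mkOfDetNeZero]

namespace Circle

variable {C D E : Circle} {k : Equiv.Perm Sphere}

@[simp] theorem form_coe (C : Circle) (z : ℂ) :
    C.form (z : Sphere) = C.a * normSq z + 2 * (conj C.b * z).re + C.c := rfl

@[simp] theorem form_infty (C : Circle) : C.form ∞ = C.a := rfl

/-- The Hermitian form in homogeneous coordinates that defines a circle. -/
def hform (C : Circle) (z w : ℂ) : ℝ :=
  C.a * normSq z + 2 * (conj C.b * z * conj w).re + C.c * normSq w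

theorem sign_form_ofRatio (C : Circle) {z w : ℂ} (h : ¬(z = 0 ∧ w = 0)) :
    SignType.sign (C.form (ofRatio z w)) = SignType.sign (C.hform z w) := by
  rw [ofRatio]
  split_ifs with hw
  · have hz : 0 < normSq z := normSq_pos.2 fun hz => h ⟨hz, hw⟩
    simp [hform, hw, sign_mul, sign_pos hz]
  · have hw' : 0 < normSq w := normSq_pos.2 hw
    have hform_eq : C.hform z w = normSq w * C.form ((z / w : ℂ) : Sphere) := by
      obtain ⟨u, rfl⟩ : ∃ u, z = u * w := ⟨z / w, (div_mul_cancel₀ z hw).symm⟩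
      have hre : (conj C.b * (u * w) * conj w).re = normSq w * (conj C.b * u).re := by
        rw [← re_ofReal_mul, normSq_eq_conj_mul_self]; congr 1; ring
      rw [mul_div_cancel_right₀ u hw, hform, form_coe, normSq_mul, hre]
      ring
    rw [hform_eq, sign_mul, sign_pos hw', one_mul]

/-- The preimage of a circle, with its sides, under a Möbius transformation. -/
def pull (M : GL (Fin 2) ℂ) (C : Circle) : Circle where
  a := C.hform (M 0 0) (M 1 0)
  b := conj (C.a * (M 0 0 * conj (M 0 1)) + conj C.b * (M 0 0 * conj (M 1 1))
    + C.b * (M 1 0 * conj (M 0 1)) + C.c * (M 1 0 * conj (M 1 1)))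
  c := C.hform (M 0 1) (M 1 1)
  nondegenerate := by
    have hdet : 0 < normSq (M 0 0 * M 1 1 - M 0 1 * M 1 0) := by
      rw [normSq_pos, ← Matrix.det_fin_two]
      exact M.det_ne_zero
    -- the discriminant of a Hermitian form is multiplied by the squared modulus of the determinant
    rw [← sub_pos]
    refine (mul_pos hdet (sub_pos.2 C.nondegenerate)).trans_eq ?_
    simp only [hform, normSq_apply, conj_re, conj_im, mul_re, mul_im, add_re, add_im, ofReal_re,
      ofReal_im, sub_re, sub_im]
    ring

theorem hform_pull (C : Circle) (M : GL (Fin 2) ℂ) (z w : ℂ) :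
    (C.pull M).hform z w = C.hform (M 0 0 * z + M 0 1 * w) (M 1 0 * z + M 1 1 * w) := by
  simp only [hform, pull, normSq_apply, conj_re, conj_im, mul_re, mul_im, add_re, add_im,
    ofReal_re, ofReal_im]
  ring

/-- `D` is the image of `C`, with its sides, under `k`. -/
def IsImage (k : Equiv.Perm Sphere) (C D : Circle) : Prop :=
  ∀ p, SignType.sign (D.form (k p)) = SignType.sign (C.form p)

theorem isImage_pull (M : GL (Fin 2) ℂ) (C : Circle) : IsImage (ofMatrix M) (C.pull M) C := by
  intro p
  induction p using OnePoint.rec with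
  | infty =>
    rw [ofMatrix_infty, sign_form_ofRatio]
    · rfl
    · rintro ⟨h₀, h₁⟩
      simpa using eq_zero_of_mulVec_eq_zero M (z := 1) (w := 0) (by simpa using h₀)
        (by simpa using h₁)
  | coe z =>
    rw [ofMatrix_coe, sign_form_ofRatio]
    · have h := C.hform_pull M z 1
      rw [mul_one, mul_one] at h
      rw [← h]
      simp [hform]
    · rintro ⟨h₀, h₁⟩
      simpa using eq_zero_of_mulVec_eq_zero M (z := z) (w := 1) (by simpa using h₀)
        (by simpa using h₁)

theorem exists_isImage (hk : k ∈ mobius) (C : Circle) : ∃ D, IsImage k C D := by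
  obtain ⟨M, hM⟩ := exists_eq_ofMatrix (mobius.inv_mem hk)
  refine ⟨C.pull M, fun p => ?_⟩
  have h := isImage_pull M C (k p)
  rw [← hM, Equiv.Perm.coe_inv, k.symm_apply_apply] at h
  exact h.symm

/-- The same circle with its sides interchanged. -/
def flip (C : Circle) : Circle where
  a := -C.a
  b := -C.b
  c := -C.c
  nondegenerate := by simpa using C.nondegenerate

@[simp] theorem form_flip (C : Circle) (p : Sphere) : C.flip.form p = -C.form p := by
  induction p using OnePoint.rec with
  | infty => rfl
  | coe z =>
    simp only [form_coe, flip, map_neg, neg_mul, neg_re]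
    ring

theorem flip_flip (C : Circle) : C.flip.flip = C := by
  cases C; simp [flip]

theorem interior_flip (C : Circle) : C.flip.interior = C.exterior := by
  ext p; simp [interior, exterior]

theorem carrier_flip (C : Circle) : C.flip.carrier = C.carrier := by
  ext p; simp [carrier]

namespace IsImage

theorem neg_iff (h : IsImage k C D) (p : Sphere) : D.form (k p) < 0 ↔ C.form p < 0 := by
  rw [← sign_eq_neg_one_iff, h p, sign_eq_neg_one_iff]

theorem pos_iff (h : IsImage k C D) (p : Sphere) : 0 < D.form (k p) ↔ 0 < C.form p := by
  rw [← sign_eq_one_iff, h p, sign_eq_one_iff]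

theorem zero_iff (h : IsImage k C D) (p : Sphere) : D.form (k p) = 0 ↔ C.form p = 0 := by
  rw [← sign_eq_zero_iff, h p, sign_eq_zero_iff]

theorem nonpos_iff (h : IsImage k C D) (p : Sphere) : D.form (k p) ≤ 0 ↔ C.form p ≤ 0 := by
  rw [← not_lt, h.pos_iff, not_lt]

theorem interior_eq (h : IsImage k C D) : D.interior = k '' C.interior := by
  ext p
  obtain ⟨q, rfl⟩ := k.surjective p
  simp [interior, h.neg_iff]

theorem disjoint_iff {C' D' : Circle} (hC : IsImage k C C') (hD : IsImage k D D') :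
    Disjoint C'.interior D'.interior ↔ Disjoint C.interior D.interior := by
  rw [hC.interior_eq, hD.interior_eq, Set.disjoint_image_iff k.injective]

theorem inv (h : IsImage k C D) : IsImage k⁻¹ D C := fun p => by
  rw [← h (k⁻¹ p), Equiv.Perm.coe_inv, k.apply_symm_apply]

theorem flip (h : IsImage k C D) : IsImage k C.flip D.flip := fun p => by
  rw [form_flip, form_flip, Left.sign_neg, Left.sign_neg, h p]

theorem flip_left (h : IsImage k C.flip D) : IsImage k C D.flip := by
  simpa only [flip_flip] using h.flip

theorem trans {k' : Equiv.Perm Sphere} (h : IsImage k C D) (h' : IsImage k' D E) :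
    IsImage (k' * k) C E := fun p => (h' (k p)).trans (h p)

theorem image_exterior (h : IsImage k C.flip D) : k '' C.exterior = D.interior := by
  rw [h.interior_eq, interior_flip]

end IsImage

theorem form_add_mul (C : Circle) (z v : ℂ) (t : ℝ) :
    C.form ((z + t * v : ℂ) : Sphere)
      = C.a * normSq v * t ^ 2 + 2 * (conj (C.a * z + C.b) * v).re * t + C.form z := by
  simp only [form_coe, normSq_apply, conj_re, conj_im, mul_re, mul_im, add_re, add_im, ofReal_re,
    ofReal_im]
  ring

theorem eventually_form_ray_neg_of_a_neg (hC : C.a < 0) (z : ℂ) {v : ℂ} (hv : v ≠ 0) :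
    ∀ᶠ t : ℝ in atTop, C.form ((z + t * v : ℂ) : Sphere) < 0 := by
  have hlead : C.a * normSq v < 0 := mul_neg_of_neg_of_pos hC (normSq_pos.2 hv)
  have hlin : Tendsto (fun t : ℝ => C.a * normSq v * t + 2 * (conj (C.a * z + C.b) * v).re)
      atTop atBot :=
    tendsto_atBot_add_const_right _ _ (tendsto_id.const_mul_atTop_of_neg hlead)
  filter_upwards [(tendsto_atBot_add_const_right _ (C.form z)
    (tendsto_id.atTop_mul_atBot₀ hlin)).eventually_lt_atBot 0] with t ht
  rw [form_add_mul]
  refine lt_of_eq_of_lt ?_ ht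
  simp only [id]
  ring

theorem eventually_form_ray_neg_of_a_eq_zero (hC : C.a = 0) (z : ℂ) {v : ℂ}
    (hv : (conj C.b * v).re < 0) : ∀ᶠ t : ℝ in atTop, C.form ((z + t * v : ℂ) : Sphere) < 0 := by
  filter_upwards [(tendsto_atBot_add_const_right _ (C.form z) (tendsto_id.const_mul_atTop_of_neg
    (show 2 * (conj C.b * v).re < 0 by linarith))).eventually_lt_atBot 0] with t ht
  simpa only [form_add_mul, hC, ofReal_zero, zero_mul, zero_add, id] using ht

theorem b_ne_zero_of_a_eq_zero (hC : C.a = 0) : C.b ≠ 0 := by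
  have h := C.nondegenerate
  rw [hC, zero_mul] at h
  exact normSq_pos.1 h

theorem b_ne_zero_of_c_eq_zero (hC : C.c = 0) : C.b ≠ 0 := by
  have h := C.nondegenerate
  rw [hC, mul_zero] at h
  exact normSq_pos.1 h

theorem conj_b_mul_neg_b_re_neg (hC : C.a = 0) : (conj C.b * -C.b).re < 0 := by
  have h := normSq_pos.2 (b_ne_zero_of_a_eq_zero hC)
  rwa [mul_neg, neg_re, ← normSq_eq_conj_mul_self, ofReal_re, neg_lt_zero]

theorem exists_form_coe_neg (C : Circle) : ∃ z : ℂ, C.form z < 0 := by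
  rcases lt_trichotomy C.a 0 with h | h | h
  · obtain ⟨t, ht⟩ := (eventually_form_ray_neg_of_a_neg h 0 one_ne_zero).exists
    exact ⟨_, ht⟩
  · obtain ⟨t, ht⟩ :=
      (eventually_form_ray_neg_of_a_eq_zero h 0 (conj_b_mul_neg_b_re_neg h)).exists
    exact ⟨_, ht⟩
  · refine ⟨-(C.b / C.a), ?_⟩
    have hcenter : C.form ((-(C.b / C.a) : ℂ) : Sphere) = (C.a * C.c - normSq C.b) / C.a := by
      have hre : (conj C.b * (C.b / C.a)).re = normSq C.b / C.a := by
        rw [← mul_div_assoc, ← normSq_eq_conj_mul_self, ← ofReal_div, ofReal_re]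
      rw [form_coe, normSq_neg, normSq_div, normSq_ofReal, mul_neg, neg_re, hre]
      field_simp
      ring
    rw [hcenter]
    exact div_neg_of_neg_of_pos (sub_neg.2 C.nondegenerate) h

/-- The interior of a circle accumulates at each point of the circle, so a strict inequality at such
a point persists somewhere in the interior. -/
theorem exists_form_neg_and_form_neg {p : Sphere} (hC : C.form p ≤ 0) (hD : D.form p < 0) :
    ∃ q, C.form q < 0 ∧ D.form q < 0 := by
  rcases hC.lt_or_eq with hC | hC
  · exact ⟨p, hC, hD⟩
  obtain ⟨k, hk, hp⟩ := exists_mobius_apply_eq_infty p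
  obtain ⟨C', hC'⟩ := exists_isImage hk C
  obtain ⟨D', hD'⟩ := exists_isImage hk D
  rw [← hC'.zero_iff, hp, form_infty] at hC
  rw [← hD'.neg_iff, hp, form_infty] at hD
  obtain ⟨t, hCt, hDt⟩ :=
    ((eventually_form_ray_neg_of_a_eq_zero hC 0 (conj_b_mul_neg_b_re_neg hC)).and
      (eventually_form_ray_neg_of_a_neg hD 0 (neg_ne_zero.2 (b_ne_zero_of_a_eq_zero hC)))).exists
  refine ⟨k⁻¹ ((0 + t * -C'.b : ℂ) : Sphere), ?_, ?_⟩
  · rwa [← hC'.neg_iff, Equiv.Perm.coe_inv, k.apply_symm_apply]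
  · rwa [← hD'.neg_iff, Equiv.Perm.coe_inv, k.apply_symm_apply]

theorem form_nonneg_of_disjoint (h : Disjoint C.interior D.interior) {p : Sphere}
    (hp : C.form p ≤ 0) : 0 ≤ D.form p := by
  by_contra! hD
  obtain ⟨q, hCq, hDq⟩ := exists_form_neg_and_form_neg hp hD
  exact Set.disjoint_left.1 h hCq hDq

theorem form_eq_zero_of_disjoint (h : Disjoint C.interior D.interior) {p : Sphere}
    (hC : C.form p ≤ 0) (hD : D.form p ≤ 0) : C.form p = 0 ∧ D.form p = 0 :=
  ⟨le_antisymm hC (form_nonneg_of_disjoint h.symm hD),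
    le_antisymm hD (form_nonneg_of_disjoint h hC)⟩

theorem sameRay_neg_of_disjoint_halfPlanes (hC : C.a = 0) (hD : D.a = 0)
    (h : Disjoint C.interior D.interior) : SameRay ℝ C.b (-D.b) := by
  by_contra hray
  have hlt : -(inner ℝ C.b D.b) < ‖C.b‖ * ‖D.b‖ := by
    rw [← inner_neg_right, ← norm_neg D.b, inner_lt_norm_mul_iff_real]
    exact fun heq => hray (sameRay_iff_norm_smul_eq.2 heq.symm)
  have hCb : 0 < ‖C.b‖ := norm_pos_iff.2 (b_ne_zero_of_a_eq_zero hC)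
  have hDb : 0 < ‖D.b‖ := norm_pos_iff.2 (b_ne_zero_of_a_eq_zero hD)
  -- both half-planes contain the far part of the ray that bisects their inner normals
  set v : ℂ := -(‖D.b‖ • C.b + ‖C.b‖ • D.b) with hv
  have hCv : (conj C.b * v).re < 0 := by
    have : (conj C.b * v).re = -(‖C.b‖ * (‖C.b‖ * ‖D.b‖ + inner ℝ C.b D.b)) := by
      rw [mul_comm, ← Complex.inner, hv, inner_neg_right, inner_add_right, inner_smul_right,
        inner_smul_right, real_inner_self_eq_norm_sq]
      ring
    rw [this]
    exact neg_lt_zero.2 (mul_pos hCb (by linarith))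
  have hDv : (conj D.b * v).re < 0 := by
    have : (conj D.b * v).re = -(‖D.b‖ * (‖C.b‖ * ‖D.b‖ + inner ℝ C.b D.b)) := by
      rw [mul_comm, ← Complex.inner, hv, inner_neg_right, inner_add_right, inner_smul_right,
        inner_smul_right, real_inner_self_eq_norm_sq, real_inner_comm]
      ring
    rw [this]
    exact neg_lt_zero.2 (mul_pos hDb (by linarith))
  obtain ⟨t, hCt, hDt⟩ := ((eventually_form_ray_neg_of_a_eq_zero hC 0 hCv).and
    (eventually_form_ray_neg_of_a_eq_zero hD 0 hDv)).exists
  exact Set.disjoint_left.1 h hCt hDt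

theorem exists_b_eq_neg_mul (hC : C.a = 0) (hD : D.a = 0)
    (h : Disjoint C.interior D.interior) : ∃ μ : ℝ, 0 < μ ∧ D.b = -(μ * C.b) := by
  obtain ⟨μ, hμ, heq⟩ := (sameRay_neg_of_disjoint_halfPlanes hC hD h).exists_pos_left
    (b_ne_zero_of_a_eq_zero hC) (neg_ne_zero.2 (b_ne_zero_of_a_eq_zero hD))
  refine ⟨μ, hμ, ?_⟩
  rw [← real_smul, heq, neg_neg]

theorem not_pairwise_disjoint_halfPlanes (hC : C.a = 0) (hD : D.a = 0) (hE : E.a = 0)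
    (hCD : Disjoint C.interior D.interior) (hCE : Disjoint C.interior E.interior)
    (hDE : Disjoint D.interior E.interior) : False := by
  have hCb := b_ne_zero_of_a_eq_zero hC
  have hDE' : SameRay ℝ D.b E.b := sameRay_neg_iff.1 <|
    (sameRay_neg_of_disjoint_halfPlanes hC hD hCD).symm.trans
      (sameRay_neg_of_disjoint_halfPlanes hC hE hCE) fun h => absurd h hCb
  refine b_ne_zero_of_a_eq_zero hE (eq_zero_of_sameRay_self_neg (R := ℝ) ?_)
  exact hDE'.symm.trans (sameRay_neg_of_disjoint_halfPlanes hD hE hDE) fun h =>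
    absurd h (b_ne_zero_of_a_eq_zero hD)

theorem not_common_of_disjoint (hCD : Disjoint C.interior D.interior)
    (hCE : Disjoint C.interior E.interior) (hDE : Disjoint D.interior E.interior) {p : Sphere}
    (hC : C.form p = 0) (hD : D.form p = 0) (hE : E.form p = 0) : False := by
  obtain ⟨k, hk, hp⟩ := exists_mobius_apply_eq_infty p
  obtain ⟨C', hC'⟩ := exists_isImage hk C
  obtain ⟨D', hD'⟩ := exists_isImage hk D
  obtain ⟨E', hE'⟩ := exists_isImage hk E
  rw [← hC'.zero_iff, hp] at hC
  rw [← hD'.zero_iff, hp] at hD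
  rw [← hE'.zero_iff, hp] at hE
  exact not_pairwise_disjoint_halfPlanes hC hD hE ((hC'.disjoint_iff hD').2 hCD)
    ((hC'.disjoint_iff hE').2 hCE) ((hD'.disjoint_iff hE').2 hDE)

/-- Two circles with disjoint interiors that meet twice have complementary interiors, which leaves
no room for a third one. -/
theorem eq_of_common_of_disjoint (hCD : Disjoint C.interior D.interior)
    (hCE : Disjoint C.interior E.interior) (hDE : Disjoint D.interior E.interior) {p q : Sphere}
    (hCp : C.form p = 0) (hDp : D.form p = 0) (hCq : C.form q = 0) (hDq : D.form q = 0) :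
    p = q := by
  obtain ⟨k, hk, hp⟩ := exists_mobius_apply_eq_infty p
  obtain ⟨C', hC'⟩ := exists_isImage hk C
  obtain ⟨D', hD'⟩ := exists_isImage hk D
  obtain ⟨E', hE'⟩ := exists_isImage hk E
  rw [← hC'.zero_iff] at hCp hCq
  rw [← hD'.zero_iff] at hDp hDq
  rw [hp, form_infty] at hCp hDp
  rw [← hC'.disjoint_iff hD'] at hCD
  rw [← hC'.disjoint_iff hE'] at hCE
  rw [← hD'.disjoint_iff hE'] at hDE
  by_contra hne
  obtain ⟨w, hw⟩ := OnePoint.ne_infty_iff_exists.1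
    fun h : k q = ∞ => hne (k.injective (hp.trans h.symm))
  rw [← hw, form_coe] at hCq hDq
  obtain ⟨μ, hμ, hb⟩ := exists_b_eq_neg_mul hCp hDp hCD
  obtain ⟨z, hz⟩ := E'.exists_form_coe_neg
  have hCz : 0 ≤ C'.form z := form_nonneg_of_disjoint hCE.symm hz.le
  have hDz : 0 ≤ D'.form z := form_nonneg_of_disjoint hDE.symm hz.le
  have hcompl : D'.form z = -μ * C'.form z := by
    simp only [form_coe, hCp, hDp, hb, map_neg, map_mul, conj_ofReal, neg_mul, neg_re] at *
    rw [mul_assoc, re_ofReal_mul] at *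
    linear_combination hDq + μ * hCq
  have hCz' : C'.form z ≤ 0 := by nlinarith
  exact absurd hz (form_nonneg_of_disjoint hCE hCz').not_gt

end Circle

/-! ### Parabolic transformations -/

theorem T_mem_mobius (lam : ℂ) : T lam ∈ mobius := ofMatrix_mem_mobius _

theorem S_mem_mobius : S ∈ mobius := ofMatrix_mem_mobius _

@[simp] theorem T_coe (lam z : ℂ) : T lam (z : Sphere) = ((z + 2 * lam : ℂ) : Sphere) := by
  rw [T, ofMatrix_coe]
  simp [ofRatio, Matrix.GeneralLinearGroup.mkOfDetNeZero]

@[simp] theorem T_infty (lam : ℂ) : T lam ∞ = ∞ := by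
  rw [T, ofMatrix_infty]
  simp [ofRatio, Matrix.GeneralLinearGroup.mkOfDetNeZero]

theorem S_coe (z : ℂ) : S (z : Sphere) = ofRatio z (z + 1) := by
  rw [S, ofMatrix_coe]
  simp [Matrix.GeneralLinearGroup.mkOfDetNeZero]

theorem S_infty : S ∞ = ((1 : ℂ) : Sphere) := by
  rw [S, ofMatrix_infty]
  simp [ofRatio, Matrix.GeneralLinearGroup.mkOfDetNeZero]

theorem T_inv (lam : ℂ) : (T lam)⁻¹ = T (-lam) := by
  rw [inv_eq_iff_mul_eq_one]
  ext p
  induction p using OnePoint.rec with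
  | infty => simp
  | coe z => simp

/-- The Möbius transformation `z ↦ c / z`, which interchanges the roles of `S` and `T`. -/
def invol (c : ℂ) (hc : c ≠ 0) : Equiv.Perm Sphere :=
  ofMatrix (Matrix.GeneralLinearGroup.mkOfDetNeZero !![0, c; 1, 0] (by simpa using hc))

theorem invol_mem_mobius (c : ℂ) (hc : c ≠ 0) : invol c hc ∈ mobius := ofMatrix_mem_mobius _

theorem invol_zero (c : ℂ) (hc : c ≠ 0) : invol c hc ((0 : ℂ) : Sphere) = ∞ := by
  rw [invol, ofMatrix_coe]
  simp [ofRatio, Matrix.GeneralLinearGroup.mkOfDetNeZero]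

theorem invol_mul_S (c : ℂ) (hc : c ≠ 0) : invol c hc * S = T (c / 2) * invol c hc := by
  rw [invol, S, T, ← ofMatrix_mul, ← ofMatrix_mul]
  congr 1
  ext i j
  fin_cases i <;> fin_cases j <;>
    simp [Matrix.GeneralLinearGroup.mkOfDetNeZero, Matrix.mul_apply, mul_div_cancel₀]

theorem invol_mul_T (lam : ℂ) (hl : 2 * lam ≠ 0) :
    invol (2 * lam) hl * T lam = S * invol (2 * lam) hl := by
  rw [invol, S, T, ← ofMatrix_mul, ← ofMatrix_mul]
  congr 1
  ext i j
  fin_cases i <;> fin_cases j <;>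
    simp [Matrix.GeneralLinearGroup.mkOfDetNeZero, Matrix.mul_apply]

/-- `f` is parabolic with fixed point `p`: it is conjugate to a translation, by a Möbius
transformation that carries `p` to `∞`. -/
def IsParabolicAt (f : Equiv.Perm Sphere) (p : Sphere) : Prop :=
  ∃ k ∈ mobius, ∃ t : ℂ, t ≠ 0 ∧ k p = ∞ ∧ k * f = T t * k

theorem isParabolicAt_T {lam : ℂ} (hl : lam ≠ 0) : IsParabolicAt (T lam) ∞ :=
  ⟨1, mobius.one_mem, lam, hl, rfl, by simp⟩

theorem isParabolicAt_S : IsParabolicAt S ((0 : ℂ) : Sphere) :=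
  ⟨invol 1 one_ne_zero, invol_mem_mobius _ _, 1 / 2, by norm_num, invol_zero _ _,
    invol_mul_S _ _⟩

namespace IsParabolicAt

variable {f : Equiv.Perm Sphere} {p : Sphere}

theorem conjugate (h : IsParabolicAt f p) {g : Equiv.Perm Sphere} (hg : g ∈ mobius) :
    IsParabolicAt (g * f * g⁻¹) (g p) := by
  obtain ⟨k, hk, t, ht, hp, hf⟩ := h
  refine ⟨k * g⁻¹, mobius.mul_mem hk (mobius.inv_mem hg), t, ht, by simpa using hp, ?_⟩
  rw [← mul_assoc (T t), ← hf]
  group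

theorem inv (h : IsParabolicAt f p) : IsParabolicAt f⁻¹ p := by
  obtain ⟨k, hk, t, ht, hp, hf⟩ := h
  refine ⟨k, hk, -t, neg_ne_zero.2 ht, hp, ?_⟩
  rw [← T_inv, eq_inv_mul_iff_mul_eq, ← mul_assoc, ← hf, mul_inv_cancel_right]

theorem apply_eq_iff (h : IsParabolicAt f p) (q : Sphere) : f q = q ↔ q = p := by
  obtain ⟨k, -, t, ht, hp, hf⟩ := h
  rw [← k.injective.eq_iff, ← k.injective.eq_iff (a := q), hp, ← Equiv.Perm.mul_apply, hf,
    Equiv.Perm.mul_apply]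
  induction k q using OnePoint.rec with
  | infty => simp
  | coe z => simp [ht]

theorem apply_self (h : IsParabolicAt f p) : f p = p := (h.apply_eq_iff p).2 rfl

end IsParabolicAt

theorem Circle.a_nonpos_of_translate {D : Circle} {t : ℂ} (ht : t ≠ 0)
    (hD : ∀ q, D.form q ≤ 0 → D.form (T t q) ≤ 0) : D.a ≤ 0 := by
  by_contra! ha
  obtain ⟨z, hz⟩ := D.exists_form_coe_neg
  have horbit : ∀ n : ℕ, D.form ((z + (n : ℝ) * (2 * t) : ℂ) : Sphere) ≤ 0 := by
    intro n
    induction n with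
    | zero => simpa using hz.le
    | succ n ih =>
      have := hD _ ih
      rw [T_coe] at this
      convert this using 3
      push_cast; ring
  have hescape := tendsto_natCast_atTop_atTop.eventually
    (D.flip.eventually_form_ray_neg_of_a_neg (neg_lt_zero.2 ha) z (mul_ne_zero two_ne_zero ht))
  obtain ⟨n, hn⟩ := hescape.exists
  rw [form_flip] at hn
  linarith [horbit n]

/-- The fixed point of a parabolic transformation attracts every orbit, so it lies in every closed
disc that is mapped into itself. -/
theorem IsParabolicAt.form_nonpos {f : Equiv.Perm Sphere} {p : Sphere} (h : IsParabolicAt f p)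
    {C : Circle} (hC : ∀ q, C.form q ≤ 0 → C.form (f q) ≤ 0) : C.form p ≤ 0 := by
  obtain ⟨k, hk, t, ht, hp, hf⟩ := h
  obtain ⟨D, hD⟩ := Circle.exists_isImage hk C
  rw [← hD.nonpos_iff, hp]
  refine Circle.a_nonpos_of_translate ht fun q hq => ?_
  obtain ⟨r, rfl⟩ := k.surjective q
  rw [← Equiv.Perm.mul_apply, ← hf, Equiv.Perm.mul_apply, hD.nonpos_iff]
  exact hC r ((hD.nonpos_iff r).1 hq)

/-! ### Free groups -/

section FreeGroup

variable {ι : Type*}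

/-- The inverse of a letter of the free group on `ι`, where `(i, true)` stands for the generator `i`
and `(i, false)` for its inverse. -/
def invLetter (v : ι × Bool) : ι × Bool := (v.1, !v.2)

@[simp] theorem invLetter_invLetter (v : ι × Bool) : invLetter (invLetter v) = v := by
  simp [invLetter]

theorem ne_invLetter_iff {v w : ι × Bool} : w ≠ invLetter v ↔ (v.1 = w.1 → v.2 = w.2) := by
  obtain ⟨i, b⟩ := v
  obtain ⟨j, c⟩ := w
  cases b <;> cases c <;> simp [invLetter, eq_comm]

theorem ne_invLetter_self (v : ι × Bool) : v ≠ invLetter v := ne_invLetter_iff.2 fun _ => rfl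

theorem mk_invLetter (v : ι × Bool) :
    FreeGroup.mk [invLetter v] = (FreeGroup.mk [v])⁻¹ := by
  rw [FreeGroup.inv_mk]; rfl

theorem mk_cons (v : ι × Bool) (l : List (ι × Bool)) :
    FreeGroup.mk (v :: l) = FreeGroup.mk [v] * FreeGroup.mk l := by
  rw [FreeGroup.mul_mk]; rfl

theorem invRev_ne_nil {l : List (ι × Bool)} (hne : l ≠ []) : FreeGroup.invRev l ≠ [] := by
  simpa [FreeGroup.invRev] using hne

theorem head_invRev {l : List (ι × Bool)} (hne : l ≠ []) :
    (FreeGroup.invRev l).head (invRev_ne_nil hne) = invLetter (l.getLast hne) := by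
  simp [FreeGroup.invRev, invLetter]

theorem getLast_invRev {l : List (ι × Bool)} (hne : l ≠ []) :
    (FreeGroup.invRev l).getLast (invRev_ne_nil hne) = invLetter (l.head hne) := by
  simp [FreeGroup.invRev, invLetter]

theorem isReduced_invRev {l : List (ι × Bool)} (hl : FreeGroup.IsReduced l) :
    FreeGroup.IsReduced (FreeGroup.invRev l) := by
  classical
  rw [FreeGroup.isReduced_iff_reduce_eq, FreeGroup.reduce_invRev, hl.reduce_eq]

theorem exists_ne_ne [Nontrivial ι] (a b : ι × Bool) : ∃ u, u ≠ a ∧ u ≠ b := by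
  obtain ⟨j, hj⟩ := exists_ne a.1
  by_cases hb : (j, true) = b
  · exact ⟨(j, false), fun ha => hj (congrArg Prod.fst ha), by rw [← hb]; simp⟩
  · exact ⟨(j, true), fun ha => hj (congrArg Prod.fst ha), hb⟩

theorem ping_pong {Ω : Type*} (φ : FreeGroup ι →* Equiv.Perm Ω) (X : ι × Bool → Set Ω)
    (hX : ∀ v u, u ≠ invLetter v → ∀ p ∈ X u, φ (FreeGroup.mk [v]) p ∈ X v) :
    ∀ (l : List (ι × Bool)) (hne : l ≠ []), FreeGroup.IsReduced l → ∀ p : Ω,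
      φ (FreeGroup.mk [l.getLast hne]) p ∈ X (l.getLast hne) →
      φ (FreeGroup.mk l) p ∈ X (l.head hne)
  | [], hne, _, _, _ => absurd rfl hne
  | [_], _, _, _, hp => hp
  | v :: w :: l, _, hl, p, hp => by
    rw [FreeGroup.isReduced_cons_cons] at hl
    rw [mk_cons, map_mul, Equiv.Perm.mul_apply]
    exact hX v w (ne_invLetter_iff.2 hl.1) _
      (ping_pong φ X hX (w :: l) (by simp) hl.2 p (by simpa using hp))

theorem ping_pong_of_disjoint {Ω : Type*} (φ : FreeGroup ι →* Equiv.Perm Ω)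
    (X : ι × Bool → Set Ω) (hdisj : ∀ u v, ∀ p ∈ X u, p ∈ X v → u = v)
    (hX : ∀ v, ∀ p ∉ X (invLetter v), φ (FreeGroup.mk [v]) p ∈ X v)
    {l : List (ι × Bool)} (hne : l ≠ []) (hl : FreeGroup.IsReduced l) {p : Ω}
    (hp : p ∉ X (invLetter (l.getLast hne))) : φ (FreeGroup.mk l) p ∈ X (l.head hne) :=
  ping_pong φ X (fun v _ huv p hp => hX v p fun hp' => huv (hdisj _ _ p hp hp')) l hne hl p
    (hX _ p hp)

theorem lift_mk_true {H : Type*} [Group H] (g : ι → H) (i : ι) :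
    FreeGroup.lift g (FreeGroup.mk [(i, true)]) = g i := by simp [FreeGroup.lift_mk]

theorem lift_mk_false {H : Type*} [Group H] (g : ι → H) (i : ι) :
    FreeGroup.lift g (FreeGroup.mk [(i, false)]) = (g i)⁻¹ := by simp [FreeGroup.lift_mk]

theorem exists_mk_singleton_eq_zpow (v : ι × Bool) :
    ∃ e : ℤ, FreeGroup.mk [v] = FreeGroup.of v.1 ^ e := by
  obtain ⟨i, b⟩ := v
  cases b
  · exact ⟨-1, by rw [zpow_neg_one]; rfl⟩
  · exact ⟨1, by rw [zpow_one]; rfl⟩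

open FreeGroup (startsWith)

variable [DecidableEq ι]

theorem mem_startsWith {v : ι × Bool} {x : FreeGroup ι} :
    x ∈ startsWith v ↔ x.toWord.head? = Option.some v := by
  rw [List.head?_eq_getElem?]; rfl

theorem eq_of_mem_startsWith {u v : ι × Bool} {x : FreeGroup ι} (hu : x ∈ startsWith u)
    (hv : x ∈ startsWith v) : u = v := by
  rw [mem_startsWith] at hu hv
  exact Option.some.inj (hu.symm.trans hv)

theorem mul_mem_startsWith {l : List (ι × Bool)} (hne : l ≠ []) (hl : FreeGroup.IsReduced l)
    {x : FreeGroup ι} (hx : x ∉ startsWith (invLetter (l.getLast hne))) :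
    FreeGroup.mk l * x ∈ startsWith (l.head hne) :=
  ping_pong_of_disjoint (MulAction.toPermHom (FreeGroup ι) (FreeGroup ι)) startsWith
    (fun _ _ _ hu hv => eq_of_mem_startsWith hu hv) (fun _ x => FreeGroup.startsWith_mk_mul x)
    hne hl hx

theorem inv_mk_mem_startsWith {l : List (ι × Bool)} (hne : l ≠ [])
    (hl : FreeGroup.IsReduced l) :
    (FreeGroup.mk l)⁻¹ ∈ startsWith (invLetter (l.getLast hne)) := by
  rw [mem_startsWith, FreeGroup.inv_mk, FreeGroup.toWord_mk, (isReduced_invRev hl).reduce_eq,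
    List.head?_eq_some_head (invRev_ne_nil hne), head_invRev hne]

end FreeGroup

section SimultaneousConjugation

open FreeGroup

theorem closure_conj_eq_top {H : Type*} [Group H] {s t : H} (c : H)
    (h : Subgroup.closure {s, t} = ⊤) : Subgroup.closure {c * s * c⁻¹, c * t * c⁻¹} = ⊤ := by
  have hmap := congrArg (Subgroup.map (MulAut.conj c).toMonoidHom) h
  rw [MonoidHom.map_closure, Set.image_pair,
    Subgroup.map_top_of_surjective _ (MulAut.conj c).surjective] at hmap
  simpa only [MulEquiv.coe_toMonoidHom, MulAut.conj_apply] using hmap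

theorem range_lift_pair {H : Type*} [Group H] (s t : H) :
    (lift ![s, t]).range = Subgroup.closure {s, t} := by
  rw [range_lift_eq_closure, Matrix.range_cons_cons_empty]

/-- The ping-pong sets of the pair `of 0`, `k * of 1 * k⁻¹` acting on the free group by left
multiplication. -/
def conjStartsWith (k : FreeGroup (Fin 2)) (v : Fin 2 × Bool) : Set (FreeGroup (Fin 2)) :=
  if v.1 = 0 then startsWith v else {x | k⁻¹ * x ∈ startsWith v}

theorem mem_conjStartsWith_one {k x : FreeGroup (Fin 2)} {b : Bool} :
    x ∈ conjStartsWith k (1, b) ↔ k⁻¹ * x ∈ startsWith (1, b) := Iff.rfl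

theorem mul_mem_conjStartsWith (k : FreeGroup (Fin 2)) (v : Fin 2 × Bool) {x : FreeGroup (Fin 2)}
    (hx : x ∉ conjStartsWith k (invLetter v)) :
    lift ![of 0, k * of 1 * k⁻¹] (FreeGroup.mk [v]) * x ∈ conjStartsWith k v := by
  have hlift : ∀ b, lift ![of 0, k * of 1 * k⁻¹] (FreeGroup.mk [(1, b)])
      = k * FreeGroup.mk [(1, b)] * k⁻¹ := by
    intro b
    cases b <;> simp [lift_mk, of, mul_assoc, invRev]
  have hlift₀ : ∀ b, lift ![of 0, k * of 1 * k⁻¹] (FreeGroup.mk [(0, b)])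
      = FreeGroup.mk [(0, b)] := by
    intro b
    cases b <;> simp [lift_mk, of, invRev]
  obtain ⟨i, b⟩ := v
  fin_cases i
  · rw [Fin.zero_eta, hlift₀]
    exact startsWith_mk_mul x hx
  · rw [Fin.mk_one, hlift, mem_conjStartsWith_one, mul_assoc, mul_assoc, inv_mul_cancel_left]
    exact startsWith_mk_mul _ hx

variable {k : FreeGroup (Fin 2)}

theorem eq_of_mem_conjStartsWith (hne : k.toWord ≠ []) (hhead : (k.toWord.head hne).1 = 1)
    (hlast : (k.toWord.getLast hne).1 = 0) (u v : Fin 2 × Bool) (x : FreeGroup (Fin 2))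
    (hu : x ∈ conjStartsWith k u) (hv : x ∈ conjStartsWith k v) : u = v := by
  have hmixed : ∀ b c, k⁻¹ * x ∈ startsWith (1, b) → x ∉ startsWith (0, c) := by
    intro b c h₁ h₀
    have hx := mul_mem_startsWith hne isReduced_toWord (x := k⁻¹ * x) fun h => by
      have := congrArg Prod.fst (eq_of_mem_startsWith h₁ h)
      simp [invLetter, hlast] at this
    rw [mk_toWord, mul_inv_cancel_left] at hx
    simpa [hhead] using congrArg Prod.fst (eq_of_mem_startsWith h₀ hx)
  obtain ⟨i, b⟩ := u
  obtain ⟨j, c⟩ := v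
  fin_cases i <;> fin_cases j
  · exact eq_of_mem_startsWith hu hv
  · exact absurd hu (hmixed _ _ hv)
  · exact absurd hv (hmixed _ _ hu)
  · exact eq_of_mem_startsWith (x := k⁻¹ * x) hu hv

theorem inv_notMem_startsWith_one {m : List (Fin 2 × Bool)} (hm : m ≠ []) (hred : IsReduced m)
    (hlast : (m.getLast hm).1 = 0) (b : Bool) : (FreeGroup.mk m)⁻¹ ∉ startsWith (1, b) := by
  intro hb
  have := congrArg Prod.fst (eq_of_mem_startsWith (inv_mk_mem_startsWith hm hred) hb)
  simp [invLetter, hlast] at this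

theorem one_notMem_conjStartsWith (hne : k.toWord ≠ []) (hlast : (k.toWord.getLast hne).1 = 0)
    (v : Fin 2 × Bool) : 1 ∉ conjStartsWith k v := by
  obtain ⟨i, b⟩ := v
  fin_cases i
  · exact fun h₀ => startsWith.ne_one 1 h₀ rfl
  · rw [Fin.mk_one, mem_conjStartsWith_one, mul_one, ← mk_toWord (x := k)]
    exact inv_notMem_startsWith_one hne isReduced_toWord hlast b

theorem mk_head_notMem_conjStartsWith (hne : k.toWord ≠ [])
    (hhead : (k.toWord.head hne).1 = 1) (hlast : (k.toWord.getLast hne).1 = 0)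
    (v : Fin 2 × Bool) : FreeGroup.mk [k.toWord.head hne] ∉ conjStartsWith k v := by
  intro hv
  obtain ⟨i, b⟩ := v
  fin_cases i
  · have := mem_startsWith.1 hv
    simp only [toWord_mk, reduce_singleton, List.head?_cons, Option.some.injEq] at this
    simp [this] at hhead
  · have htail : k.toWord.tail ≠ [] := by
      intro htail
      obtain ⟨v, l, hw⟩ := List.exists_cons_of_ne_nil hne
      obtain rfl : l = [] := by simpa only [hw, List.tail_cons] using htail
      simp only [hw, List.head_cons, List.getLast_singleton] at hhead hlast
      exact zero_ne_one (hlast.symm.trans hhead)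
    refine inv_notMem_startsWith_one htail (isReduced_toWord.infix (List.tail_suffix _).isInfix)
      (by rwa [List.getLast_tail]) b ?_
    have hk : (FreeGroup.mk k.toWord.tail)⁻¹ = k⁻¹ * FreeGroup.mk [k.toWord.head hne] := by
      rw [inv_eq_iff_eq_inv, mul_inv_rev, inv_inv, eq_inv_mul_iff_mul_eq, ← mk_cons,
        List.cons_head_tail, mk_toWord]
    rw [hk]
    exact hv

theorem closure_ne_top_of_head_of_getLast (hne : k.toWord ≠ [])
    (hhead : (k.toWord.head hne).1 = 1) (hlast : (k.toWord.getLast hne).1 = 0) :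
    Subgroup.closure {of (0 : Fin 2), k * of 1 * k⁻¹} ≠ ⊤ := by
  intro htop
  obtain ⟨r, hr⟩ : FreeGroup.mk [k.toWord.head hne]
      ∈ (lift ![of (0 : Fin 2), k * of 1 * k⁻¹]).range := by
    rw [range_lift_pair, htop]; trivial
  have hrne : r.toWord ≠ [] := by
    rw [ne_eq, toWord_eq_nil_iff]
    rintro rfl
    simpa using congrArg toWord hr
  have hmem := ping_pong_of_disjoint ((MulAction.toPermHom (FreeGroup (Fin 2)) _).comp
    (lift ![of (0 : Fin 2), k * of 1 * k⁻¹])) (conjStartsWith k)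
    (eq_of_mem_conjStartsWith hne hhead hlast) (fun v x => mul_mem_conjStartsWith k v) hrne
    isReduced_toWord (one_notMem_conjStartsWith hne hlast _)
  rw [mk_toWord, MonoidHom.comp_apply, hr, MulAction.toPermHom_apply, MulAction.toPerm_apply,
    smul_eq_mul, mul_one] at hmem
  exact mk_head_notMem_conjStartsWith hne hhead hlast _ hmem

theorem exists_eq_zpow_mul_zpow_of_closure_eq_top (k : FreeGroup (Fin 2))
    (htop : Subgroup.closure {of (0 : Fin 2), k * of 1 * k⁻¹} = ⊤) :
    ∃ a b : ℤ, k = of 0 ^ a * of 1 ^ b := by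
  induction hn : k.toWord.length using Nat.strong_induction_on generalizing k with
  | _ n ih =>
  subst hn
  by_cases hne : k.toWord = []
  · exact ⟨0, 0, by simp [toWord_eq_nil_iff.1 hne]⟩
  by_cases hhead : (k.toWord.head hne).1 = 0
  · obtain ⟨e, he⟩ := exists_mk_singleton_eq_zpow (k.toWord.head hne)
    have hk : k = of 0 ^ e * FreeGroup.mk k.toWord.tail := by
      rw [← hhead, ← he, ← mk_cons, List.cons_head_tail, mk_toWord]
    have htail := closure_conj_eq_top (of (0 : Fin 2) ^ e)⁻¹ htop
    nth_rw 1 2 [hk] at htail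
    obtain ⟨a, b, hab⟩ := ih _ (norm_mk_le.trans_lt (by simpa using List.length_pos_iff.2 hne))
      (FreeGroup.mk k.toWord.tail) (by convert htail using 3 <;> group) rfl
    exact ⟨e + a, b, by rw [zpow_add, mul_assoc, ← hab, ← hk]⟩
  by_cases hlast : (k.toWord.getLast hne).1 = 0
  · exact absurd htop (closure_ne_top_of_head_of_getLast hne (by omega) hlast)
  · obtain ⟨e, he⟩ := exists_mk_singleton_eq_zpow (k.toWord.getLast hne)
    have hk : k = FreeGroup.mk k.toWord.dropLast * of 1 ^ e := by
      rw [← Fin.eq_one_of_ne_zero _ hlast, ← he, mul_mk, List.dropLast_append_getLast, mk_toWord]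
    nth_rw 1 2 [hk] at htop
    obtain ⟨a, b, hab⟩ := ih _ (norm_mk_le.trans_lt (by simpa using List.length_pos_iff.2 hne))
      (FreeGroup.mk k.toWord.dropLast) (by convert htop using 3; group) rfl
    exact ⟨a, b + e, by rw [zpow_add, ← mul_assoc, ← hab, ← hk]⟩

theorem exists_simultaneous_conj {H : Type*} [Group H] {f : FreeGroup (Fin 2) →* H}
    (hf : Function.Bijective f) {u v : H}
    (h : Subgroup.closure {u * f (of 0) * u⁻¹, v * f (of 1) * v⁻¹} = ⊤) :
    ∃ c, u * f (of 0) * u⁻¹ = c * f (of 0) * c⁻¹ ∧ v * f (of 1) * v⁻¹ = c * f (of 1) * c⁻¹ := by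
  obtain ⟨k, hk⟩ := hf.2 (u⁻¹ * v)
  have htop : Subgroup.closure {of (0 : Fin 2), k * of 1 * k⁻¹} = ⊤ := by
    apply Subgroup.map_injective hf.1
    rw [MonoidHom.map_closure, Set.image_pair, Subgroup.map_top_of_surjective _ hf.2]
    convert closure_conj_eq_top u⁻¹ h using 3
    · group
    · simp only [_root_.map_mul, _root_.map_inv, hk]; group
  obtain ⟨a, b, rfl⟩ := exists_eq_zpow_mul_zpow_of_closure_eq_top k htop
  obtain rfl : u * (f (of 0) ^ a * f (of 1) ^ b) = v := by
    rw [← map_zpow, ← map_zpow, ← _root_.map_mul, hk, mul_inv_cancel_left]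
  refine ⟨u * f (of 0) ^ a, ?_, ?_⟩ <;> group

end SimultaneousConjugation

section Words

open Multiplicative (toAdd ofAdd)

/-- The exponent sum of the generator `i`. -/
def exponentSum (i : Fin 2) : FreeGroup (Fin 2) →* Multiplicative ℤ :=
  FreeGroup.lift (Pi.mulSingle i (ofAdd 1))

/-- The determinant of two elements of the free group of rank two in its abelianization `ℤ²`. -/
def exponentDet (x y : FreeGroup (Fin 2)) : ℤ :=
  toAdd (exponentSum 0 x) * toAdd (exponentSum 1 y)
    - toAdd (exponentSum 1 x) * toAdd (exponentSum 0 y)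

/-- The homomorphism to the symmetric group of degree three that takes the generator `i` to a
transposition and the other one to a cycle. -/
def permHom (i : Fin 2) : FreeGroup (Fin 2) →* Equiv.Perm (Fin 3) :=
  FreeGroup.lift fun j => if j = i then Equiv.swap 0 1 else finRotate 3

/-- The turns of a cyclic word: for each letter `v` and its cyclic successor `w`, the unordered pair
of `v⁻¹` and `w`. In a Schottky group this is the pair of circles between which the axis passes. -/
def turns (l : List (Fin 2 × Bool)) : List (Sym2 (Fin 2 × Bool)) :=
  l.zipWith (fun v w => s(invLetter v, w)) (l.rotate 1)

/-- The nonempty words of length at most five in which no turn occurs twice or is degenerate, and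
which neither `permHom` kills. -/
def trails : List (List (Fin 2 × Bool)) :=
  ((List.range 6).flatMap fun n =>
    (List.replicate n [(0, true), (0, false), (1, true), (1, false)]).sections).filter fun l =>
      l ≠ [] ∧ (∀ t ∈ turns l, ¬ t.IsDiag) ∧ (turns l).Nodup ∧ ∀ i, permHom i (.mk l) ≠ 1

theorem length_add_length_le_three_of_mem_trails : ∀ l ∈ trails, ∀ m ∈ trails,
    l.length + m.length ≤ 6 → (turns l ++ turns m).Nodup →
    (exponentDet (.mk l) (.mk m)).natAbs = 1 → l.length + m.length ≤ 3 := by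
  decide +kernel

theorem map_ne_one_of_closure_eq_top {K H : Type*} [Group K] [Group H] (f : K →* H) {a b : K}
    (hab : ¬ Commute (f a) (f b)) {x y : K} (htop : Subgroup.closure {x, y} = ⊤) : f x ≠ 1 := by
  intro hx
  have hrange : ∀ z, f z ∈ Subgroup.zpowers (f y) := by
    suffices f.range ≤ Subgroup.zpowers (f y) from fun z => this ⟨z, rfl⟩
    rw [MonoidHom.range_eq_map, ← htop, MonoidHom.map_closure, Set.image_pair, hx,
      Subgroup.closure_le, Set.pair_subset_iff]
    exact ⟨one_mem _, Subgroup.mem_zpowers _⟩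
  obtain ⟨i, hi⟩ := hrange a
  obtain ⟨j, hj⟩ := hrange b
  exact hab (hi ▸ hj ▸ (Commute.refl (f y)).zpow_zpow i j)

theorem not_commute_permHom (i : Fin 2) :
    ¬ Commute (permHom i (FreeGroup.of 0)) (permHom i (FreeGroup.of 1)) := by
  simp only [permHom, FreeGroup.lift_apply_of, Commute, SemiconjBy]
  revert i
  decide

theorem exponentDet_mul_left (x x' y : FreeGroup (Fin 2)) :
    exponentDet (x * x') y = exponentDet x y + exponentDet x' y := by
  simp only [exponentDet, map_mul, toAdd_mul]; ring

theorem exponentDet_inv_left (x y : FreeGroup (Fin 2)) :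
    exponentDet x⁻¹ y = -exponentDet x y := by
  simp only [exponentDet, map_inv, toAdd_inv]; ring

theorem exponentDet_self (x : FreeGroup (Fin 2)) : exponentDet x x = 0 := by
  rw [exponentDet]; ring

theorem exponentDet_swap (x y : FreeGroup (Fin 2)) : exponentDet y x = -exponentDet x y := by
  simp only [exponentDet]; ring

theorem exponentDet_mk (l : List (Fin 2 × Bool)) (y : FreeGroup (Fin 2)) :
    exponentDet (.mk l) y = (l.map fun v => exponentDet (.mk [v]) y).sum := by
  induction l with
  | nil => simp [exponentDet, ← FreeGroup.one_eq_mk]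
  | cons v l ih => rw [mk_cons, exponentDet_mul_left, ih, List.map_cons, List.sum_cons]

theorem exponentDet_eq_of_isConj {x x' y y' : FreeGroup (Fin 2)} (hx : IsConj x x')
    (hy : IsConj y y') : exponentDet x y = exponentDet x' y' := by
  have hx' := fun i => isConj_iff_eq.1 ((exponentSum i).map_isConj hx)
  have hy' := fun i => isConj_iff_eq.1 ((exponentSum i).map_isConj hy)
  simp only [exponentDet, hx', hy']

theorem toAdd_exponentSum_of (i j : Fin 2) :
    toAdd (exponentSum i (FreeGroup.of j)) = if j = i then 1 else 0 := by
  revert i j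
  decide

theorem natAbs_exponentDet_of_closure_eq_top {x y : FreeGroup (Fin 2)}
    (htop : Subgroup.closure {x, y} = ⊤) : (exponentDet x y).natAbs = 1 := by
  have hspan : ∀ z, ∃ i j : ℤ, ∀ k, toAdd (exponentSum k z)
      = i * toAdd (exponentSum k x) + j * toAdd (exponentSum k y) := by
    intro z
    have hz : MonoidHom.pi exponentSum z
        ∈ (Subgroup.closure {x, y}).map (MonoidHom.pi exponentSum) :=
      Subgroup.mem_map_of_mem _ (htop ▸ Subgroup.mem_top z)
    rw [MonoidHom.map_closure, Set.image_pair, Subgroup.mem_closure_pair] at hz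
    obtain ⟨i, j, hij⟩ := hz
    refine ⟨i, j, fun k => ?_⟩
    simpa [eq_comm] using congrArg toAdd (congrFun hij k)
  obtain ⟨i, j, h₀⟩ := hspan (FreeGroup.of 0)
  obtain ⟨i', j', h₁⟩ := hspan (FreeGroup.of 1)
  simp only [toAdd_exponentSum_of, Fin.forall_fin_two, if_true, zero_ne_one, one_ne_zero, if_false]
    at h₀ h₁
  rw [← Int.isUnit_iff_natAbs_eq]
  refine IsUnit.of_mul_eq_one (i * j' - j * i') ?_
  rw [exponentDet]
  linear_combination -(i' * toAdd (exponentSum 1 x) + j' * toAdd (exponentSum 1 y)) * h₀.1 - h₁.2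
    + (i' * toAdd (exponentSum 0 x) + j' * toAdd (exponentSum 0 y)) * h₀.2

theorem length_turns (l : List (Fin 2 × Bool)) : (turns l).length = l.length := by
  simp [turns]

theorem mem_trails {l : List (Fin 2 × Bool)} (hlen : l.length ≤ 5) (hne : l ≠ [])
    (hdiag : ∀ t ∈ turns l, ¬ t.IsDiag) (hnodup : (turns l).Nodup)
    (hperm : ∀ i, permHom i (.mk l) ≠ 1) : l ∈ trails := by
  rw [trails, List.mem_filter, List.mem_flatMap]
  refine ⟨⟨l.length, List.mem_range.2 (by omega), List.mem_sections.2 ?_⟩, by simp_all⟩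
  have hletter : ∀ v : Fin 2 × Bool, v ∈ [(0, true), (0, false), (1, true), (1, false)] := by
    decide
  clear * - hletter
  induction l with
  | nil => exact .nil
  | cons v l ih => exact .cons (hletter v) ih

theorem length_add_length_le_three_of_nodup_turns {l m : List (Fin 2 × Bool)} (hl : l ≠ [])
    (hm : m ≠ []) (hdiag : ∀ t ∈ turns l ++ turns m, ¬ t.IsDiag)
    (hnodup : (turns l ++ turns m).Nodup) {x y : FreeGroup (Fin 2)} (hx : IsConj x (.mk l))
    (hy : IsConj y (.mk m)) (htop : Subgroup.closure {x, y} = ⊤) : l.length + m.length ≤ 3 := by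
  have hlen : l.length + m.length ≤ 6 := by
    have hcard : Fintype.card {t : Sym2 (Fin 2 × Bool) // ¬ t.IsDiag} = 6 := by
      rw [Sym2.card_subtype_not_diag]; rfl
    rw [← hcard, Fintype.card_subtype, ← length_turns l, ← length_turns m, ← List.length_append,
      ← List.toFinset_card_of_nodup hnodup]
    exact Finset.card_le_card fun t ht => by simpa using hdiag t (List.mem_toFinset.1 ht)
  have hl₀ := List.length_pos_iff.2 hl
  have hm₀ := List.length_pos_iff.2 hm
  have map_mk_ne_one : ∀ {x y : FreeGroup (Fin 2)} {l}, IsConj x (.mk l) →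
      Subgroup.closure {x, y} = ⊤ → ∀ i, permHom i (.mk l) ≠ 1 := by
    intro x y l hx htop i hl
    refine map_ne_one_of_closure_eq_top _ (not_commute_permHom i) htop (isConj_one_left.1 ?_)
    exact hl ▸ (permHom i).map_isConj hx
  rw [List.nodup_append'] at hnodup
  simp only [List.mem_append, or_imp, forall_and] at hdiag
  refine length_add_length_le_three_of_mem_trails
    l (mem_trails (by omega) hl hdiag.1 hnodup.1 (map_mk_ne_one hx htop))
    m (mem_trails (by omega) hm hdiag.2 hnodup.2.1 (map_mk_ne_one hy (Set.pair_comm x y ▸ htop)))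
    hlen (List.nodup_append'.2 hnodup) ?_
  rw [← exponentDet_eq_of_isConj hx hy]
  exact natAbs_exponentDet_of_closure_eq_top htop

end Words

/-! ### Schottky configurations -/

theorem Circle.sign_form_eq_of_interior_eq {C D : Circle} (h : C.interior = D.interior)
    (p : Sphere) : SignType.sign (C.form p) = SignType.sign (D.form p) := by
  have nonpos_of_nonpos : ∀ C D : Circle, C.interior = D.interior → C.form p ≤ 0 →
      D.form p ≤ 0 := by
    intro C D h hC
    by_contra! hD
    obtain ⟨q, hq, hq'⟩ := exists_form_neg_and_form_neg hC (D := D.flip) (by simpa using hD)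
    have hDq : q ∈ D.interior := h ▸ hq
    rw [form_flip, neg_lt_zero] at hq'
    exact lt_asymm hq' hDq
  have hneg : C.form p < 0 ↔ D.form p < 0 := Set.ext_iff.1 h p
  have hnonpos : C.form p ≤ 0 ↔ D.form p ≤ 0 :=
    ⟨nonpos_of_nonpos C D h, nonpos_of_nonpos D C h.symm⟩
  rcases lt_trichotomy (C.form p) 0 with hC | hC | hC
  · rw [sign_neg hC, sign_neg (hneg.1 hC)]
  · rw [hC, le_antisymm (hnonpos.1 hC.le) (not_lt.1 fun hD => (hneg.2 hD).ne hC)]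
  · rw [sign_pos hC, sign_pos (not_le.1 fun hD => hC.not_ge (hnonpos.2 hD))]

/-- The transformations `g i` pair the circles `D (i, false)` and `D (i, true)`, which have pairwise
disjoint interiors; `v` takes the exterior of `D v⁻¹` to the interior of `D v`. -/
structure IsSchottky {ι : Type*} (g : ι → Equiv.Perm Sphere) (D : ι × Bool → Circle) : Prop where
  mem : ∀ i, g i ∈ mobius
  disjoint : ∀ {u v}, u ≠ v → Disjoint (D u).interior (D v).interior
  isImage : ∀ v, Circle.IsImage (FreeGroup.lift g (.mk [v])) (D (invLetter v)).flip (D v)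

section

variable {ι : Type*} {g : ι → Equiv.Perm Sphere} {D : ι × Bool → Circle}

theorem isSchottky_of_isImage (mem : ∀ i, g i ∈ mobius)
    (disjoint : ∀ u v, u ≠ v → Disjoint (D u).interior (D v).interior)
    (isImage : ∀ i, Circle.IsImage (g i) (D (i, false)).flip (D (i, true))) : IsSchottky g D := by
  refine ⟨mem, disjoint _ _, ?_⟩
  rintro ⟨i, b⟩
  cases b
  · rw [lift_mk_false]
    exact (isImage i).flip_left.inv
  · rw [lift_mk_true]
    exact isImage i

theorem IsMarkedClassicalTSchottky.exists_isSchottky {n : ℕ} {g : Fin n → Equiv.Perm Sphere}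
    (h : IsMarkedClassicalTSchottky g) : ∃ D, IsSchottky g D := by
  obtain ⟨hmem, C, C', hdisj, hmap⟩ := h
  let e := (Equiv.prodComm (Fin n) Bool).trans (Equiv.boolProdEquivSum (Fin n))
  refine ⟨fun v => Sum.elim C C' (e v), isSchottky_of_isImage hmem
    (fun u v huv => hdisj (e.injective.ne huv)) fun i p => ?_⟩
  obtain ⟨E, hE⟩ := Circle.exists_isImage (hmem i) (C i).flip
  change SignType.sign ((C' i).form _) = SignType.sign ((C i).flip.form p)
  rw [← hE p]
  apply Circle.sign_form_eq_of_interior_eq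
  rw [hE.interior_eq, Circle.interior_flip, hmap]

end

namespace IsSchottky

variable {ι : Type*} {g : ι → Equiv.Perm Sphere} {D : ι × Bool → Circle}

theorem lift_mem (h : IsSchottky g D) (x : FreeGroup ι) : FreeGroup.lift g x ∈ mobius := by
  have hrange : (FreeGroup.lift g).range ≤ mobius := by
    rw [FreeGroup.range_lift_eq_closure, Subgroup.closure_le]
    exact Set.range_subset_iff.2 h.mem
  exact hrange ⟨x, rfl⟩

theorem form_lift_nonpos (h : IsSchottky g D) {u v : ι × Bool} (huv : u ≠ invLetter v) {p : Sphere}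
    (hp : (D u).form p ≤ 0) : (D v).form (FreeGroup.lift g (.mk [v]) p) ≤ 0 := by
  rw [(h.isImage v).nonpos_iff, Circle.form_flip, neg_nonpos]
  exact Circle.form_nonneg_of_disjoint (h.disjoint huv) hp

theorem form_lift_neg (h : IsSchottky g D) {u v : ι × Bool} (huv : u ≠ invLetter v) {p : Sphere}
    (hp : (D u).form p < 0) : (D v).form (FreeGroup.lift g (.mk [v]) p) < 0 := by
  rw [(h.isImage v).neg_iff, Circle.form_flip, neg_lt_zero]
  exact not_le.1 fun hv =>
    hp.not_ge (Circle.form_nonneg_of_disjoint (h.disjoint huv).symm hv)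

theorem form_lift_eq_zero_iff (h : IsSchottky g D) (v : ι × Bool) (p : Sphere) :
    (D v).form (FreeGroup.lift g (.mk [v]) p) = 0 ↔ (D (invLetter v)).form p = 0 := by
  rw [(h.isImage v).zero_iff, Circle.form_flip, neg_eq_zero]

theorem lift_injective [Nontrivial ι] (h : IsSchottky g D) :
    Function.Injective (FreeGroup.lift g) := by
  classical
  rw [injective_iff_map_eq_one]
  intro x hx
  by_contra hne
  have hw : x.toWord ≠ [] := by rwa [ne_eq, FreeGroup.toWord_eq_nil_iff]
  obtain ⟨u, hhead, hlast⟩ := exists_ne_ne (x.toWord.head hw) (invLetter (x.toWord.getLast hw))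
  obtain ⟨z, hz⟩ := (D u).exists_form_coe_neg
  have hxz := ping_pong (FreeGroup.lift g) (fun v => (D v).interior)
    (fun v u huv p hp => h.form_lift_neg huv hp) x.toWord hw FreeGroup.isReduced_toWord z
    (h.form_lift_neg hlast hz)
  rw [FreeGroup.mk_toWord, hx] at hxz
  exact Set.disjoint_left.1 (h.disjoint hhead) hz hxz

theorem exists_conj (h : IsSchottky g D) {k : Equiv.Perm Sphere} (hk : k ∈ mobius) :
    ∃ D', IsSchottky (fun i => k * g i * k⁻¹) D' ∧ ∀ v, Circle.IsImage k (D v) (D' v) := by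
  choose D' hD' using fun v => Circle.exists_isImage hk (D v)
  refine ⟨D', isSchottky_of_isImage
    (fun i => mobius.mul_mem (mobius.mul_mem hk (h.mem i)) (mobius.inv_mem hk))
    (fun u v huv => ((hD' u).disjoint_iff (hD' v)).2 (h.disjoint huv)) fun i => ?_, hD'⟩
  have hi := h.isImage (i, true)
  rw [lift_mk_true] at hi
  exact (hD' (i, false)).flip.inv.trans (hi.trans (hD' (i, true)))

theorem eq_of_form_eq_zero [Nontrivial ι] (h : IsSchottky g D) {u v : ι × Bool} (huv : u ≠ v)
    {p q : Sphere} (hup : (D u).form p = 0) (hvp : (D v).form p = 0) (huq : (D u).form q = 0)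
    (hvq : (D v).form q = 0) : p = q := by
  obtain ⟨w, hwu, hwv⟩ := exists_ne_ne u v
  exact Circle.eq_of_common_of_disjoint (h.disjoint huv) (h.disjoint hwu.symm)
    (h.disjoint hwv.symm) hup hvp huq hvq

variable {l : List (ι × Bool)} {p : Sphere}

theorem form_head_nonpos (h : IsSchottky g D) (hne : l ≠ []) (hl : FreeGroup.IsReduced l)
    (hcyc : l.head hne ≠ invLetter (l.getLast hne))
    (hp : IsParabolicAt (FreeGroup.lift g (.mk l)) p) : (D (l.head hne)).form p ≤ 0 :=
  hp.form_nonpos fun q hq => ping_pong (FreeGroup.lift g) (fun v => {p | (D v).form p ≤ 0})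
    (fun _ _ huv _ hp => h.form_lift_nonpos huv hp) l hne hl q (h.form_lift_nonpos hcyc hq)

theorem form_head_eq_zero (h : IsSchottky g D) (hne : l ≠ []) (hl : FreeGroup.IsReduced l)
    (hcyc : l.head hne ≠ invLetter (l.getLast hne))
    (hp : IsParabolicAt (FreeGroup.lift g (.mk l)) p) :
    (D (l.head hne)).form p = 0 ∧ (D (invLetter (l.getLast hne))).form p = 0 := by
  refine Circle.form_eq_zero_of_disjoint (h.disjoint hcyc) (h.form_head_nonpos hne hl hcyc hp) ?_
  rw [← head_invRev hne]
  refine h.form_head_nonpos (invRev_ne_nil hne) (isReduced_invRev hl) ?_ ?_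
  · rwa [head_invRev, getLast_invRev, invLetter_invLetter, ne_comm]
  · rw [← FreeGroup.inv_mk, map_inv]
    exact hp.inv

end IsSchottky

/-! ### Itineraries of parabolic words -/

section PeriodicSums

open Finset Function

theorem sum_range_mul_of_periodic {u : ℕ → ℤ} {n : ℕ} (hu : Periodic u n) (k : ℕ) :
    ∑ i ∈ range (k * n), u i = k * ∑ i ∈ range n, u i := by
  induction k with
  | zero => simp
  | succ k ih =>
    have hshift : ∀ i, u (k * n + i) = u i := fun i => by rw [add_comm]; exact hu.nat_mul k i
    rw [Nat.succ_mul, sum_range_add, ih]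
    simp only [hshift]
    push_cast
    ring

theorem mul_sum_range_comm_of_periodic {u : ℕ → ℤ} {m n : ℕ} (hm : Periodic u m)
    (hn : Periodic u n) : m * ∑ i ∈ range n, u i = n * ∑ i ∈ range m, u i := by
  rw [← sum_range_mul_of_periodic hm, ← sum_range_mul_of_periodic hn, mul_comm]

variable {u v : ℤ → ℤ} {m n : ℕ}

theorem sum_range_add_of_periodic (hu : Periodic u n) (a : ℤ) :
    ∑ k ∈ range n, u (a + k) = ∑ k ∈ range n, u k := by
  have hper : Periodic (fun a => ∑ k ∈ range n, u (a + k)) 1 := by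
    intro a
    have h := sum_range_succ' (fun k : ℕ => u (a + k)) n
    rw [sum_range_succ, hu a, Nat.cast_zero, add_zero, add_left_inj] at h
    simp only [h]
    exact sum_congr rfl fun k _ => by push_cast; ring_nf
  simpa using hper.int_mul_eq a

theorem sum_range_sub_of_periodic (hu : Periodic u n) (a : ℤ) :
    ∑ k ∈ range n, u (a - k) = ∑ k ∈ range n, u k := by
  rw [← sum_range_add_of_periodic hu (a + 1 - n), ← sum_range_reflect]
  refine sum_congr rfl fun k hk => ?_
  rw [mem_range] at hk
  push_cast [Nat.cast_sub (show k ≤ n - 1 by omega), Nat.cast_sub (show 1 ≤ n by omega)]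
  ring_nf

theorem mul_sum_range_eq_of_forall_add (hu : Periodic u n) (hv : Periodic v m) {a b : ℤ}
    (h : ∀ t : ℕ, u (a + t) = v (b + t)) :
    m * ∑ k ∈ range n, u k = n * ∑ k ∈ range m, v k := by
  rw [← sum_range_add_of_periodic hu a, ← sum_range_add_of_periodic hv b]
  simp only [h]
  refine mul_sum_range_comm_of_periodic (u := fun t => v (b + t)) (fun t => ?_) fun t => ?_ <;>
    beta_reduce
  · rw [Nat.cast_add, ← add_assoc, hv]
  · rw [← h, ← h, Nat.cast_add, ← add_assoc, hu]

theorem mul_sum_range_eq_of_forall_sub (hu : Periodic u n) (hv : Periodic v m) {a b : ℤ}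
    (h : ∀ t : ℕ, u (a + t) = v (b - t)) :
    m * ∑ k ∈ range n, u k = n * ∑ k ∈ range m, v k := by
  rw [← sum_range_sub_of_periodic hv 0]
  refine mul_sum_range_eq_of_forall_add (v := fun k => v (0 - k)) (a := a) (b := -b) hu
    (fun k => ?_) fun t => ?_
  · beta_reduce
    rw [← sub_sub, hv.sub_eq]
  · rw [h]; ring_nf

end PeriodicSums

/-- A bi-infinite periodic path of letters together with points of the sphere, where `x i` takes
`q (i + 1)` to `q i` and `q i` is on the circle of `x i`. The fixed points of the cyclic
permutations of a word inducing a parabolic transformation form such a path. -/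
structure IsItinerary {ι : Type*} (g : ι → Equiv.Perm Sphere) (D : ι × Bool → Circle) (n : ℕ)
    (x : ℤ → ι × Bool) (q : ℤ → Sphere) : Prop where
  periodic : Function.Periodic x n
  ne_invLetter : ∀ i, x (i + 1) ≠ invLetter (x i)
  apply_succ : ∀ i, FreeGroup.lift g (.mk [x i]) (q (i + 1)) = q i
  form_eq_zero : ∀ i, (D (x i)).form (q i) = 0

namespace IsItinerary

variable {ι : Type*} {g : ι → Equiv.Perm Sphere} {D : ι × Bool → Circle} {m n : ℕ}
  {x y : ℤ → ι × Bool} {q r : ℤ → Sphere}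

theorem form_invLetter_eq_zero (hx : IsItinerary g D n x q) (h : IsSchottky g D) (i : ℤ) :
    (D (invLetter (x i))).form (q (i + 1)) = 0 := by
  rw [← h.form_lift_eq_zero_iff, hx.apply_succ, hx.form_eq_zero]

theorem reverse (hx : IsItinerary g D n x q) (h : IsSchottky g D) :
    IsItinerary g D n (fun i => invLetter (x (-1 - i))) fun i => q (-i) where
  periodic i := by beta_reduce; rw [← sub_sub, hx.periodic.sub_eq]
  ne_invLetter i := by
    have hne := hx.ne_invLetter (-1 - (i + 1))
    rw [show -1 - (i + 1) + 1 = -1 - i by ring] at hne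
    rw [invLetter_invLetter]
    exact hne.symm
  apply_succ i := by
    rw [mk_invLetter, map_inv, Equiv.Perm.inv_eq_iff_eq, neg_add', ← neg_add_eq_sub, neg_add_eq_sub,
      ← hx.apply_succ]
    ring_nf
  form_eq_zero i := by
    have hzero := hx.form_invLetter_eq_zero h (-1 - i)
    rwa [show -1 - i + 1 = -i by ring] at hzero

theorem eq_add_one (hx : IsItinerary g D n x q) (hy : IsItinerary g D m y r)
    (h : IsSchottky g D) {i j : ℤ} (hletter : x i = y j) (hpoint : q i = r j) :
    x (i + 1) = y (j + 1) ∧ q (i + 1) = r (j + 1) := by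
  have hpoint' : q (i + 1) = r (j + 1) := by
    rw [← hx.apply_succ, ← hy.apply_succ, hletter] at hpoint
    exact Equiv.injective _ hpoint
  refine ⟨?_, hpoint'⟩
  by_contra hne
  refine Circle.not_common_of_disjoint (h.disjoint hne) (h.disjoint (hx.ne_invLetter i))
    (h.disjoint (hletter ▸ hy.ne_invLetter j)) (hx.form_eq_zero _) ?_
    (hx.form_invLetter_eq_zero h i)
  rw [hpoint', hy.form_eq_zero]

theorem eq_add_nat (hx : IsItinerary g D n x q) (hy : IsItinerary g D m y r)
    (h : IsSchottky g D) {i j : ℤ} (hletter : x i = y j) (hpoint : q i = r j) (t : ℕ) :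
    x (i + t) = y (j + t) := by
  suffices x (i + t) = y (j + t) ∧ q (i + t) = r (j + t) from this.1
  induction t with
  | zero => simpa using ⟨hletter, hpoint⟩
  | succ t ih => simpa [add_assoc] using hx.eq_add_one hy h ih.1 ih.2

theorem forall_eq_of_turn_eq [Nontrivial ι] (hx : IsItinerary g D n x q)
    (hy : IsItinerary g D m y r) (h : IsSchottky g D) {i j : ℤ}
    (hturn : s(invLetter (x i), x (i + 1)) = s(invLetter (y j), y (j + 1))) :
    (∀ t : ℕ, x (i + 1 + t) = y (j + 1 + t)) ∨
      ∀ t : ℕ, x (i + 1 + t) = invLetter (y (j - t)) := by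
  have hxi := hx.form_invLetter_eq_zero h i
  have hyj := hy.form_invLetter_eq_zero h j
  rw [Sym2.eq_iff] at hturn
  rcases hturn with ⟨hinv, hsucc⟩ | ⟨hinv, hsucc⟩
  · refine Or.inl (hx.eq_add_nat hy h hsucc ?_)
    refine h.eq_of_form_eq_zero (hx.ne_invLetter i) (hx.form_eq_zero _) hxi ?_ ?_
    · rw [hsucc, hy.form_eq_zero]
    · rwa [hinv]
  · right
    have hy' := hy.reverse h
    have hpoint : q (i + 1) = r (j + 1) := by
      refine h.eq_of_form_eq_zero (hx.ne_invLetter i) (hx.form_eq_zero _) hxi ?_ ?_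
      · rwa [hsucc]
      · rw [hinv, hy.form_eq_zero]
    intro t
    have := hx.eq_add_nat hy' h (i := i + 1) (j := -1 - j) (by rw [hsucc, sub_sub_cancel])
      (by rw [hpoint]; ring_nf) t
    rw [this]
    ring_nf

variable {w : ι × Bool → ℤ}

theorem mul_sum_eq_neg_of_forall_sub (hx : IsItinerary g D n x q) (hy : IsItinerary g D m y r)
    (hw : ∀ v, w (invLetter v) = -w v) {i j : ℤ}
    (hxy : ∀ t : ℕ, x (i + t) = invLetter (y (j - t))) :
    m * ∑ k ∈ Finset.range n, w (x k) = -(n * ∑ k ∈ Finset.range m, w (y k)) := by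
  have hsum := mul_sum_range_eq_of_forall_sub (hx.periodic.comp w) (hy.periodic.comp (-w))
    (a := i) (b := j) fun t => by simp [hxy t, hw]
  simpa using hsum

theorem mul_sum_eq_of_turn_eq [Nontrivial ι] (hx : IsItinerary g D n x q)
    (hy : IsItinerary g D m y r) (h : IsSchottky g D) (hw : ∀ v, w (invLetter v) = -w v) {i j : ℤ}
    (hturn : s(invLetter (x i), x (i + 1)) = s(invLetter (y j), y (j + 1))) :
    m * ∑ k ∈ Finset.range n, w (x k) = n * ∑ k ∈ Finset.range m, w (y k) ∨
      m * ∑ k ∈ Finset.range n, w (x k) = -(n * ∑ k ∈ Finset.range m, w (y k)) :=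
  (hx.forall_eq_of_turn_eq hy h hturn).imp
    (fun hxy => mul_sum_range_eq_of_forall_add (hx.periodic.comp w) (hy.periodic.comp w)
      fun t => congrArg w (hxy t))
    (hx.mul_sum_eq_neg_of_forall_sub hy hw)

theorem dvd_of_forall_eq_add {d : ℕ} (hx : IsItinerary g D n x q) {i : ℤ}
    (hshift : ∀ t : ℕ, x (i + t) = x (i + d + t))
    (hunit : IsUnit (∑ k ∈ Finset.range n, w (x k))) : n ∣ d := by
  have hmul := mul_sum_range_comm_of_periodic (u := fun t => w (x (i + t))) (m := n) (n := d)
    (fun t => by beta_reduce; rw [Nat.cast_add, ← add_assoc, hx.periodic])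
    fun t => by beta_reduce; rw [hshift t, Nat.cast_add]; ring_nf
  rw [sum_range_add_of_periodic (u := fun k => w (x k)) (hx.periodic.comp w)] at hmul
  exact Int.natCast_dvd_natCast.1 (hunit.dvd_mul_right.1 ⟨_, hmul.symm⟩)

theorem turn_ne_of_isUnit [Nontrivial ι] (hx : IsItinerary g D n x q) (h : IsSchottky g D)
    (hw : ∀ v, w (invLetter v) = -w v) (hunit : IsUnit (∑ k ∈ Finset.range n, w (x k)))
    {i j : ℕ} (hij : i < j) (hj : j < n) :
    s(invLetter (x i), x (i + 1)) ≠ s(invLetter (x j), x (j + 1)) := by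
  intro hturn
  rcases hx.forall_eq_of_turn_eq hx h hturn with hxx | hxx
  · have hdvd : n ∣ j - i := hx.dvd_of_forall_eq_add (i := i + 1) (fun t => by
      rw [hxx, Nat.cast_sub hij.le]; ring_nf) hunit
    exact Nat.not_le.2 (by omega) (Nat.le_of_dvd (by omega) hdvd)
  · have hsum := hx.mul_sum_eq_neg_of_forall_sub hx hw hxx
    rw [self_eq_neg, mul_eq_zero, Nat.cast_eq_zero] at hsum
    exact hsum.elim (by omega) hunit.ne_zero

end IsItinerary

theorem exists_isConj_isCyclicallyReduced {ι : Type*} (x : FreeGroup ι) :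
    ∃ l, FreeGroup.IsCyclicallyReduced l ∧ IsConj x (.mk l) := by
  classical
  refine ⟨FreeGroup.reduceCyclically x.toWord,
    FreeGroup.reduceCyclically.isCyclicallyReduced FreeGroup.isReduced_toWord,
    (isConj_iff.2 ⟨.mk (FreeGroup.reduceCyclically.conjugator x.toWord), ?_⟩).symm⟩
  rw [FreeGroup.inv_mk, FreeGroup.mul_mk, FreeGroup.mul_mk,
    FreeGroup.reduceCyclically.conj_conjugator_reduceCyclically, FreeGroup.mk_toWord]

theorem head_ne_invLetter_getLast {ι : Type*} {l : List (ι × Bool)}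
    (hl : FreeGroup.IsCyclicallyReduced l) (hne : l ≠ []) :
    l.head hne ≠ invLetter (l.getLast hne) := by
  rw [ne_invLetter_iff]
  exact hl.2 _ (List.getLast?_eq_getLast_of_ne_nil hne) _ (List.head?_eq_some_head hne)

theorem IsParabolicAt.ne_one {k : Equiv.Perm Sphere} {p : Sphere} (hk : IsParabolicAt k p) :
    k ≠ 1 := by
  rintro rfl
  have h₀ := (hk.apply_eq_iff ((0 : ℂ) : Sphere)).1 rfl
  exact OnePoint.coe_ne_infty _ (h₀.trans ((hk.apply_eq_iff ∞).1 rfl).symm)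

namespace IsSchottky

variable {ι : Type*} {g : ι → Equiv.Perm Sphere} {D : ι × Bool → Circle}

theorem isParabolicAt_of_isConj (h : IsSchottky g D) {x y : FreeGroup ι} (hxy : IsConj x y)
    {p : Sphere} (hx : IsParabolicAt (FreeGroup.lift g x) p) :
    ∃ q, IsParabolicAt (FreeGroup.lift g y) q := by
  obtain ⟨c, rfl⟩ := isConj_iff.1 hxy
  simp only [map_mul, map_inv]
  exact ⟨_, hx.conjugate (h.lift_mem c)⟩

variable {l : List (ι × Bool)} {p : Sphere}

theorem form_getElem_nonpos (h : IsSchottky g D) (hne : l ≠ [])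
    (hl : FreeGroup.IsCyclicallyReduced l) (hp : IsParabolicAt (FreeGroup.lift g (.mk l)) p)
    {i : ℕ} (hi : i < l.length) :
    (D l[i]).form (FreeGroup.lift g (.mk (l.drop i)) p) ≤ 0 := by
  have hdrop : l.drop i ≠ [] := by rwa [ne_eq, List.drop_eq_nil_iff, not_le]
  have hcyc := head_ne_invLetter_getLast hl hne
  rw [← List.head_drop hdrop]
  refine ping_pong (FreeGroup.lift g) (fun v => {p | (D v).form p ≤ 0})
    (fun _ _ huv _ hp => h.form_lift_nonpos huv hp) _ hdrop
    (hl.1.infix (List.drop_suffix i l).isInfix) p ?_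
  rw [List.getLast_drop]
  exact h.form_lift_nonpos hcyc (h.form_head_nonpos hne hl.1 hcyc hp)

theorem form_getElem_eq_zero (h : IsSchottky g D) (hne : l ≠ [])
    (hl : FreeGroup.IsCyclicallyReduced l) (hp : IsParabolicAt (FreeGroup.lift g (.mk l)) p)
    {i : ℕ} (hi : i < l.length) :
    (D l[i]).form (FreeGroup.lift g (.mk (l.drop i)) p) = 0 := by
  have hcyc := head_ne_invLetter_getLast hl hne
  induction i with
  | zero =>
    rw [List.drop_zero, hp.apply_self, ← List.head_eq_getElem hne]
    exact (h.form_head_eq_zero hne hl.1 hcyc hp).1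
  | succ i ih =>
    have hzero := ih (by omega)
    rw [List.drop_eq_getElem_cons (by omega), mk_cons, map_mul, Equiv.Perm.mul_apply,
      h.form_lift_eq_zero_iff] at hzero
    refine (Circle.form_eq_zero_of_disjoint (h.disjoint ?_)
      (h.form_getElem_nonpos hne hl hp hi) hzero.le).1
    rw [ne_invLetter_iff]
    exact List.isChain_iff_getElem.1 hl.1 i hi

theorem exists_isItinerary (h : IsSchottky g D) (hne : l ≠ [])
    (hl : FreeGroup.IsCyclicallyReduced l) (hp : IsParabolicAt (FreeGroup.lift g (.mk l)) p) :
    ∃ x q, IsItinerary g D l.length x q ∧ ∀ (i : ℕ) (hi : i < l.length), x i = l[i] := by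
  have hlen : (0 : ℤ) < l.length := by exact_mod_cast List.length_pos_iff.2 hne
  let r : ℤ → ℕ := fun i => (i % l.length).toNat
  have coe_r : ∀ i, (r i : ℤ) = i % l.length := fun i =>
    Int.toNat_of_nonneg (i.emod_nonneg hlen.ne')
  have hr : ∀ i, r i < l.length := fun i => by
    have := i.emod_lt_of_pos hlen
    have := coe_r i
    omega
  have r_add_one : ∀ i, r i + 1 < l.length ∧ r (i + 1) = r i + 1 ∨
      r i + 1 = l.length ∧ r (i + 1) = 0 := by
    intro i
    have hsucc : (r (i + 1) : ℤ) = ((r i + 1 : ℕ) : ℤ) % l.length := by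
      rw [coe_r, Nat.cast_add, coe_r, Nat.cast_one, Int.emod_add_emod]
    rw [← Int.natCast_mod, Nat.cast_inj] at hsucc
    rcases (Nat.succ_le_of_lt (hr i)).lt_or_eq with hlt | heq
    · exact Or.inl ⟨hlt, hsucc.trans (Nat.mod_eq_of_lt hlt)⟩
    · exact Or.inr ⟨heq, hsucc.trans (by rw [← heq, Nat.mod_self])⟩
  have r_periodic : ∀ i, r (i + l.length) = r i := fun i => by simp only [r, Int.add_emod_right]
  refine ⟨fun i => l[r i]'(hr i), fun i => FreeGroup.lift g (.mk (l.drop (r i))) p,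
    ⟨fun i => ?_, fun i => ?_, fun i => ?_, fun i => h.form_getElem_eq_zero hne hl hp (hr i)⟩,
    fun i hi => ?_⟩
  · simp only [r_periodic]
  · rcases r_add_one i with ⟨hlt, hsucc⟩ | ⟨heq, hzero⟩
    · simp only [hsucc]
      rw [ne_invLetter_iff]
      exact List.isChain_iff_getElem.1 hl.1 _ hlt
    · simp only [hzero, eq_tsub_of_add_eq heq]
      rw [← List.head_eq_getElem hne, ← List.getLast_eq_getElem hne]
      exact head_ne_invLetter_getLast hl hne
  · rw [List.drop_eq_getElem_cons (hr i), mk_cons (l[r i]'(hr i)) (l.drop (r i + 1)), map_mul,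
      Equiv.Perm.mul_apply]
    rcases r_add_one i with ⟨-, hsucc⟩ | ⟨heq, hzero⟩
    · rw [hsucc]
    · rw [hzero, heq, List.drop_length, List.drop_zero, hp.apply_self, ← FreeGroup.one_eq_mk,
        map_one, Equiv.Perm.one_apply]
  · have : r i = i := by
      rw [← Nat.cast_inj (R := ℤ), coe_r, ← Int.natCast_mod, Nat.mod_eq_of_lt hi]
    simp only [this]

end IsSchottky

namespace IsItinerary

variable {l m : List (Fin 2 × Bool)} {x y : ℤ → Fin 2 × Bool} {q r : ℤ → Sphere}
  {g : Fin 2 → Equiv.Perm Sphere} {D : Fin 2 × Bool → Circle}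

theorem getElem_turns (hx : IsItinerary g D l.length x q)
    (hxl : ∀ (i : ℕ) (hi : i < l.length), x i = l[i]) {i : ℕ} (hi : i < (turns l).length) :
    (turns l)[i] = s(invLetter (x i), x (i + 1)) := by
  rw [length_turns] at hi
  simp only [turns, List.getElem_zipWith, List.getElem_rotate, ← hxl]
  rcases Nat.lt_or_ge (i + 1) l.length with hlt | hge
  · simp only [Nat.mod_eq_of_lt hlt, Nat.cast_add, Nat.cast_one]
  · have hlen : i + 1 = l.length := le_antisymm hi hge
    have hperiod := hx.periodic 0
    rw [zero_add, ← hlen, Nat.cast_add, Nat.cast_one] at hperiod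
    rw [hlen, Nat.mod_self, hperiod, Nat.cast_zero]

theorem not_isDiag_of_mem_turns (hx : IsItinerary g D l.length x q)
    (hxl : ∀ (i : ℕ) (hi : i < l.length), x i = l[i]) : ∀ t ∈ turns l, ¬ t.IsDiag := by
  intro t ht
  obtain ⟨i, hi, rfl⟩ := List.getElem_of_mem ht
  rw [hx.getElem_turns hxl, Sym2.mk_isDiag_iff]
  exact (hx.ne_invLetter i).symm

theorem sum_exponentDet (hxl : ∀ (i : ℕ) (hi : i < l.length), x i = l[i])
    (z : FreeGroup (Fin 2)) :
    ∑ k ∈ Finset.range l.length, exponentDet (.mk [x k]) z = exponentDet (.mk l) z := by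
  rw [exponentDet_mk, Finset.sum_range, ← Fin.sum_univ_fun_getElem]
  exact Finset.sum_congr rfl fun k _ => by rw [hxl k k.2]

theorem exponentDet_invLetter (v : Fin 2 × Bool) (z : FreeGroup (Fin 2)) :
    exponentDet (.mk [invLetter v]) z = -exponentDet (.mk [v]) z := by
  rw [mk_invLetter, exponentDet_inv_left]

theorem nodup_turns (h : IsSchottky g D) (hx : IsItinerary g D l.length x q)
    (hxl : ∀ (i : ℕ) (hi : i < l.length), x i = l[i]) {z : FreeGroup (Fin 2)}
    (hunit : IsUnit (exponentDet (.mk l) z)) : (turns l).Nodup := by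
  rw [← sum_exponentDet hxl] at hunit
  refine List.pairwise_iff_getElem.2 fun i j hi hj hij => ?_
  rw [hx.getElem_turns hxl, hx.getElem_turns hxl]
  exact hx.turn_ne_of_isUnit (w := fun v => exponentDet (.mk [v]) z) h
    (exponentDet_invLetter · z) hunit hij (length_turns l ▸ hj)

theorem nodup_turns_append (h : IsSchottky g D) (hx : IsItinerary g D l.length x q)
    (hxl : ∀ (i : ℕ) (hi : i < l.length), x i = l[i]) (hy : IsItinerary g D m.length y r)
    (hym : ∀ (i : ℕ) (hi : i < m.length), y i = m[i]) (hm : m ≠ [])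
    (hunit : IsUnit (exponentDet (.mk l) (.mk m))) : (turns l ++ turns m).Nodup := by
  rw [List.nodup_append']
  refine ⟨hx.nodup_turns h hxl hunit, hy.nodup_turns h hym (z := .mk l) ?_, ?_⟩
  · rwa [exponentDet_swap, IsUnit.neg_iff]
  · rintro t htl htm
    obtain ⟨i, hi, rfl⟩ := List.getElem_of_mem htl
    obtain ⟨j, hj, hij⟩ := List.getElem_of_mem htm
    rw [hx.getElem_turns hxl, hy.getElem_turns hym] at hij
    have hsum := hx.mul_sum_eq_of_turn_eq (w := fun v => exponentDet (.mk [v]) (.mk m)) hy h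
      (exponentDet_invLetter · _) hij.symm
    rw [sum_exponentDet hxl, sum_exponentDet hym, exponentDet_self, mul_zero, neg_zero, or_self,
      mul_eq_zero, Nat.cast_eq_zero, List.length_eq_zero_iff] at hsum
    exact hsum.elim hm hunit.ne_zero

end IsItinerary

namespace IsSchottky

theorem exists_words {g : Fin 2 → Equiv.Perm Sphere} {D : Fin 2 × Bool → Circle}
    (h : IsSchottky g D) {s t : FreeGroup (Fin 2)} (htop : Subgroup.closure {s, t} = ⊤)
    {p q : Sphere} (hs : IsParabolicAt (FreeGroup.lift g s) p)
    (ht : IsParabolicAt (FreeGroup.lift g t) q) :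
    ∃ l m : List (Fin 2 × Bool), l ≠ [] ∧ m ≠ [] ∧ l.length + m.length ≤ 3 ∧
      IsConj s (.mk l) ∧ IsConj t (.mk m) := by
  have exists_word : ∀ {s p}, IsParabolicAt (FreeGroup.lift g s) p →
      ∃ l ≠ [], IsConj s (.mk l) ∧ ∃ x q, IsItinerary g D l.length x q ∧
        ∀ (i : ℕ) (hi : i < l.length), x i = l[i] := by
    intro s p hs
    obtain ⟨l, hl, hsl⟩ := exists_isConj_isCyclicallyReduced s
    obtain ⟨q, hq⟩ := h.isParabolicAt_of_isConj hsl hs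
    have hne : l ≠ [] := by
      rintro rfl
      exact hq.ne_one (by rw [← FreeGroup.one_eq_mk, map_one])
    exact ⟨l, hne, hsl, h.exists_isItinerary hne hl hq⟩
  obtain ⟨l, hl, hsl, x, _, hx, hxl⟩ := exists_word hs
  obtain ⟨m, hm, htm, y, _, hy, hym⟩ := exists_word ht
  refine ⟨l, m, hl, hm, length_add_length_le_three_of_nodup_turns hl hm ?_ ?_ hsl htm htop,
    hsl, htm⟩
  · simp only [List.mem_append, or_imp, forall_and]
    exact ⟨hx.not_isDiag_of_mem_turns hxl, hy.not_isDiag_of_mem_turns hym⟩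
  · refine hx.nodup_turns_append h hxl hy hym hm ?_
    rw [← exponentDet_eq_of_isConj hsl htm, Int.isUnit_iff_natAbs_eq]
    exact natAbs_exponentDet_of_closure_eq_top htop

end IsSchottky

/-! ### Normal form of a parabolic pair -/

theorem lift_zpow_mul_bijective (e : ℤ) :
    Function.Bijective (FreeGroup.lift ![FreeGroup.of 0, FreeGroup.of 0 ^ e * FreeGroup.of 1] :
      FreeGroup (Fin 2) →* FreeGroup (Fin 2)) := by
  let φ : ℤ → FreeGroup (Fin 2) →* FreeGroup (Fin 2) := fun e =>
    FreeGroup.lift ![FreeGroup.of 0, FreeGroup.of 0 ^ e * FreeGroup.of 1]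
  have hφ : ∀ e e', e + e' = 0 → (φ e).comp (φ e') = MonoidHom.id _ := by
    intro e e' he
    ext i
    fin_cases i <;> simp [φ, ← mul_assoc, ← zpow_add, add_comm e', he]
  exact Function.bijective_iff_has_inverse.2 ⟨φ (-e),
    DFunLike.congr_fun (hφ (-e) e (neg_add_cancel e)),
    DFunLike.congr_fun (hφ e (-e) (add_neg_cancel e))⟩

theorem lift_mk_singleton_bijective {u v : Fin 2 × Bool} (huv : u.1 ≠ v.1) :
    Function.Bijective (FreeGroup.lift ![.mk [u], .mk [v]] :
      FreeGroup (Fin 2) →* FreeGroup (Fin 2)) := by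
  let φ : Fin 2 × Bool → Fin 2 × Bool → FreeGroup (Fin 2) →* FreeGroup (Fin 2) := fun u v =>
    FreeGroup.lift ![.mk [u], .mk [v]]
  obtain ⟨u', v', hinv⟩ : ∃ u' v', ∀ i : Fin 2, φ u' v' (φ u v (.of i)) = .of i ∧
      φ u v (φ u' v' (.of i)) = .of i := by
    revert u v
    decide
  have hleft : (φ u' v').comp (φ u v) = MonoidHom.id _ := by
    ext i
    exact (hinv i).1
  have hright : (φ u v).comp (φ u' v') = MonoidHom.id _ := by
    ext i
    exact (hinv i).2
  exact Function.bijective_iff_has_inverse.2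
    ⟨φ u' v', DFunLike.congr_fun hleft, DFunLike.congr_fun hright⟩

theorem lift_mk_zpow_mul_bijective {u v : Fin 2 × Bool} (huv : u.1 ≠ v.1) (e : ℤ) :
    Function.Bijective (FreeGroup.lift ![.mk [u], .mk [u] ^ e * .mk [v]] :
      FreeGroup (Fin 2) →* FreeGroup (Fin 2)) := by
  have hcomp : (FreeGroup.lift ![.mk [u], .mk [u] ^ e * .mk [v]] :
      FreeGroup (Fin 2) →* FreeGroup (Fin 2)) = (FreeGroup.lift ![.mk [u], .mk [v]]).comp
        (FreeGroup.lift ![FreeGroup.of 0, FreeGroup.of 0 ^ e * FreeGroup.of 1]) := by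
    ext i
    fin_cases i <;> simp
  rw [hcomp, MonoidHom.coe_comp]
  exact (lift_mk_singleton_bijective huv).comp (lift_zpow_mul_bijective e)

/-- The pairs of elements of the free group of rank two that are simultaneously conjugate to one of
the letters and to the other one, possibly multiplied by the first letter or by its inverse. -/
def IsNormalPair (s t : FreeGroup (Fin 2)) : Prop :=
  ∃ (c : FreeGroup (Fin 2)) (u v : Fin 2 × Bool) (e : ℤ), u.1 ≠ v.1 ∧ (e = 0 ∨ e = 1 ∨ e = -1) ∧
    s = c * .mk [u] * c⁻¹ ∧ t = c * (.mk [u] ^ e * .mk [v]) * c⁻¹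

section NormalForm

variable {s t : FreeGroup (Fin 2)} {u v w : Fin 2 × Bool} {m : List (Fin 2 × Bool)}

theorem isNormalPair_of_isConj (htop : Subgroup.closure {s, t} = ⊤) (huv : u.1 ≠ v.1) {e : ℤ}
    (he : e = 0 ∨ e = 1 ∨ e = -1) (hs : IsConj s (.mk [u]))
    (ht : IsConj t (.mk [u] ^ e * .mk [v])) : IsNormalPair s t := by
  obtain ⟨a, rfl⟩ := isConj_iff.1 hs.symm
  obtain ⟨b, rfl⟩ := isConj_iff.1 ht.symm
  obtain ⟨c, hc⟩ := exists_simultaneous_conj (lift_mk_zpow_mul_bijective huv e) (u := a) (v := b)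
    (by simpa using htop)
  exact ⟨c, u, v, e, huv, he, by simpa using hc⟩

theorem eq_or_eq_invLetter {ι : Type*} {u v : ι × Bool} (h : u.1 = v.1) :
    v = u ∨ v = invLetter u := by
  by_contra! hne
  exact hne.1 (Prod.ext h.symm (ne_invLetter_iff.1 hne.2 h).symm)

theorem fst_ne_of_natAbs_exponentDet_eq_one :
    ∀ {u v : Fin 2 × Bool}, (exponentDet (.mk [u]) (.mk [v])).natAbs = 1 → u.1 ≠ v.1 := by
  decide

theorem fst_eq_and_ne_of_natAbs_exponentDet_eq_one :
    ∀ {u v w : Fin 2 × Bool}, (exponentDet (.mk [u]) (.mk [v, w])).natAbs = 1 →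
      u.1 = v.1 ∧ u.1 ≠ w.1 ∨ u.1 = w.1 ∧ u.1 ≠ v.1 := by
  decide

theorem isNormalPair_of_isConj_mk_pair (htop : Subgroup.closure {s, t} = ⊤) (huv : u.1 = v.1)
    (huw : u.1 ≠ w.1) (hs : IsConj s (.mk [u])) (ht : IsConj t (.mk [v, w])) :
    IsNormalPair s t := by
  rw [mk_cons] at ht
  rcases eq_or_eq_invLetter huv with rfl | rfl
  · exact isNormalPair_of_isConj htop huw (Or.inr (Or.inl rfl)) hs (by rwa [zpow_one])
  · exact isNormalPair_of_isConj htop huw (Or.inr (Or.inr rfl)) hs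
      (by rwa [zpow_neg_one, ← mk_invLetter])

theorem isNormalPair_of_length_le_two (htop : Subgroup.closure {s, t} = ⊤)
    (hm : m ≠ []) (hlen : m.length ≤ 2) (hs : IsConj s (.mk [u])) (ht : IsConj t (.mk m)) :
    IsNormalPair s t := by
  have hdet := natAbs_exponentDet_of_closure_eq_top htop
  rw [exponentDet_eq_of_isConj hs ht] at hdet
  match m with
  | [v] =>
    exact isNormalPair_of_isConj htop (fst_ne_of_natAbs_exponentDet_eq_one hdet) (Or.inl rfl) hs
      (by rwa [zpow_zero, one_mul])
  | [v, w] =>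
    have hswap : IsConj (FreeGroup.mk [v, w]) (.mk [w, v]) := by
      rw [mk_cons v [w], mk_cons w [v]]
      exact isConj_iff.2 ⟨(FreeGroup.mk [v])⁻¹, by group⟩
    rcases fst_eq_and_ne_of_natAbs_exponentDet_eq_one hdet with ⟨huv, huw⟩ | ⟨huw, huv⟩
    · exact isNormalPair_of_isConj_mk_pair htop huv huw hs ht
    · exact isNormalPair_of_isConj_mk_pair htop huw huv hs (ht.trans hswap)
  | _ :: _ :: _ :: l => simp at hlen

theorem IsSchottky.isNormalPair_or_isNormalPair {g : Fin 2 → Equiv.Perm Sphere}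
    {D : Fin 2 × Bool → Circle} (h : IsSchottky g D) (htop : Subgroup.closure {s, t} = ⊤)
    {p q : Sphere} (hs : IsParabolicAt (FreeGroup.lift g s) p)
    (ht : IsParabolicAt (FreeGroup.lift g t) q) : IsNormalPair s t ∨ IsNormalPair t s := by
  obtain ⟨l, m, hl, hm, hlm, hsl, htm⟩ := h.exists_words htop hs ht
  have hlpos := List.length_pos_iff.2 hl
  have hmpos := List.length_pos_iff.2 hm
  rcases Nat.lt_or_ge 1 l.length with hl_two | hl_one
  · obtain ⟨u, rfl⟩ := List.length_eq_one_iff.1 (show m.length = 1 by omega)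
    rw [Set.pair_comm] at htop
    exact Or.inr (isNormalPair_of_length_le_two htop hl (by omega) htm hsl)
  · obtain ⟨u, rfl⟩ := List.length_eq_one_iff.1 (show l.length = 1 by omega)
    exact Or.inl (isNormalPair_of_length_le_two htop hm (by omega) hsl htm)

end NormalForm

theorem exists_lift_eq_and_closure_eq_top {ι H : Type*} [Group H] {g : ι → H}
    (hinj : Function.Injective (FreeGroup.lift g)) {a b : H}
    (h : Subgroup.closure (Set.range g) = Subgroup.closure {a, b}) :
    ∃ s t, FreeGroup.lift g s = a ∧ FreeGroup.lift g t = b ∧ Subgroup.closure {s, t} = ⊤ := by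
  have hrange : (FreeGroup.lift g).range = Subgroup.closure {a, b} := by
    rw [FreeGroup.range_lift_eq_closure, h]
  obtain ⟨s, hs⟩ : a ∈ (FreeGroup.lift g).range :=
    hrange ▸ Subgroup.subset_closure (Set.mem_insert a {b})
  obtain ⟨t, ht⟩ : b ∈ (FreeGroup.lift g).range :=
    hrange ▸ Subgroup.subset_closure (Set.mem_insert_of_mem a rfl)
  refine ⟨s, t, hs, ht, Subgroup.map_injective hinj ?_⟩
  rw [MonoidHom.map_closure, Set.image_pair, hs, ht, ← hrange, MonoidHom.range_eq_map]

theorem card_le_two_of_closure_eq_top {ι : Type*} [Fintype ι] {s t : FreeGroup ι}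
    (h : Subgroup.closure {s, t} = ⊤) : Fintype.card ι ≤ 2 := by
  let M := Multiplicative (ZMod 2)
  have hinj : Function.Injective fun f : ι → M => (FreeGroup.lift f s, FreeGroup.lift f t) := by
    intro f f' hff'
    rw [Prod.mk.injEq] at hff'
    refine FreeGroup.lift.injective (MonoidHom.eq_of_eqOn_dense h ?_)
    rintro _ (rfl | rfl)
    exacts [hff'.1, hff'.2]
  classical
  have hcard := Fintype.card_le_of_injective _ hinj
  rw [Fintype.card_fun, Fintype.card_prod, Fintype.card_multiplicative, ZMod.card, ← sq] at hcard
  exact (Nat.pow_le_pow_iff_right one_lt_two).1 hcard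

theorem S_mul_T_ne_T_mul_S {lam : ℂ} (hlam : lam ≠ 0) : S * T lam ≠ T lam * S := by
  intro h
  have hinfty : ((S * T lam) ∞ : Sphere) = (T lam * S) ∞ := by rw [h]
  simp only [Equiv.Perm.mul_apply, T_infty, S_infty, T_coe, OnePoint.coe_eq_coe] at hinfty
  apply hlam
  linear_combination -hinfty / 2

theorem IsClassicalTSchottky.exists_isSchottky {lam : ℂ} (hlam : lam ≠ 0)
    (h : IsClassicalTSchottky (G lam)) :
    ∃ (g : Fin 2 → Equiv.Perm Sphere) (D : Fin 2 × Bool → Circle), IsSchottky g D ∧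
      Subgroup.closure (Set.range g) = Subgroup.closure {S, T lam} := by
  obtain ⟨n, g, hg, hmarked⟩ := h
  obtain ⟨D, hD⟩ := hmarked.exists_isSchottky
  change _ = Subgroup.closure {S, T lam} at hg
  have hn : 2 ≤ n := by
    by_contra! hn
    have := Fin.subsingleton_iff_le_one.2 (Nat.lt_succ_iff.1 hn)
    have hcomm : IsMulCommutative (Subgroup.closure (Set.range g)) := by
      refine Subgroup.isMulCommutative_closure ?_
      rintro _ ⟨i, rfl⟩ _ ⟨j, rfl⟩
      rw [Subsingleton.elim i j]
    rw [hg] at hcomm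
    refine S_mul_T_ne_T_mul_S hlam (congrArg Subtype.val (hcomm.is_comm.comm
      ⟨S, Subgroup.subset_closure ?_⟩ ⟨T lam, Subgroup.subset_closure ?_⟩))
    exacts [Set.mem_insert _ _, Set.mem_insert_of_mem _ rfl]
  have := Fin.nontrivial_iff_two_le.2 hn
  obtain ⟨s, t, -, -, htop⟩ := exists_lift_eq_and_closure_eq_top hD.lift_injective hg
  obtain rfl : n = 2 :=
    le_antisymm (Fintype.card_fin n ▸ card_le_two_of_closure_eq_top htop) hn
  exact ⟨g, D, hD, hg⟩

/-! ### Classical T-Schottky groups -/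

section Inequalities

variable {l m b : ℂ} {a₁ a₂ : ℝ}

theorem two_le_norm_add_abs_im_of_norm_mul_norm_le (hm : m ≠ 0) (hb : b ≠ 0)
    (h : ‖m‖ * ‖b‖ + |(conj m * b).re| ≤ (conj m * l).re * b.re) : 2 ≤ ‖l‖ + |l.im| := by
  have hN : 0 < ‖m‖ * ‖b‖ := mul_pos (norm_pos_iff.2 hm) (norm_pos_iff.2 hb)
  have hsplit : 2 * ((conj m * l).re * b.re) =
      (l * (conj m * conj b)).re + (l.re * (conj m * b).re - l.im * (conj m * b).im) := by
    simp only [mul_re, mul_im, conj_re, conj_im]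
    ring
  have hfst : (l * (conj m * conj b)).re ≤ ‖l‖ * (‖m‖ * ‖b‖) := by
    simpa only [norm_mul, norm_conj] using re_le_norm (l * (conj m * conj b))
  have hre : l.re * (conj m * b).re ≤ ‖l‖ * |(conj m * b).re| := by
    refine (le_abs_self _).trans ?_
    rw [abs_mul]
    gcongr
    exact abs_re_le_norm l
  have him : -(l.im * (conj m * b).im) ≤ |l.im| * (‖m‖ * ‖b‖) := by
    refine (neg_le_abs _).trans ?_
    rw [abs_mul]
    gcongr
    simpa only [norm_mul, norm_conj] using abs_im_le_norm (conj m * b)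
  by_contra! hlt
  have hl : ‖l‖ * |(conj m * b).re| ≤ 2 * |(conj m * b).re| := by
    gcongr
    linarith [abs_nonneg l.im]
  linarith [mul_lt_mul_of_pos_right hlt hN]

theorem two_le_norm_add_abs_im_of_normSq_le (hb : 0 < b.re)
    (h₁ : normSq b ≤ (conj b * l).re * b.re) (h₂ : 2 * (conj b * l).re ≤ normSq l * b.re) :
    2 ≤ ‖l‖ + |l.im| := by
  set α := (conj b * l).re with hα
  set γ := (conj b * l).im with hγ
  set s := normSq l * b.re / 2 with hs
  have hα_pos : 0 < α := by
    have hb' : b ≠ 0 := by rintro rfl; simp at hb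
    exact pos_of_mul_pos_left ((normSq_pos.2 hb').trans_le h₁) hb.le
  have hαs : α ≤ s := by linarith
  have hγs : |γ| ≤ s := by
    refine abs_le_of_sq_le_sq ?_ (hα_pos.le.trans hαs)
    calc γ ^ 2 = normSq b * normSq l - α ^ 2 := by
          simp only [hα, hγ, normSq_apply, mul_re, mul_im, conj_re, conj_im]
          ring
      _ ≤ α * b.re * normSq l - α ^ 2 := by gcongr; exact normSq_nonneg l
      _ ≤ s ^ 2 := by linarith [sq_nonneg (s - α), show α * b.re * normSq l = 2 * α * s by ring]
  have hsum : 2 * s = l.re * α + l.im * γ := by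
    simp only [hs, hα, hγ, normSq_apply, mul_re, mul_im, conj_re, conj_im]
    ring
  have hre : l.re * α ≤ ‖l‖ * s := by
    calc l.re * α ≤ ‖l‖ * α := by gcongr; exact re_le_norm l
      _ ≤ ‖l‖ * s := by gcongr
  have him : l.im * γ ≤ |l.im| * s := by
    calc l.im * γ ≤ |l.im| * |γ| := by rw [← abs_mul]; exact le_abs_self _
      _ ≤ |l.im| * s := by gcongr
  refine le_of_mul_le_mul_right ?_ (hα_pos.trans_le hαs)
  linarith

theorem two_le_norm_add_abs_im_of_add_le_norm (ha₁ : 0 < a₁) (ha₂ : 0 < a₂)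
    (hsum : a₁ + a₂ = 2 * b.re) (h₁ : normSq b ≤ (conj b * l).re * a₁)
    (h₂ : normSq b ≤ (conj b * l).re * a₂)
    (hdist : ‖b‖ / a₁ + ‖b‖ / a₂ ≤ ‖b / a₁ + b / a₂ - 2 * l‖) : 2 ≤ ‖l‖ + |l.im| := by
  set α := (conj b * l).re with hα
  have hα_nonneg : 0 ≤ α := nonneg_of_mul_nonneg_left ((normSq_nonneg b).trans h₁) ha₁
  set R := 1 / a₁ + 1 / a₂ with hR
  have hRα : R * α ≤ normSq l := by
    have hsq : (R * ‖b‖) ^ 2 ≤ normSq (R * b - 2 * l) := by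
      have hnorm : R * ‖b‖ = ‖b‖ / a₁ + ‖b‖ / a₂ := by
        rw [hR]
        ring
      have hvec : R * b - 2 * l = b / a₁ + b / a₂ - 2 * l := by
        rw [hR]
        push_cast
        ring
      rw [normSq_eq_norm_sq, hnorm, hvec]
      gcongr
    have hexpand : normSq (R * b - 2 * l) = (R * ‖b‖) ^ 2 - 4 * (R * α) + 4 * normSq l := by
      rw [mul_pow, ← normSq_eq_norm_sq]
      simp only [hα, normSq_apply, conj_re, conj_im, mul_re, mul_im, sub_re, sub_im,
        ofReal_re, ofReal_im, re_ofNat, im_ofNat]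
      ring
    linarith
  have hRb : 2 ≤ R * b.re := by
    rw [hR, div_add_div _ _ ha₁.ne' ha₂.ne', div_mul_eq_mul_div, le_div_iff₀ (by positivity)]
    nlinarith [sq_nonneg (a₁ - a₂)]
  have hb : 0 < b.re := by linarith
  refine two_le_norm_add_abs_im_of_normSq_le hb ?_ ?_
  · linear_combination (h₁ + h₂) / 2 + α / 2 * hsum
  · calc 2 * α ≤ R * b.re * α := by gcongr
      _ = R * α * b.re := by ring
      _ ≤ normSq l * b.re := by gcongr

theorem four_mul_le_add_mul_add {x c₁ c₂ : ℝ} (hx : 0 ≤ x) (ha₁ : 0 < a₁) (ha₂ : 0 < a₂)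
    (h₁ : x ≤ c₁ * a₁) (h₂ : x ≤ c₂ * a₂) : 4 * x ≤ (c₁ + c₂) * (a₁ + a₂) := by
  have hc₁ : 0 ≤ c₁ := nonneg_of_mul_nonneg_left (hx.trans h₁) ha₁
  have hc₂ : 0 ≤ c₂ := nonneg_of_mul_nonneg_left (hx.trans h₂) ha₂
  have hcross : 2 * x ≤ c₁ * a₂ + c₂ * a₁ := by
    refine le_of_sq_le_sq ?_ (by positivity)
    linarith [sq_nonneg (c₁ * a₂ - c₂ * a₁), mul_le_mul h₁ h₂ hx (hx.trans h₁)]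
  linarith

theorem exists_pos_eq_neg_mul (hm : m ≠ 0) (hb : b ≠ 0)
    (h : ‖m‖ * ‖b‖ + (conj m * b).re ≤ 0) : ∃ κ : ℝ, 0 < κ ∧ m = -(κ * b) := by
  have hinner : inner ℝ m (-b) = ‖m‖ * ‖-b‖ := by
    refine le_antisymm (real_inner_le_norm _ _) ?_
    rw [Complex.inner, norm_neg, neg_mul, neg_re, mul_comm b]
    linarith
  obtain ⟨κ, hκ, heq⟩ := (sameRay_iff_norm_smul_eq.2
    (inner_eq_norm_mul_iff_real.1 hinner).symm).exists_pos_right hm (neg_ne_zero.2 hb)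
  exact ⟨κ, hκ, by rw [heq, real_smul, mul_neg]⟩

end Inequalities

namespace Circle

variable {C D E : Circle}

/-- The image of a circle, with its sides, under `S`. -/
def mapS (C : Circle) : Circle where
  a := C.a - 2 * C.b.re + C.c
  b := C.b - C.c
  c := C.c
  nondegenerate := by
    have h := C.nondegenerate
    simp only [normSq_apply, sub_re, sub_im, ofReal_re, ofReal_im] at h ⊢
    linarith

theorem isImage_mapS (C : Circle) : IsImage S C C.mapS := by
  intro p
  induction p using OnePoint.rec with
  | infty =>
    rw [S_infty]
    congr 1
    simp only [form_infty, form_coe, mapS, map_one, mul_one, conj_re, sub_re, ofReal_re]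
    ring
  | coe z =>
    rw [S_coe, sign_form_ofRatio _ (by rintro ⟨rfl, h⟩; simp at h)]
    congr 1
    simp only [hform, mapS, form_coe, normSq_apply, conj_re, conj_im, mul_re, mul_im, add_re,
      add_im, sub_re, sub_im, one_re, one_im, ofReal_re, ofReal_im]
    ring

/-- The image of a circle, with its sides, under `T l`. -/
def mapT (C : Circle) (l : ℂ) : Circle where
  a := C.a
  b := C.b - 2 * C.a * l
  c := C.c + 4 * C.a * normSq l - 4 * (conj C.b * l).re
  nondegenerate := by
    have h := C.nondegenerate
    simp only [normSq_apply, conj_re, conj_im, mul_re, mul_im, sub_re, sub_im, ofReal_re,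
      ofReal_im, re_ofNat, im_ofNat] at h ⊢
    linarith

theorem isImage_mapT (C : Circle) (l : ℂ) : IsImage (T l) C (C.mapT l) := by
  intro p
  congr 1
  induction p using OnePoint.rec with
  | infty => simp [mapT]
  | coe z =>
    simp only [T_coe, form_coe, mapT, normSq_apply, conj_re, conj_im, mul_re, mul_im, add_re,
      add_im, sub_re, sub_im, ofReal_re, ofReal_im, re_ofNat, im_ofNat]
    ring

section Flip

variable (l : ℂ)

theorem mapS_flip_a (hc : C.c = 0) : C.flip.mapS.a = 2 * C.b.re - C.a := by
  simp only [mapS, flip, hc, neg_re]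
  ring

theorem mapS_flip_b (hc : C.c = 0) : C.flip.mapS.b = -C.b := by
  simp [mapS, flip, hc]

theorem mapS_flip_c (hc : C.c = 0) : C.flip.mapS.c = 0 := by
  simp [mapS, flip, hc]

theorem mapT_flip_a (ha : C.a = 0) : (C.flip.mapT l).a = 0 := by
  simp [mapT, flip, ha]

theorem mapT_flip_b (ha : C.a = 0) : (C.flip.mapT l).b = -C.b := by
  simp [mapT, flip, ha]

theorem mapT_flip_c (ha : C.a = 0) : (C.flip.mapT l).c = 4 * (conj C.b * l).re - C.c := by
  simp only [mapT, flip, ha, map_neg, neg_mul, neg_re, neg_zero]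
  ring

end Flip

/-- The Euclidean centre of a circle. For lines, it has the junk value `0`. -/
def center (C : Circle) : ℂ := -(C.b / C.a)

/-- The Euclidean radius of a circle, with the sign of `a`. For lines, it has the junk value
`0`. -/
def radius (C : Circle) : ℝ := √(normSq C.b - C.a * C.c) / C.a

theorem center_mapT (hC : C.a ≠ 0) (l : ℂ) : (C.mapT l).center = C.center + 2 * l := by
  have : (C.a : ℂ) ≠ 0 := ofReal_ne_zero.2 hC
  simp only [center, mapT]
  field_simp
  ring

theorem radius_mapT (C : Circle) (l : ℂ) : (C.mapT l).radius = C.radius := by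
  simp only [radius, mapT]
  congr 2
  simp only [normSq_apply, conj_re, conj_im, mul_re, mul_im, sub_re, sub_im, ofReal_re,
      ofReal_im, re_ofNat, im_ofNat]
  ring

theorem radius_of_c_eq_zero (hC : C.c = 0) : C.radius = ‖C.b‖ / C.a := by
  rw [radius, hC, mul_zero, sub_zero, normSq_eq_norm_sq, Real.sqrt_sq (norm_nonneg _)]

theorem radius_pos (hC : 0 < C.a) : 0 < C.radius :=
  div_pos (Real.sqrt_pos.2 (sub_pos.2 C.nondegenerate)) hC

theorem form_coe_eq_of_a_ne_zero (hC : C.a ≠ 0) (z : ℂ) :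
    C.form z = C.a * (‖z - C.center‖ ^ 2 - C.radius ^ 2) := by
  have hcenter : C.center = -((C.a⁻¹ : ℝ) * C.b) := by
    rw [center, ofReal_inv, div_eq_inv_mul]
  rw [← normSq_eq_norm_sq, radius, div_pow, Real.sq_sqrt (sub_nonneg.2 C.nondegenerate.le),
    hcenter]
  simp only [form_coe, normSq_apply, conj_re, conj_im, mul_re, mul_im, sub_re, sub_im, neg_re,
    neg_im, ofReal_re, ofReal_im]
  field

theorem form_coe_neg_iff_mem_ball (hC : 0 < C.a) {z : ℂ} :
    C.form z < 0 ↔ z ∈ Metric.ball C.center C.radius := by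
  rw [form_coe_eq_of_a_ne_zero hC.ne', mem_ball_iff_norm, ← neg_pos, ← mul_neg,
    mul_pos_iff_of_pos_left hC, neg_pos, sub_neg, sq_lt_sq₀ (norm_nonneg _) (radius_pos hC).le]

theorem radius_add_radius_le_dist (hC : 0 < C.a) (hD : 0 < D.a)
    (h : Disjoint C.interior D.interior) : C.radius + D.radius ≤ dist C.center D.center := by
  rw [← disjoint_ball_ball_iff (radius_pos hC) (radius_pos hD), Set.disjoint_left]
  intro z hzC hzD
  rw [← form_coe_neg_iff_mem_ball hC] at hzC
  rw [← form_coe_neg_iff_mem_ball hD] at hzD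
  exact Set.disjoint_left.1 h hzC hzD

theorem two_mul_norm_mul_radius_le_form_center (hC : 0 < C.a) (hD : D.a = 0)
    (h : Disjoint C.interior D.interior) : 2 * (‖D.b‖ * C.radius) ≤ D.form C.center := by
  have hb : 0 < ‖D.b‖ := norm_pos_iff.2 (b_ne_zero_of_a_eq_zero hD)
  -- the point of the disc that lies furthest in the direction of the half-plane
  set z : ℂ := C.center + (-(C.radius / ‖D.b‖) : ℝ) * D.b with hz
  have hzC : C.form z = 0 := by
    rw [form_coe_eq_of_a_ne_zero hC.ne', hz, add_sub_cancel_left, norm_mul, norm_real,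
      Real.norm_eq_abs, abs_neg, abs_of_pos (div_pos (radius_pos hC) hb),
      div_mul_cancel₀ _ hb.ne', sub_self, mul_zero]
  have hzD := form_nonneg_of_disjoint h hzC.le
  have hexpand : D.form z = -(2 * (‖D.b‖ * C.radius)) + D.form C.center := by
    rw [hz, form_add_mul, hD, ofReal_zero, zero_mul, zero_mul, zero_mul, zero_add, zero_add,
      ← normSq_eq_conj_mul_self, ofReal_re, normSq_eq_norm_sq]
    field_simp
  linarith

theorem two_mul_norm_mul_norm_add_re_le (ha : 0 < C.a) (hc : C.c = 0) (hD : D.a = 0)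
    (h : Disjoint C.interior D.interior) :
    2 * (‖D.b‖ * ‖C.b‖ + (conj D.b * C.b).re) ≤ D.c * C.a := by
  have hle := two_mul_norm_mul_radius_le_form_center ha hD h
  have hform : D.form C.center = D.c - 2 * (conj D.b * C.b).re / C.a := by
    rw [form_coe, hD, center, mul_neg, neg_re, mul_div_assoc', div_ofReal_re]
    ring
  rw [radius_of_c_eq_zero hc, hform, mul_div_assoc', mul_div_assoc', le_sub_iff_add_le,
    ← add_div, div_le_iff₀ ha] at hle
  linarith

theorem a_pos_of_disjoint_halfPlanes (hD : D.a = 0) (hE : E.a = 0)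
    (hCD : Disjoint C.interior D.interior) (hCE : Disjoint C.interior E.interior)
    (hDE : Disjoint D.interior E.interior) : 0 < C.a :=
  (form_nonneg_of_disjoint hCD.symm (p := ∞) hD.le).lt_of_ne fun h =>
    not_pairwise_disjoint_halfPlanes h.symm hD hE hCD hCE hDE

end Circle

namespace Circle

variable {l : ℂ}

theorem two_le_norm_add_abs_im_of_paired {E E' H H' : Circle} (hE : IsImage S E.flip E')
    (hH : IsImage (T l) H.flip H') (hc : E.c = 0) (ha : H.a = 0)
    (hHH' : Disjoint H.interior H'.interior) (hEH : Disjoint E.interior H.interior)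
    (hEH' : Disjoint E.interior H'.interior) (hE'H : Disjoint E'.interior H.interior)
    (hE'H' : Disjoint E'.interior H'.interior) : 2 ≤ ‖l‖ + |l.im| := by
  rw [hE.interior_eq, ← (isImage_mapS _).interior_eq] at hE'H hE'H'
  rw [hH.interior_eq, ← (isImage_mapT _ _).interior_eq] at hHH' hEH' hE'H'
  set E₂ := E.flip.mapS
  set H₂ := H.flip.mapT l
  have hE₂a : E₂.a = 2 * E.b.re - E.a := mapS_flip_a hc
  have hE₂b : E₂.b = -E.b := mapS_flip_b hc
  have hE₂c : E₂.c = 0 := mapS_flip_c hc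
  have hH₂a : H₂.a = 0 := mapT_flip_a l ha
  have hH₂b : H₂.b = -H.b := mapT_flip_b l ha
  have hH₂c : H₂.c = 4 * (conj H.b * l).re - H.c := mapT_flip_c l ha
  have ha_pos := a_pos_of_disjoint_halfPlanes ha hH₂a hEH hEH' hHH'
  have ha₂_pos := a_pos_of_disjoint_halfPlanes ha hH₂a hE'H hE'H' hHH'
  have hle₁ := two_mul_norm_mul_norm_add_re_le ha_pos hc ha hEH
  have hle₂ := two_mul_norm_mul_norm_add_re_le ha_pos hc hH₂a hEH'
  have hle₃ := two_mul_norm_mul_norm_add_re_le ha₂_pos hE₂c ha hE'H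
  have hle₄ := two_mul_norm_mul_norm_add_re_le ha₂_pos hE₂c hH₂a hE'H'
  rw [hE₂b, norm_neg] at hle₃ hle₄
  rw [hH₂b, norm_neg, map_neg] at hle₂ hle₄
  rw [neg_mul, neg_re] at hle₂
  rw [mul_neg, neg_re] at hle₃
  rw [neg_mul_neg] at hle₄
  have hm := b_ne_zero_of_a_eq_zero ha
  have hb := b_ne_zero_of_c_eq_zero hc
  refine two_le_norm_add_abs_im_of_norm_mul_norm_le hm hb ?_
  have hre : |(conj H.b * E.b).re| ≤ ‖H.b‖ * ‖E.b‖ := by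
    simpa only [norm_mul, norm_conj] using abs_re_le_norm (conj H.b * E.b)
  obtain ⟨hlow, hupp⟩ := abs_le.1 hre
  have hplus := four_mul_le_add_mul_add (by linarith) ha_pos ha₂_pos hle₁ hle₄
  have hminus := four_mul_le_add_mul_add (by linarith) ha_pos ha₂_pos hle₂ hle₃
  rw [hE₂a, hH₂c] at hplus hminus
  rcases abs_cases (conj H.b * E.b).re with ⟨habs, -⟩ | ⟨habs, -⟩ <;> rw [habs] <;> linarith

theorem exists_pos_b_eq_neg_mul_of_disjoint {D P : Circle} (hDa : 0 < D.a) (hDc : D.c = 0)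
    (hPa : P.a = 0) (hPc : P.c = 0) (h : Disjoint D.interior P.interior) :
    ∃ κ : ℝ, 0 < κ ∧ P.b = -(κ * D.b) := by
  have hle := two_mul_norm_mul_norm_add_re_le hDa hDc hPa h
  rw [hPc, zero_mul] at hle
  exact exists_pos_eq_neg_mul (b_ne_zero_of_a_eq_zero hPa) (b_ne_zero_of_c_eq_zero hDc)
    (by linarith)

theorem normSq_le_of_le_form {P : Circle} {b : ℂ} {a κ : ℝ} (hPa : P.a = 0) (hPc : P.c = 0)
    (hκ : 0 < κ) (hPb : P.b = -(κ * b)) (ha : 0 < a)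
    (h : 2 * (‖P.b‖ * (‖b‖ / a)) ≤ P.form (b / a - 2 * l : ℂ)) :
    normSq b ≤ (conj b * l).re * a := by
  have hnorm : 2 * (‖P.b‖ * (‖b‖ / a)) = κ * (2 * normSq b / a) := by
    rw [hPb, norm_neg, norm_mul, norm_real, Real.norm_of_nonneg hκ.le, normSq_eq_norm_sq]
    ring
  have hform : P.form (b / a - 2 * l : ℂ) = κ * (4 * (conj b * l).re - 2 * normSq b / a) := by
    have hexpand : conj P.b * (b / a - 2 * l) =
        ((2 * κ : ℝ) : ℂ) * (conj b * l) - ((κ * normSq b / a : ℝ) : ℂ) := by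
      rw [hPb, map_neg, map_mul, conj_ofReal]
      push_cast
      rw [normSq_eq_conj_mul_self]
      ring
    rw [form_coe, hPa, hPc, hexpand, sub_re, re_ofReal_mul, ofReal_re]
    ring
  rw [hnorm, hform] at h
  have hle := le_of_mul_le_mul_left h hκ
  rw [← div_le_iff₀ ha]
  linarith [mul_div_assoc 2 (normSq b) a]

theorem two_le_norm_add_abs_im_of_slid {P P' Q Q' : Circle} (hP : IsImage (T l) P'.flip P)
    (hQ : IsImage (T (-l) * S) Q'.flip Q) (ha : P.a = 0) (hPc : P.c = 0) (hQ'c : Q'.c = 0)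
    (hPP' : Disjoint P.interior P'.interior) (hPQ : Disjoint P.interior Q.interior)
    (hPQ' : Disjoint P.interior Q'.interior) (hP'Q : Disjoint P'.interior Q.interior)
    (hP'Q' : Disjoint P'.interior Q'.interior) (hQQ' : Disjoint Q.interior Q'.interior) :
    2 ≤ ‖l‖ + |l.im| := by
  have hP' : IsImage (T (-l)) P.flip P' := T_inv l ▸ hP.flip_left.inv
  rw [hP'.interior_eq, ← (isImage_mapT _ _).interior_eq] at hPP' hP'Q hP'Q'
  rw [hQ.interior_eq, ← ((isImage_mapS _).trans (isImage_mapT _ _)).interior_eq] at hPQ hP'Q hQQ'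
  set P₁ := P.flip.mapT (-l)
  set Q₁ := Q'.flip.mapS.mapT (-l) with hQ₁
  have hP₁a : P₁.a = 0 := mapT_flip_a _ ha
  have hP₁b : P₁.b = -P.b := mapT_flip_b _ ha
  have hQ₁a : Q₁.a = 2 * Q'.b.re - Q'.a := mapS_flip_a hQ'c
  have ha₁ := a_pos_of_disjoint_halfPlanes ha hP₁a hPQ'.symm hP'Q'.symm hPP'
  have ha₂ := a_pos_of_disjoint_halfPlanes ha hP₁a hPQ.symm hP'Q.symm hPP'
  have hradius₁ : Q'.radius = ‖Q'.b‖ / Q'.a := radius_of_c_eq_zero hQ'c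
  have hradius₂ : Q₁.radius = ‖Q'.b‖ / Q₁.a := by
    rw [hQ₁, radius_mapT, radius_of_c_eq_zero (mapS_flip_c hQ'c), mapS_flip_b hQ'c, norm_neg]
    rfl
  have hcenter₂ : Q₁.center = Q'.b / Q₁.a - 2 * l := by
    rw [hQ₁, center_mapT (C := Q'.flip.mapS) ha₂.ne']
    rw [center, mapS_flip_b hQ'c, neg_div, neg_neg, mul_neg, ← sub_eq_add_neg]
    rfl
  -- `P` touches `Q'` at `0`, so their normals there are opposite to each other
  obtain ⟨κ, hκ, hPb⟩ := exists_pos_b_eq_neg_mul_of_disjoint ha₁ hQ'c ha hPc hPQ'.symm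
  refine two_le_norm_add_abs_im_of_add_le_norm ha₁ ha₂ (by rw [hQ₁a]; ring)
    (normSq_le_of_le_form ha hPc hκ hPb ha₁ ?_) (normSq_le_of_le_form ha hPc hκ hPb ha₂ ?_) ?_
  · have hle := two_mul_norm_mul_radius_le_form_center ha₁ hP₁a hP'Q'.symm
    rw [hP₁b, norm_neg, hradius₁] at hle
    refine hle.trans_eq ?_
    have hP₁c : P₁.c = 4 * (conj P.b * -l).re - P.c := mapT_flip_c _ ha
    simp only [form_coe, hP₁a, hP₁b, hP₁c, ha, hPc, center, two_mul, mul_add, mul_sub, mul_neg,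
      neg_mul, map_neg, add_re, sub_re, neg_re]
    ring
  · have hle := two_mul_norm_mul_radius_le_form_center ha₂ ha hPQ.symm
    rwa [hradius₂, hcenter₂] at hle
  · have hdist := radius_add_radius_le_dist ha₁ ha₂ hQQ'.symm
    rw [hradius₁, hradius₂, hcenter₂, dist_comm, dist_eq_norm, center, sub_neg_eq_add] at hdist
    refine hdist.trans_eq (congrArg norm ?_)
    ring

end Circle

theorem lift_conj {ι H : Type*} [Group H] (g : ι → H) (k : H) (x : FreeGroup ι) :
    FreeGroup.lift (fun i => k * g i * k⁻¹) x = k * FreeGroup.lift g x * k⁻¹ :=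
  (FreeGroup.lift_unique ((MulAut.conj k).toMonoidHom.comp (FreeGroup.lift g)) (by simp)).symm

namespace IsSchottky

variable {ι : Type*} {l : ℂ} {u v : ι × Bool} {g : ι → Equiv.Perm Sphere} {D : ι × Bool → Circle}

theorem form_eq_zero_of_letter (h : IsSchottky g D) {p : Sphere}
    (hp : IsParabolicAt (FreeGroup.lift g (.mk [u])) p) :
    (D u).form p = 0 ∧ (D (invLetter u)).form p = 0 :=
  h.form_head_eq_zero (List.cons_ne_nil u []) FreeGroup.IsReduced.singleton (ne_invLetter_self u) hp

theorem two_le_of_letters (h : IsSchottky g D) (hl : l ≠ 0) (huv : u.1 ≠ v.1)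
    (hT : FreeGroup.lift g (.mk [u]) = T l) (hS : FreeGroup.lift g (.mk [v]) = S) :
    2 ≤ ‖l‖ + |l.im| := by
  have hdisj {w w' : ι × Bool} (hw : w.1 = v.1) (hw' : w'.1 = u.1) :
      Disjoint (D w).interior (D w').interior :=
    h.disjoint fun heq => huv (by rw [← hw, ← hw', heq])
  have hform_T := (h.form_eq_zero_of_letter (hT ▸ isParabolicAt_T hl)).2
  have hform_S := (h.form_eq_zero_of_letter (hS ▸ isParabolicAt_S)).2
  have himage_S : Circle.IsImage S _ _ := hS ▸ h.isImage v
  have himage_T : Circle.IsImage (T l) _ _ := hT ▸ h.isImage u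
  refine Circle.two_le_norm_add_abs_im_of_paired himage_S himage_T ?_ hform_T
    (h.disjoint (ne_invLetter_self u).symm) (hdisj rfl rfl) (hdisj rfl rfl) (hdisj rfl rfl)
    (hdisj rfl rfl)
  simpa using hform_S

theorem two_le_of_letter_of_product (h : IsSchottky g D) (hl : l ≠ 0) (huv : u.1 ≠ v.1)
    (hT : FreeGroup.lift g (.mk [u]) = T l) (hS : FreeGroup.lift g (.mk [u, v]) = S) :
    2 ≤ ‖l‖ + |l.im| := by
  have hdisj {w w' : ι × Bool} (hw : w.1 = u.1) (hw' : w'.1 = v.1) :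
      Disjoint (D w).interior (D w').interior :=
    h.disjoint fun heq => huv (by rw [← hw, ← hw', heq])
  have hv : FreeGroup.lift g (.mk [v]) = T (-l) * S := by
    rw [← hS, ← T_inv, ← hT, mk_cons u [v], map_mul, inv_mul_cancel_left]
  have hform_T := (h.form_eq_zero_of_letter (hT ▸ isParabolicAt_T hl)).1
  have hform_S := h.form_head_eq_zero (List.cons_ne_nil u [v])
    (by simpa [FreeGroup.IsReduced] using fun heq => absurd heq huv)
    (fun heq => huv (congrArg Prod.fst heq :)) (hS ▸ isParabolicAt_S)
  have himage_T : Circle.IsImage (T l) _ _ := hT ▸ h.isImage u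
  have himage_v : Circle.IsImage (T (-l) * S) _ _ := hv ▸ h.isImage v
  refine Circle.two_le_norm_add_abs_im_of_slid himage_T himage_v hform_T ?_ ?_
    (h.disjoint (ne_invLetter_self u)) (hdisj rfl rfl) (hdisj rfl rfl) (hdisj rfl rfl)
    (hdisj rfl rfl) (h.disjoint (ne_invLetter_self v))
  · simpa using hform_S.1
  · simpa using hform_S.2

theorem two_le_of_letter_of_zpow_mul (h : IsSchottky g D) (hl : l ≠ 0) (huv : u.1 ≠ v.1) {e : ℤ}
    (he : e = 0 ∨ e = 1 ∨ e = -1) (hT : FreeGroup.lift g (.mk [u]) = T l)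
    (hS : FreeGroup.lift g (.mk [u] ^ e * .mk [v]) = S) : 2 ≤ ‖l‖ + |l.im| := by
  rcases he with rfl | rfl | rfl
  · rw [zpow_zero, one_mul] at hS
    exact h.two_le_of_letters hl huv hT hS
  · rw [zpow_one, ← mk_cons] at hS
    exact h.two_le_of_letter_of_product hl huv hT hS
  · rw [zpow_neg_one, ← mk_invLetter, ← mk_cons] at hS
    have hT' : FreeGroup.lift g (.mk [invLetter u]) = T (-l) := by
      rw [mk_invLetter, map_inv, hT, T_inv]
    simpa using h.two_le_of_letter_of_product (u := invLetter u) (neg_ne_zero.2 hl) huv hT' hS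

variable {s t : FreeGroup (Fin 2)} {g : Fin 2 → Equiv.Perm Sphere} {D : Fin 2 × Bool → Circle}

theorem two_le_of_isNormalPair (h : IsSchottky g D) (hl : l ≠ 0) (hst : IsNormalPair s t)
    {J : Equiv.Perm Sphere} (hJ : J ∈ mobius) (hT : J * FreeGroup.lift g s * J⁻¹ = T l)
    (hS : J * FreeGroup.lift g t * J⁻¹ = S) : 2 ≤ ‖l‖ + |l.im| := by
  obtain ⟨c, u, v, e, huv, he, rfl, rfl⟩ := hst
  obtain ⟨D', hD', -⟩ := h.exists_conj (mobius.mul_mem hJ (h.lift_mem c))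
  refine hD'.two_le_of_letter_of_zpow_mul hl huv he ?_ ?_
  · rw [lift_conj, ← hT, map_mul, map_mul, map_inv]
    group
  · rw [lift_conj, ← hS, map_mul _ (c * _), map_mul _ c, map_inv]
    group

theorem two_le (h : IsSchottky g D) (hl : l ≠ 0)
    (hg : Subgroup.closure (Set.range g) = Subgroup.closure {S, T l}) : 2 ≤ ‖l‖ + |l.im| := by
  obtain ⟨s, t, hs, ht, hst⟩ := exists_lift_eq_and_closure_eq_top h.lift_injective hg
  rcases h.isNormalPair_or_isNormalPair hst (hs ▸ isParabolicAt_S) (ht ▸ isParabolicAt_T hl) with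
    hnormal | hnormal
  · have hl' : 2 * l ≠ 0 := mul_ne_zero two_ne_zero hl
    refine h.two_le_of_isNormalPair hl hnormal (invol_mem_mobius (2 * l) hl') ?_ ?_
    · rw [hs, invol_mul_S, mul_div_cancel_left₀ l two_ne_zero, mul_inv_cancel_right]
    · rw [ht, invol_mul_T, mul_inv_cancel_right]
  · exact h.two_le_of_isNormalPair hl hnormal mobius.one_mem (by simpa using ht) (by simpa using hs)

end IsSchottky

theorem two_le_of_isClassicalTSchottky {lam : ℂ} (hlam : lam ≠ 0)
    (h : IsClassicalTSchottky (G lam)) : 2 ≤ ‖lam‖ + |lam.im| := by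
  obtain ⟨g, D, hD, hg⟩ := h.exists_isSchottky hlam
  exact hD.two_le hlam hg

theorem exists_unit_sqrt {w : ℂ} (hw : 0 ≤ w.re) :
    ∃ m : ℂ, normSq m = 1 ∧ 0 < m.re ∧ w = ‖w‖ * m ^ 2 := by
  refine ⟨exp ((arg w / 2 : ℝ) * I), ?_, ?_, ?_⟩
  · rw [normSq_eq_norm_sq, norm_exp_ofReal_mul_I, one_pow]
  · rw [exp_ofReal_mul_I_re]
    have := abs_le.1 (abs_arg_le_pi_div_two_iff.2 hw)
    exact Real.cos_pos_of_mem_Ioo ⟨by linarith [Real.pi_pos], by linarith [Real.pi_pos]⟩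
  · have hsq : exp ((arg w / 2 : ℝ) * I) ^ 2 = exp (arg w * I) := by
      rw [← exp_nat_mul]
      push_cast
      ring_nf
    rw [hsq, norm_mul_exp_arg_mul_I]

section UnitSqrt

variable {w m : ℂ} {r : ℝ}

theorem two_mul_re_sq (hm : normSq m = 1) (hw : w = r * m ^ 2) :
    2 * (m.re * (r * m.re)) = r + w.re := by
  rw [normSq_apply] at hm
  rw [hw, re_ofReal_mul, sq, mul_re]
  linear_combination r * hm

theorem conj_mul_re (hm : normSq m = 1) (hw : w = r * m ^ 2) :
    (conj m * w).re = r * m.re := by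
  have hconj : conj m * w = r * ((normSq m : ℝ) * m) := by
    rw [normSq_eq_conj_mul_self, hw]
    ring
  rw [hconj, hm, ofReal_one, one_mul, re_ofReal_mul]

end UnitSqrt

theorem normSq_add_I_mul (z : ℂ) : normSq (z + I * z) = 2 * normSq z := by
  rw [← one_add_mul, normSq_mul]
  norm_num [normSq_apply]

theorem normSq_sub_I_mul (z : ℂ) : normSq (z - I * z) = 2 * normSq z := by
  rw [← one_sub_mul, normSq_mul]
  norm_num [normSq_apply]

theorem G_neg (lam : ℂ) : G (-lam) = G lam := by
  have hmem (z : ℂ) : T (-z) ∈ G z := T_inv z ▸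
    Subgroup.inv_mem _ (Subgroup.subset_closure (Set.mem_insert_of_mem S rfl))
  have hS (z : ℂ) : S ∈ G z := Subgroup.subset_closure (Set.mem_insert S {T z})
  refine le_antisymm ?_ ?_ <;> refine (Subgroup.closure_le _).2 (Set.pair_subset (hS _) ?_)
  · exact hmem lam
  · simpa using hmem (-lam)

namespace Circle

variable {C D E : Circle}

theorem disjoint_of_add_nonneg (h : ∀ p, 0 ≤ C.form p + D.form p) :
    Disjoint C.interior D.interior :=
  Set.disjoint_left.2 fun p (hC : C.form p < 0) (hD : D.form p < 0) => by linarith [h p]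

theorem disjoint_of_normSq_le (hC : 0 < C.a) (hc : C.c = 0) (hD : D.a = 0)
    (h : normSq (C.b + D.b) ≤ C.a * D.c) : Disjoint C.interior D.interior := by
  refine disjoint_of_add_nonneg fun p => ?_
  induction p using OnePoint.rec with
  | infty => simp [hD, hC.le]
  | coe z =>
    have hsquare : C.a * (C.form z + D.form z) =
        normSq (C.a * z + (C.b + D.b)) + (C.a * D.c - normSq (C.b + D.b)) := by
      simp only [form_coe, hc, hD, normSq_apply, conj_re, conj_im, mul_re, mul_im, add_re, add_im,
        ofReal_re, ofReal_im]
      ring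
    refine nonneg_of_mul_nonneg_right ?_ hC
    linarith [normSq_nonneg (C.a * z + (C.b + D.b))]

theorem disjoint_of_b_eq_neg (ha : 0 ≤ C.a + D.a) (hb : D.b = -C.b) (hc : 0 ≤ C.c + D.c) :
    Disjoint C.interior D.interior := by
  refine disjoint_of_add_nonneg fun p => ?_
  induction p using OnePoint.rec with
  | infty => exact ha
  | coe z =>
    have := mul_nonneg ha (normSq_nonneg z)
    simp only [form_coe, hb, map_neg, neg_mul, neg_re]
    linarith

theorem isClassicalTSchottky_of_disjoint {l : ℂ} {E E' H H' : Circle}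
    (hE : IsImage S E.flip E') (hH : IsImage (T l) H.flip H')
    (hEE' : Disjoint E.interior E'.interior) (hHH' : Disjoint H.interior H'.interior)
    (hEH : Disjoint E.interior H.interior) (hEH' : Disjoint E.interior H'.interior)
    (hE'H : Disjoint E'.interior H.interior) (hE'H' : Disjoint E'.interior H'.interior) :
    IsClassicalTSchottky (G l) := by
  refine ⟨2, ![S, T l], by rw [Matrix.range_cons_cons_empty, G],
    Fin.forall_fin_two.2 ⟨S_mem_mobius, T_mem_mobius l⟩, ![E, H], ![E', H'], ?_,
    Fin.forall_fin_two.2 ⟨hE.image_exterior, hH.image_exterior⟩⟩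
  rintro (i | i) (j | j) hij <;> fin_cases i <;> fin_cases j <;>
    first
    | exact absurd rfl hij
    | assumption
    | exact Disjoint.symm (by assumption)

theorem isClassicalTSchottky_of_normSq_le {l : ℂ} {E H : Circle} (hEc : E.c = 0)
    (hEa : 0 < E.a) (hEb : E.b.re = E.a) (hHa : H.a = 0) (hHc : H.c = 2 * (conj H.b * l).re)
    (hadd : normSq (E.b + H.b) ≤ E.a * H.c) (hsub : normSq (E.b - H.b) ≤ E.a * H.c) :
    IsClassicalTSchottky (G l) := by
  have hHc_nonneg : 0 ≤ H.c := nonneg_of_mul_nonneg_right ((normSq_nonneg _).trans hadd) hEa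
  have hE'a : E.flip.mapS.a = E.a := by rw [mapS_flip_a hEc, hEb]; ring
  have hE'b := mapS_flip_b hEc
  have hE'c := mapS_flip_c hEc
  have hH'a := mapT_flip_a l hHa
  have hH'b := mapT_flip_b l hHa
  have hH'c : (H.flip.mapT l).c = H.c := by rw [mapT_flip_c l hHa, hHc]; ring
  refine isClassicalTSchottky_of_disjoint (isImage_mapS E.flip) (isImage_mapT H.flip l)
    (disjoint_of_b_eq_neg ?_ hE'b ?_) (disjoint_of_b_eq_neg ?_ hH'b ?_)
    (disjoint_of_normSq_le hEa hEc hHa hadd) (disjoint_of_normSq_le hEa hEc hH'a ?_)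
    (disjoint_of_normSq_le (hE'a ▸ hEa) hE'c hHa ?_)
    (disjoint_of_normSq_le (hE'a ▸ hEa) hE'c hH'a ?_)
  · rw [hE'a]
    exact add_nonneg hEa.le hEa.le
  · rw [hEc, hE'c, add_zero]
  · rw [hHa, hH'a, add_zero]
  · rw [hH'c]
    exact add_nonneg hHc_nonneg hHc_nonneg
  · rwa [hH'b, hH'c, ← sub_eq_add_neg]
  · rwa [hE'a, hE'b, neg_add_eq_sub, ← neg_sub, normSq_neg]
  · rwa [hE'a, hE'b, hH'b, hH'c, ← neg_add, normSq_neg]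

theorem isClassicalTSchottky_of_le_of_im_nonneg {lam : ℂ} (him : 0 ≤ lam.im)
    (h : 2 ≤ ‖lam‖ + lam.im) : IsClassicalTSchottky (G lam) := by
  have hre : (-I * lam).re = lam.im := by simp
  obtain ⟨m, hm, hmre, hw⟩ := exists_unit_sqrt (w := -I * lam) (by rwa [hre])
  rw [norm_mul, norm_neg, norm_I, one_mul] at hw
  have hle : 2 ≤ m.re * (2 * (‖lam‖ * m.re)) := by
    have := two_mul_re_sq hm hw
    rw [hre] at this
    linarith
  have hnormal : ‖lam‖ * m.re = (conj (I * m) * lam).re := by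
    rw [← conj_mul_re hm hw, map_mul, conj_I]
    ring_nf
  let E : Circle := ⟨m.re, m, 0, by simp [hm]⟩
  let H : Circle := ⟨0, I * m, 2 * (‖lam‖ * m.re), by simp [hm]⟩
  refine isClassicalTSchottky_of_normSq_le (E := E) (H := H) rfl hmre rfl rfl
    (congrArg (2 * ·) hnormal) ?_ ?_
  · rwa [normSq_add_I_mul, hm, mul_one]
  · rwa [normSq_sub_I_mul, hm, mul_one]

end Circle

theorem isClassicalTSchottky_of_le {lam : ℂ} (h : 2 ≤ ‖lam‖ + |lam.im|) :
    IsClassicalTSchottky (G lam) := by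
  rcases le_total 0 lam.im with him | him
  · rw [abs_of_nonneg him] at h
    exact Circle.isClassicalTSchottky_of_le_of_im_nonneg him h
  · rw [abs_of_nonpos him] at h
    rw [← G_neg]
    exact Circle.isClassicalTSchottky_of_le_of_im_nonneg (by simpa using him) (by simpa using h)

/-! ### Non-separating disjoint circle groups -/

/-- The half-turn `z ↦ -z` about the line `[0, ∞]`. -/
def negation : Equiv.Perm Sphere :=
  ofMatrix (Matrix.GeneralLinearGroup.mkOfDetNeZero !![-1, 0; 0, 1] (by simp))

theorem negation_mem_mobius : negation ∈ mobius := ofMatrix_mem_mobius _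

@[simp] theorem negation_coe (z : ℂ) : negation (z : Sphere) = ((-z : ℂ) : Sphere) := by
  simp [negation, ofMatrix_coe, ofRatio, Matrix.GeneralLinearGroup.mkOfDetNeZero]

@[simp] theorem negation_infty : negation ∞ = ∞ := by
  simp [negation, ofMatrix_infty, ofRatio, Matrix.GeneralLinearGroup.mkOfDetNeZero]

theorem negation_mul_self : negation * negation = 1 := by
  ext p
  induction p using OnePoint.rec with
  | infty => simp
  | coe z => simp

theorem mul_negation_mul_negation (k : Equiv.Perm Sphere) : k * negation * negation = k := by
  rw [mul_assoc, negation_mul_self, mul_one]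

theorem isHalfTurn_negation : IsHalfTurn negation ((0 : ℂ) : Sphere) ∞ := by
  refine ⟨by simp, negation_mem_mobius, by simp, by simp, fun h => ?_, negation_mul_self⟩
  have hone := Equiv.ext_iff.1 h ((1 : ℂ) : Sphere)
  norm_num at hone

theorem mul_negation_mul_self {k : Equiv.Perm Sphere} (hk : negation * k = k⁻¹ * negation) :
    k * negation * (k * negation) = 1 := by
  rw [mul_assoc, ← mul_assoc negation, hk, mul_negation_mul_negation, mul_inv_cancel]

theorem negation_mul_T (l : ℂ) : negation * T l = (T l)⁻¹ * negation := by
  rw [T_inv]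
  ext p
  induction p using OnePoint.rec with
  | infty => simp
  | coe z => simp [add_comm]

theorem negation_mul_S : negation * S = S⁻¹ * negation := by
  rw [eq_inv_mul_iff_mul_eq, S, negation, ← ofMatrix_mul, ← ofMatrix_mul]
  congr 1
  ext i j
  fin_cases i <;> fin_cases j <;>
    simp [Matrix.GeneralLinearGroup.mkOfDetNeZero, Matrix.mul_apply]

theorem isHalfTurn_S_mul_negation :
    IsHalfTurn (S * negation) ((0 : ℂ) : Sphere) ((2 : ℂ) : Sphere) := by
  refine ⟨by simp, mobius.mul_mem S_mem_mobius negation_mem_mobius, ?_, ?_, fun h => ?_,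
    mul_negation_mul_self negation_mul_S⟩
  · simp [S_coe, ofRatio]
  · norm_num [S_coe, ofRatio]
  · have hinfty := Equiv.ext_iff.1 h ∞
    simp [S_infty] at hinfty

theorem isHalfTurn_T_mul_negation (l : ℂ) : IsHalfTurn (T l * negation) ∞ (l : Sphere) := by
  refine ⟨by simp, mobius.mul_mem (T_mem_mobius l) negation_mem_mobius, by simp, ?_, fun h => ?_,
    mul_negation_mul_self (negation_mul_T l)⟩
  · simp [two_mul]
  · have hadd_one := Equiv.ext_iff.1 h ((l + 1 : ℂ) : Sphere)
    simp only [Equiv.Perm.mul_apply, negation_coe, T_coe, Equiv.Perm.one_apply,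
      OnePoint.coe_eq_coe] at hadd_one
    have : (-2 : ℂ) = 0 := by linear_combination hadd_one
    norm_num at this

theorem IsParabolicAt.isPerpendicularToAxis {f : Equiv.Perm Sphere} {u n n' : Sphere}
    (h : IsParabolicAt f u) (hu : u = n ∨ u = n') : IsPerpendicularToAxis n n' f :=
  Or.inl ⟨u, Set.ext h.apply_eq_iff, hu⟩

theorem isOrthoEnd_S_T {l : ℂ} (hl : l ≠ 0) :
    IsOrthoEnd S (T l) ((0 : ℂ) : Sphere) ((2 : ℂ) : Sphere) ((0 : ℂ) : Sphere) ∞ ∞ (l : Sphere) :=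
  ⟨isParabolicAt_S.isPerpendicularToAxis (Or.inl rfl),
    (isParabolicAt_T hl).isPerpendicularToAxis (Or.inr rfl), S * negation, negation, T l * negation,
    isHalfTurn_S_mul_negation, isHalfTurn_negation, isHalfTurn_T_mul_negation l,
    (mul_negation_mul_negation S).symm, (mul_negation_mul_negation (T l)).symm⟩

namespace Circle

variable {C D E : Circle}

theorem disjointOrTangent_of_disjoint (hCD : Disjoint C.interior D.interior)
    (hCE : Disjoint C.interior E.interior) (hDE : Disjoint D.interior E.interior) :
    C.DisjointOrTangent D := fun _ hp _ hq =>
  eq_of_common_of_disjoint hCD hCE hDE hp.1 hp.2 hq.1 hq.2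

theorem not_separates_of_disjoint (hCD : Disjoint C.interior D.interior)
    (hCE : Disjoint C.interior E.interior) : ¬ C.Separates D E := by
  rintro (⟨⟨p, hp, hneg⟩, -⟩ | ⟨-, ⟨p, hp, hneg⟩⟩)
  · exact (form_nonneg_of_disjoint hCD.symm (le_of_eq hp)).not_gt hneg
  · exact (form_nonneg_of_disjoint hCE.symm (le_of_eq hp)).not_gt hneg

theorem hasNSDCProperty_of_disjoint {a a' n n' b b' : Sphere} (ha : a ≠ a') (hn : n ≠ n')
    (hb : b ≠ b') (hCD : Disjoint C.interior D.interior) (hCE : Disjoint C.interior E.interior)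
    (hDE : Disjoint D.interior E.interior) (haC : a ∈ C.carrier) (ha'C : a' ∈ C.carrier)
    (hnD : n ∈ D.carrier) (hn'D : n' ∈ D.carrier) (hbE : b ∈ E.carrier) (hb'E : b' ∈ E.carrier) :
    HasNSDCProperty a a' n n' b b' :=
  ⟨ha, hn, hb, C, D, E, haC, ha'C, hnD, hn'D, hbE, hb'E,
    disjointOrTangent_of_disjoint hCD hCE hDE,
    disjointOrTangent_of_disjoint hDE hCD.symm hCE.symm,
    disjointOrTangent_of_disjoint hCE hCD hDE.symm,
    not_separates_of_disjoint hCD hCE, not_separates_of_disjoint hCD.symm hDE,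
    not_separates_of_disjoint hCE.symm hDE.symm⟩

theorem hasNSDCProperty_of_four_le {l : ℂ} (hl : 0 ≤ l.re) (h : 4 ≤ ‖l‖ + l.re) :
    HasNSDCProperty ((0 : ℂ) : Sphere) ((2 : ℂ) : Sphere) ((0 : ℂ) : Sphere) ∞ ∞ (l : Sphere) := by
  obtain ⟨m, hm, hmre, hml⟩ := exists_unit_sqrt hl
  have hle := two_mul_re_sq hm hml
  let A : Circle := ⟨m.re, -m, 0, by simp [hm]⟩
  let N : Circle := ⟨0, m, 0, by simp [hm]⟩
  let B : Circle := ⟨0, -m, 2 * (‖l‖ * m.re), by simp [hm]⟩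
  have hAN : Disjoint A.interior N.interior := disjoint_of_normSq_le hmre rfl rfl (by simp [A, N])
  have hNB : Disjoint N.interior B.interior :=
    disjoint_of_b_eq_neg (add_zero _).ge rfl (by simp only [N, B]; positivity)
  have hAB : Disjoint A.interior B.interior := by
    refine disjoint_of_normSq_le hmre rfl rfl ?_
    have hsum : normSq (A.b + B.b) = 4 := by
      rw [show A.b + B.b = -2 * m by simp only [A, B]; ring, normSq_mul, hm, normSq_neg]
      norm_num
    rw [hsum]
    change 4 ≤ m.re * (2 * (‖l‖ * m.re))
    linarith
  refine hasNSDCProperty_of_disjoint (by simp) (by simp) (by simp) hAN hAB hNB ?_ ?_ ?_ ?_ ?_ ?_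
  · simp [carrier, A]
  · simp [carrier, A]
    ring
  · simp [carrier, N]
  · simp [carrier, N]
  · simp [carrier, B]
  · simp only [carrier, Set.mem_ofPred_eq, form_coe, B, map_neg, neg_mul, neg_re,
      conj_mul_re hm hml]
    ring

end Circle

theorem isNSDC_of_le_of_re_nonneg {lam : ℂ} (hre : 0 ≤ lam.re) (h : 4 ≤ ‖lam‖ + lam.re) :
    IsNSDC (G lam) := by
  have hlam : lam ≠ 0 := by
    rintro rfl
    norm_num at h
  exact ⟨S, T lam, rfl, S_mem_mobius, T_mem_mobius lam, _, _, _, _, _, _, isOrthoEnd_S_T hlam,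
    Circle.hasNSDCProperty_of_four_le hre h⟩

theorem isNSDC_of_le {lam : ℂ} (h : 4 ≤ ‖lam‖ + |lam.re|) : IsNSDC (G lam) := by
  rcases le_total 0 lam.re with hre | hre
  · rw [abs_of_nonneg hre] at h
    exact isNSDC_of_le_of_re_nonneg hre h
  · rw [abs_of_nonpos hre] at h
    rw [← G_neg]
    exact isNSDC_of_le_of_re_nonneg (by simpa using hre) (by simpa using h)

namespace Circle

variable {C D E : Circle} {k : Equiv.Perm Sphere}

theorem exists_pos_form_ray_eq_zero (hC : C.a < 0) {z v : ℂ} (hv : v ≠ 0) (hz : 0 < C.form z) :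
    ∃ t : ℝ, 0 < t ∧ C.form ((z + t * v : ℂ) : Sphere) = 0 := by
  obtain ⟨t₁, ht₁, hneg⟩ :=
    ((eventually_gt_atTop 0).and (eventually_form_ray_neg_of_a_neg hC z hv)).exists
  have hcont : Continuous fun t : ℝ => C.form ((z + t * v : ℂ) : Sphere) := by
    simp only [form_add_mul]
    fun_prop
  have hz' : 0 < C.form ((z + (0 : ℝ) * v : ℂ) : Sphere) := by simpa using hz
  obtain ⟨t, ht, hroot⟩ :=
    intermediate_value_Ioo' ht₁.le hcont.continuousOn ⟨hneg, hz'⟩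
  exact ⟨t, ht.1, hroot⟩

theorem form_add_mul_I_mul_b (hC : C.a = 0) {z : ℂ} (hz : C.form z = 0) (t : ℝ) :
    C.form ((z + t * (I * C.b) : ℂ) : Sphere) = 0 := by
  have hperp : (conj C.b * (I * C.b)).re = 0 := by
    rw [mul_left_comm, ← normSq_eq_conj_mul_self, re_mul_ofReal, I_re, zero_mul]
  simp only [form_add_mul, hz, hC, ofReal_zero, hperp, zero_mul, mul_zero, zero_add,
    add_zero]

theorem not_disjointOrTangent_of_line (hC : C.a < 0) (hD : D.a = 0) {z : ℂ} (hCz : 0 < C.form z)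
    (hDz : D.form z = 0) : ¬ C.DisjointOrTangent D := by
  intro h
  have hv : I * D.b ≠ 0 := mul_ne_zero I_ne_zero (b_ne_zero_of_a_eq_zero hD)
  obtain ⟨t, ht, hCt⟩ := exists_pos_form_ray_eq_zero hC hv hCz
  obtain ⟨s, hs, hCs⟩ := exists_pos_form_ray_eq_zero hC (neg_ne_zero.2 hv) hCz
  have hDs := form_add_mul_I_mul_b hD hDz (-s)
  rw [ofReal_neg, neg_mul, ← mul_neg] at hDs
  have heq := h ⟨hCt, form_add_mul_I_mul_b hD hDz t⟩ ⟨hCs, hDs⟩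
  rw [OnePoint.coe_eq_coe, add_right_inj, mul_neg, ← neg_mul, mul_left_inj' hv, ← ofReal_neg,
    ofReal_inj] at heq
  linarith

theorem IsImage.carrier_eq (h : IsImage k C D) : D.carrier = k '' C.carrier := by
  ext p
  obtain ⟨q, rfl⟩ := k.surjective p
  simp [carrier, h.zero_iff]

theorem IsImage.disjointOrTangent {C' D' : Circle} (hC : IsImage k C C') (hD : IsImage k D D')
    (h : C.DisjointOrTangent D) : C'.DisjointOrTangent D' := by
  rw [DisjointOrTangent, hC.carrier_eq, hD.carrier_eq, ← Set.image_inter k.injective]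
  exact h.image k

theorem DisjointOrTangent.nonneg_or_nonpos (h : C.DisjointOrTangent D) :
    (∀ p ∈ D.carrier, 0 ≤ C.form p) ∨ (∀ p ∈ D.carrier, C.form p ≤ 0) := by
  by_contra! hcon
  obtain ⟨⟨p, hp, hCp⟩, q, hq, hCq⟩ := hcon
  obtain ⟨k, hk, hkp⟩ := exists_mobius_apply_eq_infty p
  obtain ⟨C', hC'⟩ := exists_isImage hk C
  obtain ⟨D', hD'⟩ := exists_isImage hk D
  rw [← hC'.neg_iff, hkp, form_infty] at hCp
  replace hp : D'.form (k p) = 0 := (hD'.zero_iff p).2 hp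
  rw [hkp, form_infty] at hp
  replace hq : D'.form (k q) = 0 := (hD'.zero_iff q).2 hq
  rw [← hC'.pos_iff] at hCq
  obtain ⟨z, hz⟩ := OnePoint.ne_infty_iff_exists.1 fun hqi : k q = ∞ =>
    (hqi ▸ hCq : 0 < C'.form ∞).not_gt hCp
  rw [← hz] at hq hCq
  exact not_disjointOrTangent_of_line hCp hp hCq hq (hC'.disjointOrTangent hD' h)

theorem normSq_mul_add (C : Circle) (z : ℂ) :
    normSq (C.a * z + C.b) = C.a * C.form z + (normSq C.b - C.a * C.c) := by
  simp only [form_coe, normSq_apply, conj_re, conj_im, mul_re, mul_im, add_re, add_im, ofReal_re,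
    ofReal_im]
  ring

theorem exists_form_eq_zero_and_form_neg (hC : C.a < 0) (hD : D.a < 0) {z : ℂ}
    (hCz : C.form z < 0) (hDz : 0 < D.form z) : ∃ p, D.form p = 0 ∧ C.form p < 0 := by
  -- `C.form` decreases along the ray that leaves `z` away from the centre of `C`
  set v : ℂ := -(C.a * z + C.b) with hv
  have hvpos : 0 < normSq v := by
    rw [hv, normSq_neg, normSq_mul_add]
    exact add_pos (mul_pos_of_neg_of_neg hC hCz) (sub_pos.2 C.nondegenerate)
  obtain ⟨t, ht, hDt⟩ := exists_pos_form_ray_eq_zero hD (normSq_pos.1 hvpos) hDz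
  have hslope : (conj (C.a * z + C.b) * v).re = -normSq v := by
    rw [hv, mul_neg, neg_re, ← normSq_eq_conj_mul_self, ofReal_re, normSq_neg]
  refine ⟨_, hDt, ?_⟩
  rw [form_add_mul, hslope]
  have hquad : C.a * normSq v * t ^ 2 < 0 :=
    mul_neg_of_neg_of_pos (mul_neg_of_neg_of_pos hC hvpos) (by positivity)
  linarith [mul_pos hvpos ht]

theorem disjoint_or_disjoint_flip (h : ∀ p ∈ D.carrier, 0 ≤ C.form p) :
    Disjoint C.interior D.interior ∨ Disjoint C.interior D.flip.interior := by
  by_contra! hcon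
  rw [interior_flip, Set.not_disjoint_iff, Set.not_disjoint_iff] at hcon
  obtain ⟨⟨p, hCp, hDp⟩, q, hCq, hDq⟩ := hcon
  obtain ⟨k, hk, hkp⟩ := exists_mobius_apply_eq_infty p
  obtain ⟨C', hC'⟩ := exists_isImage hk C
  obtain ⟨D', hD'⟩ := exists_isImage hk D
  replace hCp := (hC'.neg_iff p).2 hCp
  replace hDp := (hD'.neg_iff p).2 hDp
  replace hCq := (hC'.neg_iff q).2 hCq
  replace hDq := (hD'.pos_iff q).2 hDq
  rw [hkp, form_infty] at hCp hDp
  obtain ⟨z, hz⟩ := OnePoint.ne_infty_iff_exists.1 fun hqi : k q = ∞ =>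
    (hqi ▸ hDq : 0 < D'.form ∞).not_gt hDp
  rw [← hz] at hCq hDq
  obtain ⟨r, hDr, hCr⟩ := exists_form_eq_zero_and_form_neg hCp hDp hCq hDq
  exact (h _ ((hD'.inv.zero_iff r).2 hDr)).not_gt ((hC'.inv.neg_iff r).2 hCr)

theorem exists_orientation (hCD : C.DisjointOrTangent D) (hD : D.carrier.Nontrivial)
    (hs : ¬ C.Separates D E) :
    ∃ C' : Circle, (C' = C ∨ C' = C.flip) ∧ (∀ p ∈ D.carrier, 0 ≤ C'.form p) ∧
      ∀ p ∈ E.carrier, 0 ≤ C'.form p := by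
  obtain ⟨p, hp, hp0⟩ : ∃ p ∈ D.carrier, C.form p ≠ 0 := by
    by_contra! hsub
    exact (Set.not_subsingleton_iff.2 hD) fun x hx y hy => hCD ⟨hsub x hx, hx⟩ ⟨hsub y hy, hy⟩
  rw [Separates, not_or] at hs
  rcases hp0.lt_or_gt with hlt | hgt
  · refine ⟨C.flip, Or.inr rfl, ?_, fun q hq => ?_⟩
    · simpa using hCD.nonneg_or_nonpos.resolve_left fun h => (h p hp).not_gt hlt
    · rw [form_flip, Left.nonneg_neg_iff]
      exact not_lt.1 fun hq' => hs.1 ⟨⟨p, hp, hlt⟩, q, hq, hq'⟩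
  · refine ⟨C, Or.inl rfl, ?_, fun q hq => ?_⟩
    · exact hCD.nonneg_or_nonpos.resolve_right fun h => (h p hp).not_gt hgt
    · exact not_lt.1 fun hq' => hs.2 ⟨⟨p, hp, hgt⟩, q, hq, hq'⟩

theorem disjoint_of_nonneg (hCD : C.DisjointOrTangent D) (hC : C.carrier.Nontrivial)
    (hCnonneg : ∀ p ∈ D.carrier, 0 ≤ C.form p) (hDnonneg : ∀ p ∈ C.carrier, 0 ≤ D.form p) :
    Disjoint C.interior D.interior := by
  refine (disjoint_or_disjoint_flip hCnonneg).resolve_right fun h => ?_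
  have hsub : C.carrier ⊆ D.carrier := fun p hp => by
    have hnonpos := form_nonneg_of_disjoint h (le_of_eq hp)
    rw [form_flip, Left.nonneg_neg_iff] at hnonpos
    exact le_antisymm hnonpos (hDnonneg p hp)
  exact (Set.not_subsingleton_iff.2 hC) fun x hx y hy => hCD ⟨hx, hsub hx⟩ ⟨hy, hsub hy⟩

theorem carrier_eq_of_eq_or_eq_flip (h : D = C ∨ D = C.flip) : D.carrier = C.carrier := by
  rcases h with rfl | rfl
  · rfl
  · exact carrier_flip C

theorem DisjointOrTangent.symm (h : C.DisjointOrTangent D) : D.DisjointOrTangent C := by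
  rwa [DisjointOrTangent, Set.inter_comm]

end Circle

theorem exists_apply_eq_mul {h : Equiv.Perm Sphere} (hm : h ∈ mobius)
    (h0 : h ((0 : ℂ) : Sphere) = (0 : ℂ)) (hi : h ∞ = ∞) :
    ∃ α : ℂ, ∀ z : ℂ, h z = ((α * z : ℂ) : Sphere) := by
  obtain ⟨M, rfl⟩ := exists_eq_ofMatrix hm
  have hc : M 1 0 = 0 := by
    by_contra hc
    rw [ofMatrix_infty, ofRatio, if_neg hc] at hi
    exact OnePoint.coe_ne_infty _ hi
  have hd : M 1 1 ≠ 0 := by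
    have hdet := M.det_ne_zero
    rw [Matrix.det_fin_two, hc, mul_zero, sub_zero] at hdet
    exact right_ne_zero_of_mul hdet
  have hb : M 0 1 = 0 := by
    rw [ofMatrix_coe, hc, ofRatio, zero_mul, zero_add, if_neg hd, mul_zero, zero_add,
      OnePoint.coe_eq_coe] at h0
    exact (div_eq_zero_iff.1 h0).resolve_right hd
  refine ⟨M 0 0 / M 1 1, fun z => ?_⟩
  rw [ofMatrix_coe, hb, hc, ofRatio, zero_mul, zero_add, if_neg hd, add_zero, mul_div_right_comm]

theorem eq_negation {h : Equiv.Perm Sphere} (hh : IsHalfTurn h ((0 : ℂ) : Sphere) ∞) :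
    h = negation := by
  obtain ⟨-, hm, h0, hi, hne, hsq⟩ := hh
  obtain ⟨α, hα⟩ := exists_apply_eq_mul hm h0 hi
  have hαsq : α ^ 2 = 1 := by
    have := Equiv.ext_iff.1 hsq ((1 : ℂ) : Sphere)
    rw [Equiv.Perm.mul_apply, hα, hα, Equiv.Perm.one_apply, OnePoint.coe_eq_coe] at this
    linear_combination this
  have hα1 : α ≠ 1 := by
    rintro rfl
    refine hne (Equiv.ext fun p => ?_)
    induction p using OnePoint.rec with
    | infty => exact hi
    | coe z => rw [hα, one_mul]; rfl
  ext p
  induction p using OnePoint.rec with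
  | infty => rw [hi, negation_infty]
  | coe z => rw [hα, (sq_eq_one_iff.1 hαsq).resolve_left hα1, negation_coe, neg_one_mul]

theorem exists_mobius_zero_infty {x y : Sphere} (hxy : x ≠ y) :
    ∃ k ∈ mobius, k x = ((0 : ℂ) : Sphere) ∧ k y = ∞ := by
  obtain ⟨k, hk, hky⟩ := exists_mobius_apply_eq_infty y
  obtain ⟨z, hz⟩ := OnePoint.ne_infty_iff_exists.1 fun hx : k x = ∞ =>
    hxy (k.injective (hx.trans hky.symm))
  refine ⟨T (-z / 2) * k, mobius.mul_mem (T_mem_mobius _) hk, ?_, ?_⟩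
  · rw [Equiv.Perm.mul_apply, ← hz, T_coe]
    congr 1; ring
  · rw [Equiv.Perm.mul_apply, hky, T_infty]

theorem conj_mul_conj {h : Equiv.Perm Sphere} (hh : h * h = 1) (k : Equiv.Perm Sphere) :
    k * h * k⁻¹ * (k * h * k⁻¹) = 1 := by
  rw [show k * h * k⁻¹ * (k * h * k⁻¹) = k * (h * h) * k⁻¹ by group, hh, mul_one, mul_inv_cancel]

theorem IsHalfTurn.conjugate {h : Equiv.Perm Sphere} {x y : Sphere} (hh : IsHalfTurn h x y)
    {k : Equiv.Perm Sphere} (hk : k ∈ mobius) : IsHalfTurn (k * h * k⁻¹) (k x) (k y) := by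
  obtain ⟨hxy, hm, hx, hy, hne, hsq⟩ := hh
  refine ⟨k.injective.ne hxy, mobius.mul_mem (mobius.mul_mem hk hm) (mobius.inv_mem hk), ?_, ?_,
    mt conj_eq_one_iff.1 hne, conj_mul_conj hsq k⟩
  · simp only [Equiv.Perm.mul_apply, Equiv.Perm.coe_inv, k.symm_apply_apply, hx]
  · simp only [Equiv.Perm.mul_apply, Equiv.Perm.coe_inv, k.symm_apply_apply, hy]

/-- `h` is an involutive Möbius transformation that interchanges the sides of `C`, as a half-turn
does for every circle through its two fixed points. -/
structure SwapsSides (h : Equiv.Perm Sphere) (C : Circle) : Prop where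
  mem : h ∈ mobius
  mul_self : h * h = 1
  image : Circle.IsImage h C C.flip

namespace SwapsSides

variable {h : Equiv.Perm Sphere} {C : Circle}

theorem inv_eq (hh : SwapsSides h C) : h⁻¹ = h := inv_eq_of_mul_eq_one_left hh.mul_self

theorem apply_apply (hh : SwapsSides h C) (p : Sphere) : h (h p) = p :=
  Equiv.ext_iff.1 hh.mul_self p

theorem form_apply_nonpos_iff (hh : SwapsSides h C) (p : Sphere) :
    C.form (h p) ≤ 0 ↔ 0 ≤ C.form p := by
  rw [← neg_nonneg, ← Circle.form_flip, ← not_lt, hh.image.neg_iff, not_lt]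

theorem form_apply_eq_zero_iff (hh : SwapsSides h C) (p : Sphere) :
    C.form (h p) = 0 ↔ C.form p = 0 := by
  rw [← hh.image.zero_iff p, Circle.form_flip, neg_eq_zero]

theorem form_eq_zero (hh : SwapsSides h C) {p : Sphere} (hp : h p = p) : C.form p = 0 := by
  have := hh.form_apply_nonpos_iff p
  rw [hp] at this
  exact (le_total (C.form p) 0).elim (fun hle => hle.antisymm (this.1 hle))
    fun hge => (this.2 hge).antisymm hge

theorem ne_one (hh : SwapsSides h C) : h ≠ 1 := by
  rintro rfl
  obtain ⟨z, hz⟩ := C.exists_form_coe_neg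
  exact hz.ne (hh.form_eq_zero rfl)

theorem conjugate (hh : SwapsSides h C) {k : Equiv.Perm Sphere} (hk : k ∈ mobius) {D : Circle}
    (hD : Circle.IsImage k C D) : SwapsSides (k * h * k⁻¹) D := by
  refine ⟨mobius.mul_mem (mobius.mul_mem hk hh.mem) (mobius.inv_mem hk),
    conj_mul_conj hh.mul_self k, ?_⟩
  rw [mul_assoc]
  exact (hD.inv.trans hh.image).trans hD.flip

theorem of_negation (ha : C.a = 0) (hc : C.c = 0) : SwapsSides negation C := by
  refine ⟨negation_mem_mobius, negation_mul_self, fun p => ?_⟩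
  rw [Circle.form_flip]
  congr 1
  induction p using OnePoint.rec with
  | infty => rw [negation_infty, Circle.form_infty, ha, neg_zero]
  | coe z =>
    simp only [negation_coe, Circle.form_coe, ha, hc, mul_neg, neg_re, zero_mul, zero_add, add_zero,
      neg_neg]

end SwapsSides

theorem IsHalfTurn.swapsSides {h : Equiv.Perm Sphere} {x y : Sphere} (hh : IsHalfTurn h x y)
    {C : Circle} (hx : x ∈ C.carrier) (hy : y ∈ C.carrier) : SwapsSides h C := by
  obtain ⟨k, hk, hkx, hky⟩ := exists_mobius_zero_infty hh.1
  obtain ⟨D, hD⟩ := Circle.exists_isImage hk C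
  have hconj : k * h * k⁻¹ = negation := eq_negation (hkx ▸ hky ▸ hh.conjugate hk)
  have hc : D.c = 0 := by simpa [hkx] using (hD.zero_iff x).2 hx
  have ha : D.a = 0 := by simpa [hky] using (hD.zero_iff y).2 hy
  have hswap := (SwapsSides.of_negation ha hc).conjugate (mobius.inv_mem hk) hD.inv
  rwa [← hconj, show k⁻¹ * (k * h * k⁻¹) * k⁻¹⁻¹ = h by group] at hswap

theorem four_le_norm_add_abs_re_of_mul_le {l m : ℂ} (hm : m ≠ 0)
    (h : 2 * normSq m ≤ m.re * (conj m * l).re) : 4 ≤ ‖l‖ + |l.re| := by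
  have hpos : 0 < normSq m := normSq_pos.2 hm
  have hexpand : 2 * (m.re * (conj m * l).re) = normSq m * l.re + (conj m * conj m * l).re := by
    simp only [normSq_apply, conj_re, conj_im, mul_re, mul_im]
    ring
  have hnorm : (conj m * conj m * l).re ≤ normSq m * ‖l‖ := by
    refine (re_le_norm _).trans (le_of_eq ?_)
    rw [norm_mul, norm_mul, RCLike.norm_conj, normSq_eq_norm_sq, sq]
  have habs : normSq m * l.re ≤ normSq m * |l.re| :=
    mul_le_mul_of_nonneg_left (le_abs_self _) hpos.le
  refine le_of_mul_le_mul_left ?_ hpos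
  linarith

theorem Circle.four_le_norm_add_abs_re {C N D : Circle} {l : ℂ} (hC0 : C.c = 0)
    (hC2 : C.form ((2 : ℂ) : Sphere) = 0) (hNa : N.a = 0) (hN0 : N.c = 0) (hDa : D.a = 0)
    (hDl : D.form (l : Sphere) = 0) (hCN : Disjoint C.interior N.interior)
    (hCD : Disjoint C.interior D.interior) (hND : Disjoint N.interior D.interior) :
    4 ≤ ‖l‖ + |l.re| := by
  have hCa : C.a = -C.b.re := by
    rw [form_coe, hC0, mul_two (conj C.b), add_re, conj_re, normSq_ofNat] at hC2
    linarith
  have hpos : 0 < C.a := a_pos_of_disjoint_halfPlanes hNa hDa hCN hCD hND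
  obtain ⟨ν, hν, hDb⟩ : ∃ ν : ℝ, 0 < ν ∧ D.b = ν * C.b := by
    obtain ⟨κ, hκ, hNb⟩ := exists_pos_b_eq_neg_mul_of_disjoint hpos hC0 hNa hN0 hCN
    obtain ⟨μ, hμ, hDb⟩ := exists_b_eq_neg_mul hNa hDa hND
    exact ⟨μ * κ, mul_pos hμ hκ, by rw [hDb, hNb, ofReal_mul]; ring⟩
  have hle := two_mul_norm_mul_norm_add_re_le hpos hC0 hDa hCD
  have hsum : ‖D.b‖ * ‖C.b‖ + (conj D.b * C.b).re = 2 * (ν * normSq C.b) := by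
    rw [hDb, norm_mul, norm_real, Real.norm_of_nonneg hν.le, map_mul, conj_ofReal, mul_assoc ν,
      mul_assoc (ν : ℂ), ← normSq_eq_conj_mul_self, re_ofReal_mul, ofReal_re, normSq_eq_norm_sq]
    ring
  have hDc : D.c = -(2 * (ν * (conj C.b * l).re)) := by
    rw [form_coe, hDa, hDb, map_mul, conj_ofReal, mul_assoc, re_ofReal_mul] at hDl
    linear_combination hDl
  rw [hsum, hDc, hCa] at hle
  refine four_le_norm_add_abs_re_of_mul_le (b_ne_zero_of_c_eq_zero hC0)
    (le_of_mul_le_mul_left (?_ : 2 * ν * _ ≤ 2 * ν * _) (by positivity))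
  linarith

/-- `P` and `Q` are, up to a common conjugation in the Möbius group, the generators `S` and `T l`
of `G l`. -/
def IsStandardPair (l : ℂ) (P Q : Equiv.Perm Sphere) : Prop :=
  ∃ k ∈ mobius, SemiconjBy k P S ∧ SemiconjBy k Q (T l)

namespace IsStandardPair

variable {l : ℂ} {P Q : Equiv.Perm Sphere}

theorem refl (l : ℂ) : IsStandardPair l S (T l) :=
  ⟨1, mobius.one_mem, SemiconjBy.one_left _, SemiconjBy.one_left _⟩

theorem symm (h : IsStandardPair l P Q) (hl : l ≠ 0) : IsStandardPair l Q P := by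
  obtain ⟨k, hk, hP, hQ⟩ := h
  have hl2 : 2 * l ≠ 0 := mul_ne_zero two_ne_zero hl
  have hS : SemiconjBy (invol (2 * l) hl2) S (T l) := by
    simpa only [SemiconjBy, mul_div_cancel_left₀ l two_ne_zero] using invol_mul_S (2 * l) hl2
  exact ⟨_, mobius.mul_mem (invol_mem_mobius _ hl2) hk,
    SemiconjBy.mul_left (invol_mul_T l hl2) hQ, hS.mul_left hP⟩

theorem inv_right (h : IsStandardPair l P Q) : IsStandardPair (-l) P Q⁻¹ := by
  obtain ⟨k, hk, hP, hQ⟩ := h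
  exact ⟨k, hk, hP, T_inv l ▸ hQ.inv_right⟩

theorem inv_left (h : IsStandardPair l P Q) : IsStandardPair (-l) P⁻¹ Q := by
  obtain ⟨k, hk, hP, hQ⟩ := h
  have hS : SemiconjBy negation S⁻¹ S := by
    simpa only [inv_inv] using SemiconjBy.inv_right negation_mul_S
  have hT : SemiconjBy negation (T l) (T (-l)) := T_inv l ▸ negation_mul_T l
  exact ⟨_, mobius.mul_mem negation_mem_mobius hk, hS.mul_left hP.inv_right, hT.mul_left hQ⟩

theorem conjugate (h : IsStandardPair l P Q) {g : Equiv.Perm Sphere} (hg : g ∈ mobius) :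
    IsStandardPair l (g * P * g⁻¹) (g * Q * g⁻¹) := by
  obtain ⟨k, hk, hP, hQ⟩ := h
  exact ⟨k * g⁻¹, mobius.mul_mem hk (mobius.inv_mem hg),
    hP.mul_left (SemiconjBy.conj_mk g P).inv_symm_left,
    hQ.mul_left (SemiconjBy.conj_mk g Q).inv_symm_left⟩

theorem exists_isParabolicAt_right (h : IsStandardPair l P Q) (hl : l ≠ 0) :
    ∃ q, IsParabolicAt Q q := by
  obtain ⟨k, hk, -, hQ⟩ := h
  exact ⟨k⁻¹ ∞, k, hk, l, hl, by rw [Equiv.Perm.coe_inv, k.apply_symm_apply], hQ⟩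

theorem exists_isParabolicAt_left (h : IsStandardPair l P Q) (hl : l ≠ 0) :
    ∃ p, IsParabolicAt P p :=
  (h.symm hl).exists_isParabolicAt_right hl

end IsStandardPair

/-- Involutions `h i` that interchange the sides of circles `C i` with disjoint interiors. Two
generators `A`, `B` with the nsdc property are of the form `h i * h j` and `h k * h j` for such a
system of three circles. -/
structure IsTurnSystem {κ : Type*} (h : κ → Equiv.Perm Sphere) (C : κ → Circle) : Prop where
  swaps : ∀ i, SwapsSides (h i) (C i)
  disjoint : Pairwise fun i j => Disjoint (C i).interior (C j).interior

theorem IsMarkedNSDC.exists_isTurnSystem {A B : Equiv.Perm Sphere} (hAB : IsMarkedNSDC A B) :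
    ∃ (h : Fin 3 → Equiv.Perm Sphere) (C : Fin 3 → Circle),
      IsTurnSystem h C ∧ A = h 0 * h 1 ∧ B = h 2 * h 1 := by
  obtain ⟨-, -, a, a', n, n', b, b', ⟨-, -, hA, hN, hB, hAturn, hNturn, hBturn, hAeq, hBeq⟩,
    haa', hnn', -, CA, CN, CB, haC, ha'C, hnC, hn'C, hbC, hb'C, hAN, hNB, hABtan,
    hsepA, hsepN, hsepB⟩ := hAB
  have hAnt : CA.carrier.Nontrivial := ⟨a, haC, a', ha'C, haa'⟩
  have hNnt : CN.carrier.Nontrivial := ⟨n, hnC, n', hn'C, hnn'⟩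
  obtain ⟨DA, hDA, hDAN, hDAB⟩ := Circle.exists_orientation hAN hNnt hsepA
  obtain ⟨DN, hDN, hDNA, hDNB⟩ := Circle.exists_orientation hAN.symm hAnt hsepN
  obtain ⟨DB, hDB, hDBA, hDBN⟩ := Circle.exists_orientation hABtan.symm hAnt hsepB
  replace hDA := Circle.carrier_eq_of_eq_or_eq_flip hDA
  replace hDN := Circle.carrier_eq_of_eq_or_eq_flip hDN
  replace hDB := Circle.carrier_eq_of_eq_or_eq_flip hDB
  rw [Circle.DisjointOrTangent] at hAN hNB hABtan
  rw [← hDA] at haC ha'C hAnt hDNA hDBA hAN hABtan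
  rw [← hDN] at hnC hn'C hNnt hDAN hDBN hAN hNB
  rw [← hDB] at hbC hb'C hDAB hDNB hNB hABtan
  have hdAN := Circle.disjoint_of_nonneg hAN hAnt hDAN hDNA
  have hdAB := Circle.disjoint_of_nonneg hABtan hAnt hDAB hDBA
  have hdNB := Circle.disjoint_of_nonneg hNB hNnt hDNB hDBN
  refine ⟨![hA, hN, hB], ![DA, DN, DB], ⟨fun i => ?_, fun i j hij => ?_⟩, hAeq, hBeq⟩
  · fin_cases i
    exacts [hAturn.swapsSides haC ha'C, hNturn.swapsSides hnC hn'C, hBturn.swapsSides hbC hb'C]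
  · fin_cases i <;> fin_cases j
    exacts [absurd rfl hij, hdAN, hdAB, hdAN.symm, absurd rfl hij, hdNB, hdAB.symm, hdNB.symm,
      absurd rfl hij]

namespace IsTurnSystem

variable {κ : Type*} {h : κ → Equiv.Perm Sphere} {C : κ → Circle} {i j k : κ} {p q : Sphere}

theorem exists_conj (hT : IsTurnSystem h C) {g : Equiv.Perm Sphere} (hg : g ∈ mobius) :
    ∃ D, IsTurnSystem (fun i => g * h i * g⁻¹) D := by
  choose D hD using fun i => Circle.exists_isImage hg (C i)
  exact ⟨D, fun i => (hT.swaps i).conjugate hg (hD i),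
    fun i j hij => ((hD i).disjoint_iff (hD j)).2 (hT.disjoint hij)⟩

theorem mul_inv_eq (hT : IsTurnSystem h C) (i j : κ) : (h i * h j)⁻¹ = h j * h i := by
  rw [mul_inv_rev, (hT.swaps i).inv_eq, (hT.swaps j).inv_eq]

theorem conj_eq_inv (hT : IsTurnSystem h C) {Q : Equiv.Perm Sphere}
    (hQ : Q = h i * h j ∨ Q = (h i * h j)⁻¹) : h j * Q * (h j)⁻¹ = Q⁻¹ := by
  have hconj : h j * (h i * h j) * (h j)⁻¹ = (h i * h j)⁻¹ := by
    rw [← mul_assoc, mul_inv_cancel_right, hT.mul_inv_eq]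
  rcases hQ with rfl | rfl
  · exact hconj
  · rw [← _root_.conj_inv, hconj]

theorem form_apply_nonpos (hT : IsTurnSystem h C) (hij : i ≠ j) (hq : (C i).form q ≤ 0) :
    (C j).form (h j q) ≤ 0 :=
  ((hT.swaps j).form_apply_nonpos_iff q).2 (Circle.form_nonneg_of_disjoint (hT.disjoint hij) hq)

theorem disjoint_image (hT : IsTurnSystem h C) (hik : i ≠ k) (hjk : j ≠ k) {D : Circle}
    (hD : Circle.IsImage (h k) (C j) D) : Disjoint (C i).interior D.interior := by
  refine Set.disjoint_left.2 fun p hp hpD => ?_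
  have hj : (C j).form (h k p) < 0 := by
    rwa [← hD.neg_iff, (hT.swaps k).apply_apply]
  have hk := hT.form_apply_nonpos hjk hj.le
  rw [(hT.swaps k).apply_apply] at hk
  exact (Circle.form_nonneg_of_disjoint (hT.disjoint hik.symm) hk).not_gt hp

theorem exists_isSchottky (hT : IsTurnSystem h C) {ι : Type*} {f : ι → κ}
    (hf : Function.Injective f) (hfk : ∀ a, f a ≠ k) :
    ∃ D, IsSchottky (fun a => h (f a) * h k) D := by
  choose E hE using fun a => Circle.exists_isImage (hT.swaps k).mem (C (f a))
  refine ⟨fun v => bif v.2 then C (f v.1) else E v.1, isSchottky_of_isImage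
    (fun a => mobius.mul_mem (hT.swaps _).mem (hT.swaps k).mem) ?_ fun a => ?_⟩
  · rintro ⟨a, x⟩ ⟨b, y⟩ hne
    have hab : x = y → f a ≠ f b := fun hxy => hf.ne fun hab => hne (Prod.ext hab hxy)
    cases x <;> cases y
    · exact ((hE a).disjoint_iff (hE b)).2 (hT.disjoint (hab rfl))
    · exact (hT.disjoint_image (hfk b) (hfk a) (hE a)).symm
    · exact hT.disjoint_image (hfk a) (hfk b) (hE b)
    · exact hT.disjoint (hab rfl)
  · have hback := (hE a).flip.inv
    rw [(hT.swaps k).inv_eq] at hback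
    simpa only [Circle.flip_flip, cond_true, cond_false] using
      hback.trans (hT.swaps (f a)).image.flip

theorem form_nonpos_of_isParabolicAt (hT : IsTurnSystem h C) (hij : i ≠ j)
    (hp : IsParabolicAt (h i * h j) p) : (C i).form p ≤ 0 :=
  hp.form_nonpos fun _ hq => hT.form_apply_nonpos hij.symm (hT.form_apply_nonpos hij hq)

theorem form_eq_zero_of_isParabolicAt (hT : IsTurnSystem h C) (hij : i ≠ j)
    (hp : IsParabolicAt (h i * h j) p) : (C i).form p = 0 ∧ (C j).form p = 0 :=
  Circle.form_eq_zero_of_disjoint (hT.disjoint hij) (hT.form_nonpos_of_isParabolicAt hij hp)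
    (hT.form_nonpos_of_isParabolicAt hij.symm (hT.mul_inv_eq i j ▸ hp.inv))

theorem apply_eq_of_isParabolicAt (hT : IsTurnSystem h C) (hij : i ≠ j) (hik : i ≠ k)
    (hjk : j ≠ k) (hp : IsParabolicAt (h i * h j) p) : h j p = p := by
  obtain ⟨hi, hj⟩ := hT.form_eq_zero_of_isParabolicAt hij hp
  have hconj := hp.conjugate (hT.swaps j).mem
  rw [← mul_assoc, mul_inv_cancel_right] at hconj
  obtain ⟨hj', hi'⟩ := hT.form_eq_zero_of_isParabolicAt hij.symm hconj
  exact Circle.eq_of_common_of_disjoint (hT.disjoint hij) (hT.disjoint hik) (hT.disjoint hjk)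
    hi' hj' hi hj

theorem not_isParabolicAt_mul (hT : IsTurnSystem h C) (hij : i ≠ j) (hik : i ≠ k) (hjk : j ≠ k)
    (hp : IsParabolicAt (h i * h j) p) : ¬ IsParabolicAt (h i * h j * (h k * h j)) q := by
  intro hq
  obtain ⟨hip, hjp⟩ := hT.form_eq_zero_of_isParabolicAt hij hp
  have hiq : (C i).form q ≤ 0 := hq.form_nonpos fun r hr =>
    hT.form_apply_nonpos hij.symm <| hT.form_apply_nonpos hjk.symm <|
      hT.form_apply_nonpos hjk <| hT.form_apply_nonpos hij hr
  have hconj : IsParabolicAt (h j * h i * (h j * h k)) (h j q) := by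
    convert hq.conjugate (hT.swaps j).mem using 1
    group
  have hjq : (C j).form (h j q) ≤ 0 := hconj.form_nonpos fun r hr =>
    hT.form_apply_nonpos hij <| hT.form_apply_nonpos hij.symm <|
      hT.form_apply_nonpos hjk.symm <| hT.form_apply_nonpos hjk hr
  have hkq : (C k).form (h j q) ≤ 0 := by
    have hinv := hconj.inv
    rw [mul_inv_rev, hT.mul_inv_eq, hT.mul_inv_eq] at hinv
    exact hinv.form_nonpos fun r hr =>
      hT.form_apply_nonpos hjk <| hT.form_apply_nonpos hij <|
        hT.form_apply_nonpos hij.symm <| hT.form_apply_nonpos hjk.symm hr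
  obtain ⟨hjq0, hkq0⟩ := Circle.form_eq_zero_of_disjoint (hT.disjoint hjk) hjq hkq
  replace hjq0 := ((hT.swaps j).form_apply_eq_zero_iff q).1 hjq0
  have hiq0 := (Circle.form_eq_zero_of_disjoint (hT.disjoint hij) hiq hjq0.le).1
  have hqp : q = p := Circle.eq_of_common_of_disjoint (hT.disjoint hij) (hT.disjoint hik)
    (hT.disjoint hjk) hiq0 hjq0 hip hjp
  rw [hqp, hT.apply_eq_of_isParabolicAt hij hik hjk hp] at hkq0
  exact Circle.not_common_of_disjoint (hT.disjoint hij) (hT.disjoint hik) (hT.disjoint hjk)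
    hip hjp hkq0

theorem four_le_of_eq (hT : IsTurnSystem h C) (hij : i ≠ j) (hik : i ≠ k) (hjk : j ≠ k) {l : ℂ}
    (hl : l ≠ 0) (hS : h i * h j = S) (hTl : h k * h j = T l) : 4 ≤ ‖l‖ + |l.re| := by
  have hp0 : IsParabolicAt (h i * h j) ((0 : ℂ) : Sphere) := hS ▸ isParabolicAt_S
  have hpinf : IsParabolicAt (h k * h j) ∞ := hTl ▸ isParabolicAt_T hl
  have hneg : h j = negation := eq_negation ⟨OnePoint.coe_ne_infty 0, (hT.swaps j).mem,
    hT.apply_eq_of_isParabolicAt hij hik hjk hp0,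
    hT.apply_eq_of_isParabolicAt hjk.symm hik.symm hij.symm hpinf, (hT.swaps j).ne_one,
    (hT.swaps j).mul_self⟩
  have hmul : ∀ m, h m = h m * h j * negation := fun m => by
    rw [hneg, mul_negation_mul_negation]
  obtain ⟨hi0, hj0⟩ := hT.form_eq_zero_of_isParabolicAt hij hp0
  obtain ⟨hkinf, hjinf⟩ := hT.form_eq_zero_of_isParabolicAt hjk.symm hpinf
  have hi2 : (C i).form ((2 : ℂ) : Sphere) = 0 := (hT.swaps i).form_eq_zero <| by
    rw [hmul, hS]
    exact isHalfTurn_S_mul_negation.2.2.2.1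
  have hkl : (C k).form (l : Sphere) = 0 := (hT.swaps k).form_eq_zero <| by
    rw [hmul, hTl]
    exact (isHalfTurn_T_mul_negation l).2.2.2.1
  exact Circle.four_le_norm_add_abs_re (by simpa using hi0) hi2 hjinf (by simpa using hj0) hkinf
    hkl (hT.disjoint hij) (hT.disjoint hik) (hT.disjoint hjk)

theorem four_le_of_isStandardPair (hT : IsTurnSystem h C) (hij : i ≠ j) (hik : i ≠ k)
    (hjk : j ≠ k) {l : ℂ} (hl : l ≠ 0) (hst : IsStandardPair l (h i * h j) (h k * h j)) :
    4 ≤ ‖l‖ + |l.re| := by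
  obtain ⟨g, hg, hP, hQ⟩ := hst
  obtain ⟨D, hD⟩ := hT.exists_conj hg
  refine hD.four_le_of_eq hij hik hjk hl ?_ ?_
  · rw [conj_mul, hP.eq, mul_inv_cancel_right]
  · rw [conj_mul, hQ.eq, mul_inv_cancel_right]

theorem four_le_of_isStandardPair_mul (hT : IsTurnSystem h C) (hij : i ≠ j) (hik : i ≠ k)
    (hjk : j ≠ k) {l : ℂ} (hl : l ≠ 0) {Q : Equiv.Perm Sphere}
    (hQ : Q = h k * h j ∨ Q = (h k * h j)⁻¹) (hst : IsStandardPair l (h i * h j) (h i * h j * Q)) :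
    4 ≤ ‖l‖ + |l.re| := by
  rcases hQ with rfl | rfl
  · obtain ⟨p, hp⟩ := hst.exists_isParabolicAt_left hl
    obtain ⟨q, hq⟩ := hst.exists_isParabolicAt_right hl
    exact absurd hq (hT.not_isParabolicAt_mul hij hik hjk hp)
  · have hprod : h i * h j * (h k * h j)⁻¹ = h i * h k := by
      rw [hT.mul_inv_eq, mul_assoc, ← mul_assoc (h j), (hT.swaps j).mul_self, one_mul]
    rw [hprod] at hst
    have hexchange := hst.inv_left.inv_right
    rw [neg_neg, hT.mul_inv_eq, hT.mul_inv_eq] at hexchange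
    exact hT.four_le_of_isStandardPair hij.symm hjk hik hl hexchange

theorem four_le_of_isStandardPair_zpow_mul (hT : IsTurnSystem h C) (hij : i ≠ j) (hik : i ≠ k)
    (hjk : j ≠ k) {l : ℂ} (hl : l ≠ 0) {Q : Equiv.Perm Sphere}
    (hQ : Q = h k * h j ∨ Q = (h k * h j)⁻¹) {e : ℤ} (he : e = 0 ∨ e = 1 ∨ e = -1)
    (hst : IsStandardPair l (h i * h j) ((h i * h j) ^ e * Q)) : 4 ≤ ‖l‖ + |l.re| := by
  rcases he with rfl | rfl | rfl
  · rw [zpow_zero, one_mul] at hst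
    rcases hQ with rfl | rfl
    · exact hT.four_le_of_isStandardPair hij hik hjk hl hst
    · simpa using hT.four_le_of_isStandardPair hij hik hjk (neg_ne_zero.2 hl)
        (by simpa only [inv_inv] using hst.inv_right)
  · rw [zpow_one] at hst
    exact hT.four_le_of_isStandardPair_mul hij hik hjk hl hQ hst
  · -- conjugation by `h j` inverts both `h i * h j` and `Q`
    have hQconj : h j * ((h i * h j)⁻¹ * Q) * (h j)⁻¹ = h i * h j * Q⁻¹ := by
      rw [← _root_.conj_mul, hT.conj_eq_inv (Or.inr rfl), hT.conj_eq_inv hQ, inv_inv]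
    have hconj := (hst.conjugate (hT.swaps j).mem).inv_left
    rw [zpow_neg_one, hT.conj_eq_inv (Or.inl rfl), hQconj, inv_inv] at hconj
    simpa using hT.four_le_of_isStandardPair_mul hij hik hjk (neg_ne_zero.2 hl)
      (hQ.symm.imp (fun h => by rw [h, inv_inv]) (congrArg (·⁻¹))) hconj

theorem four_le_of_isNormalPair (hT : IsTurnSystem h C) {f : Fin 2 → κ}
    (hf : Function.Injective f) (hfj : ∀ a, f a ≠ j) {l : ℂ} (hl : l ≠ 0) {s t : FreeGroup (Fin 2)}
    (hst : IsNormalPair s t)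
    (hpair : IsStandardPair l (FreeGroup.lift (fun a => h (f a) * h j) s)
      (FreeGroup.lift (fun a => h (f a) * h j) t)) : 4 ≤ ‖l‖ + |l.re| := by
  obtain ⟨c, u, v, e, huv, he, rfl, rfl⟩ := hst
  obtain ⟨D, hD⟩ := hT.exists_isSchottky hf hfj
  set φ := FreeGroup.lift fun a => h (f a) * h j
  have hconj := hpair.conjugate (mobius.inv_mem (hD.lift_mem c))
  have hcancel : ∀ x, (φ c)⁻¹ * φ (c * x * c⁻¹) * (φ c)⁻¹⁻¹ = φ x := fun x => by
    rw [map_mul, map_mul, map_inv]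
    group
  rw [hcancel, hcancel, map_mul, map_zpow] at hconj
  have hletter : ∀ w : Fin 2 × Bool, φ (.mk [w]) = h (f w.1) * h j ∨
      φ (.mk [w]) = (h (f w.1) * h j)⁻¹ := by
    rintro ⟨a, x⟩
    cases x
    exacts [Or.inr (lift_mk_false _ a), Or.inl (lift_mk_true _ a)]
  rcases hletter u with hu | hu
  · rw [hu] at hconj
    exact hT.four_le_of_isStandardPair_zpow_mul (hfj u.1) (hf.ne huv) (hfj v.1).symm hl
      (hletter v) he hconj
  · rw [hu, inv_zpow'] at hconj
    have hinv := hconj.inv_left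
    rw [inv_inv] at hinv
    simpa using hT.four_le_of_isStandardPair_zpow_mul (hfj u.1) (hf.ne huv) (hfj v.1).symm
      (neg_ne_zero.2 hl) (hletter v) (by omega) hinv

theorem four_le_of_closure_eq (hT : IsTurnSystem h C) (hij : i ≠ j) (hik : i ≠ k) (hjk : j ≠ k)
    {l : ℂ} (hl : l ≠ 0) (hG : Subgroup.closure {h i * h j, h k * h j} = G l) :
    4 ≤ ‖l‖ + |l.re| := by
  have hf : Function.Injective ![i, k] := by
    simpa [Function.Injective, Fin.forall_fin_two, hik] using hik.symm
  have hfj : ∀ a, ![i, k] a ≠ j := by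
    simpa [Fin.forall_fin_two] using ⟨hij, hjk.symm⟩
  obtain ⟨D, hD⟩ := hT.exists_isSchottky hf hfj
  have hrange : Set.range (fun a => h (![i, k] a) * h j) = {h i * h j, h k * h j} := by
    simp [Set.ext_iff, Fin.exists_fin_two, eq_comm]
  obtain ⟨s, t, hs, ht, htop⟩ := exists_lift_eq_and_closure_eq_top hD.lift_injective
    ((congrArg Subgroup.closure hrange).trans hG)
  have hpair := IsStandardPair.refl l
  rcases hD.isNormalPair_or_isNormalPair htop (hs ▸ isParabolicAt_S) (ht ▸ isParabolicAt_T hl)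
    with hst | hts
  · exact hT.four_le_of_isNormalPair hf hfj hl hst (by rwa [hs, ht])
  · exact hT.four_le_of_isNormalPair hf hfj hl hts (by rw [hs, ht]; exact hpair.symm hl)

end IsTurnSystem

theorem four_le_of_isNSDC {lam : ℂ} (hlam : lam ≠ 0) (h : IsNSDC (G lam)) :
    4 ≤ ‖lam‖ + |lam.re| := by
  obtain ⟨A, B, hAB, hmarked⟩ := h
  obtain ⟨h, C, hT, rfl, rfl⟩ := hmarked.exists_isTurnSystem
  exact hT.four_le_of_closure_eq (by decide) (by decide) (by decide) hlam hAB

/-! ### The boundaries -/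

theorem nsdcSpace_eq : nsdcSpace = {lam | 4 ≤ ‖lam‖ + |lam.re|} := by
  ext lam
  refine ⟨fun h => four_le_of_isNSDC h.1 h.2, fun h => ⟨?_, isNSDC_of_le h⟩⟩
  rintro rfl
  norm_num at h

theorem classicalTSchottkySpace_eq : classicalTSchottkySpace = {lam | 2 ≤ ‖lam‖ + |lam.im|} := by
  ext lam
  refine ⟨fun h => two_le_of_isClassicalTSchottky h.1 h.2,
    fun h => ⟨?_, isClassicalTSchottky_of_le h⟩⟩
  rintro rfl
  norm_num at h

theorem frontier_setOf_le_of_homogeneous {E : Type*} [AddCommGroup E] [Module ℝ E]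
    [TopologicalSpace E] [ContinuousSMul ℝ E] {f : E → ℝ} (hf : Continuous f)
    (hhom : ∀ (t : ℝ) (z : E), 0 ≤ t → f (t • z) = t * f z) {c : ℝ} (hc : 0 < c) :
    frontier {z | c ≤ f z} = {z | f z = c} := by
  refine subset_antisymm (fun z hz => (frontier_le_subset_eq continuous_const hf hz).symm)
    fun z hz => ?_
  rw [Set.mem_ofPred_eq] at hz
  rw [frontier_eq_closure_inter_closure]
  refine ⟨subset_closure hz.ge, ?_⟩
  have htendsto : Tendsto (fun t : ℝ => t • z) (𝓝[<] 1) (𝓝 z) := by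
    have hcont : Continuous fun t : ℝ => t • z := by fun_prop
    simpa only [one_smul] using (hcont.tendsto 1).mono_left nhdsWithin_le_nhds
  refine mem_closure_of_tendsto htendsto ?_
  filter_upwards [Ioo_mem_nhdsLT (zero_lt_one' ℝ)] with t ht
  rw [Set.mem_compl_iff, Set.mem_ofPred_eq, hhom t z ht.1.le, hz, not_le]
  exact mul_lt_of_lt_one_left hc ht.2

theorem frontier_nsdcSpace : frontier nsdcSpace = {lam | ‖lam‖ + |lam.re| = 4} := by
  rw [nsdcSpace_eq]
  refine frontier_setOf_le_of_homogeneous (by fun_prop) (fun t z ht => ?_) (by norm_num)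
  rw [norm_smul, Real.norm_of_nonneg ht, smul_re, smul_eq_mul, abs_mul, abs_of_nonneg ht, mul_add]

theorem frontier_classicalTSchottkySpace :
    frontier classicalTSchottkySpace = {lam | ‖lam‖ + |lam.im| = 2} := by
  rw [classicalTSchottkySpace_eq]
  refine frontier_setOf_le_of_homogeneous (by fun_prop) (fun t z ht => ?_) (by norm_num)
  rw [norm_smul, Real.norm_of_nonneg ht, smul_im, smul_eq_mul, abs_mul, abs_of_nonneg ht, mul_add]

theorem norm_polar {r : ℝ} (hr : 0 ≤ r) (ω : ℝ) : ‖(r : ℂ) * exp (ω * I)‖ = r := by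
  rw [norm_mul, norm_exp_ofReal_mul_I, mul_one, norm_real, Real.norm_of_nonneg hr]

theorem norm_add_abs_re_polar {r : ℝ} (hr : 0 ≤ r) (ω : ℝ) :
    ‖(r : ℂ) * exp (ω * I)‖ + |((r : ℂ) * exp (ω * I)).re| = r * (1 + |Real.cos ω|) := by
  rw [norm_polar hr, re_ofReal_mul, exp_ofReal_mul_I_re, abs_mul, abs_of_nonneg hr, mul_one_add]

theorem norm_add_abs_im_polar {r : ℝ} (hr : 0 ≤ r) (ω : ℝ) :
    ‖(r : ℂ) * exp (ω * I)‖ + |((r : ℂ) * exp (ω * I)).im| = r * (1 + |Real.sin ω|) := by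
  rw [norm_polar hr, im_ofReal_mul, exp_ofReal_mul_I_im, abs_mul, abs_of_nonneg hr, mul_one_add]

theorem norm_add_abs_im_eq_iff_exists {c : ℝ} (hc : 0 ≤ c) {z : ℂ} :
    ‖z‖ + |z.im| = c ↔ ∃ ω : ℝ, z = c * exp (ω * I) / ((1 + |Real.sin ω| : ℝ) : ℂ) := by
  have hpos : ∀ ω : ℝ, 0 < 1 + |Real.sin ω| := fun ω => by positivity
  have hquot : ∀ ω : ℝ, c * exp (ω * I) / ((1 + |Real.sin ω| : ℝ) : ℂ) =
      ((c / (1 + |Real.sin ω|) : ℝ) : ℂ) * exp (ω * I) := fun ω => by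
    rw [ofReal_div, div_mul_eq_mul_div]
  simp only [hquot]
  constructor
  · intro h
    have hnorm := norm_add_abs_im_polar (norm_nonneg z) (arg z)
    rw [norm_mul_exp_arg_mul_I, h] at hnorm
    exact ⟨arg z, by rw [hnorm, mul_div_cancel_right₀ _ (hpos _).ne', norm_mul_exp_arg_mul_I]⟩
  · rintro ⟨ω, rfl⟩
    rw [norm_add_abs_im_polar (div_nonneg hc (hpos ω).le), div_mul_cancel₀ _ (hpos ω).ne']

/-- On the side `0 ≤ x` this is the parabola with focus `0` and directrix `x = c`. -/
theorem sqrt_add_abs_eq_iff {x y c : ℝ} (hc : 0 < c) :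
    √(x ^ 2 + y ^ 2) + |x| = c ↔ y ^ 2 = c ^ 2 - 2 * c * |x| := by
  rw [← eq_sub_iff_add_eq]
  constructor
  · intro h
    have hsq := Real.sq_sqrt (add_nonneg (sq_nonneg x) (sq_nonneg y))
    rw [h] at hsq
    linear_combination sq_abs x - hsq
  · intro h
    have hx : |x| ≤ c := by nlinarith [sq_nonneg y, abs_nonneg x]
    rw [Real.sqrt_eq_iff_eq_sq (by positivity) (sub_nonneg.2 hx)]
    linear_combination h - sq_abs x

theorem norm_add_abs_re_eq_iff {c : ℝ} (hc : 0 < c) {z : ℂ} :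
    ‖z‖ + |z.re| = c ↔ z.im ^ 2 = c ^ 2 - 2 * c * |z.re| := by
  rw [norm_eq_sqrt_sq_add_sq, sqrt_add_abs_eq_iff hc]

theorem norm_add_abs_im_eq_iff {c : ℝ} (hc : 0 < c) {z : ℂ} :
    ‖z‖ + |z.im| = c ↔ z.re ^ 2 = c ^ 2 - 2 * c * |z.im| := by
  rw [norm_eq_sqrt_sq_add_sq, add_comm (_ ^ 2), sqrt_add_abs_eq_iff hc]

end TwoParabolic

end

theorem theorem4p2 :
    (∀ r ω : ℝ, 0 < r →
      ((r : ℂ) * Complex.exp (ω * Complex.I) ∈ TwoParabolic.nsdcSpace ↔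
        4 ≤ r * (1 + |Real.cos ω|))) ∧
    (∀ r ω : ℝ, 0 < r →
      ((r : ℂ) * Complex.exp (ω * Complex.I) ∈ frontier TwoParabolic.nsdcSpace ↔
        r * (1 + |Real.cos ω|) = 4)) ∧
    frontier TwoParabolic.nsdcSpace = {lam : ℂ | lam.im ^ 2 = 16 - 8 * |lam.re|} ∧
    frontier TwoParabolic.classicalTSchottkySpace =
      {lam : ℂ | |lam.im| = 1 - lam.re ^ 2 / 4} ∧
    frontier TwoParabolic.classicalTSchottkySpace =
      {lam : ℂ | ∃ ω : ℝ,
        lam = 2 * Complex.exp (ω * Complex.I) / ((1 + |Real.sin ω| : ℝ) : ℂ)} := by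
  rw [TwoParabolic.frontier_nsdcSpace, TwoParabolic.nsdcSpace_eq,
    TwoParabolic.frontier_classicalTSchottkySpace]
  refine ⟨fun r ω hr => ?_, fun r ω hr => ?_, Set.ext fun z => ?_, Set.ext fun z => ?_,
    Set.ext fun z => ?_⟩
  · rw [Set.mem_ofPred_eq, TwoParabolic.norm_add_abs_re_polar hr.le]
  · rw [Set.mem_ofPred_eq, TwoParabolic.norm_add_abs_re_polar hr.le]
  · rw [Set.mem_ofPred_eq, Set.mem_ofPred_eq, TwoParabolic.norm_add_abs_re_eq_iff four_pos]
    norm_num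
  · rw [Set.mem_ofPred_eq, Set.mem_ofPred_eq, TwoParabolic.norm_add_abs_im_eq_iff two_pos]
    constructor <;> intro h <;> linarith
  · rw [Set.mem_ofPred_eq, Set.mem_ofPred_eq,
      TwoParabolic.norm_add_abs_im_eq_iff_exists zero_le_two, ofReal_ofNat]
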